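/- Let $u=(u_1,u_2,u_3)$ be coordinates on $\mathbb{C}^3$ and $\theta_i=u_i\,\partial/\partial u_i$. The Picard--Fuchs system of the mirror of the STU model is $\mathcal{L}_1f=\mathcal{L}_2f=\mathcal{L}_3f=0$, where (multiplication by $u_i$ acting first) $$\mathcal{L}_1=\theta_1(\theta_1-2\theta_2-2\theta_3)-12(6\theta_1-5)(6\theta_1-1)u_1,$$ $$\mathcal{L}_i=\theta_i^2-(2\theta_2+2\theta_3-\theta_1-2)(2\theta_2+2\theta_3-\theta_1-1)u_i\qquad(i=2,3).$$ Let $\varpi(u,\delta_0)$ be its solution holomorphic at $u=0$ with value $1$ there, and, for $1\le i\le 3$, let $\varpi(u,\delta_i)=\frac{\varpi(u,\delta_0)}{2\pi i}\log u_i+g_i(u)$ be its logarithmic solutions, with $g_i$ holomorphic at $0$ and $g_i(0)=0$. Put $T_i=\varpi(u,\delta_i)/\varpi(u,\delta_0)$ and $q_i=\exp(2\pi i\,T_i)$; the mirror map $u=u(q_1,q_2,q_3)$ is the local inverse of $u\mapsto q$, holomorphic at $q=0$ with $u(0)=0$. Put $\tau_1=T_1$, $\tau_2=T_1+T_2$ and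 $\widehat q_k=\exp(2\pi i\tau_k)$, so $\widehat q_1=q_1$ and $\widehat q_2=q_1q_2$. Regard $E_4$, $\eta^{24}$ and $j=E_4^3/\eta^{24}$ as functions of $q=\exp(2\pi i\tau)$, and put $\mu=1728$. These solutions and the mirror map exist, $j(q)=\frac1q+744+196884\,q+O(q^2)$ as $q\to0$, and the following hold, where $j_k=j(\widehat q_k)$ and $s_k=\sqrt{j_k(j_k-\mu)}$ is the branch $j_k(1-\mu/j_k)^{1/2}$ (principal root), which is asymptotic to $1/\widehat q_k$ as $\widehat q_k\to0$. 1. As $q\to 0$ with all $q_i\ne0$, $$u_1=\frac{2(j_1+j_2-\mu)}{j_1j_2+s_1s_2}+O(q_3),\qquad u_2=\frac{(j_1j_2+s_1s_2)^2}{4\,j_1j_2\,(j_1+j_2-\mu)^2}+O(q_3),$$ with the $O(q_3)$ uniform in a neighbourhood of $q=0$. 2. For all $(q_1,q_2)$ in a neighbourhood of $(0,0)$, $$\lim_{q_3\to0}\varpi(u(q_1,q_2,q_3),\delta_0)=E_4(\widehat q_1)^{1/4}\,E_4(\widehat q_2)^{1/4},$$ with principal fourth roots (equal to $1$ at $\widehat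 q_k=0$). -/

import Mathlib

open Complex Filter Topology Asymptotics

noncomputable section

namespace STU

/-! ### The Picard-Fuchs system of the mirror of the STU model

The coordinates `u₁, u₂, u₃` are `u 0, u 1, u 2`. -/

/-- The logarithmic derivative `θ_i f = u_i ∂f/∂u_i`. -/
def theta (i : Fin 3) (f : (Fin 3 → ℂ) → ℂ) : (Fin 3 → ℂ) → ℂ :=
  fun u => u i * fderiv ℂ f u (Pi.single i 1)

/-- `L₁ = θ₁ (θ₁ - 2 θ₂ - 2 θ₃) - 12 (6 θ₁ - 5) (6 θ₁ - 1) u₁`. In the second term `f` is first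
multiplied by `u₁` (giving `A`), then `6 θ₁ - 1` is applied (giving `B`), then `6 θ₁ - 5`. -/
def picardFuchs₁ (f : (Fin 3 → ℂ) → ℂ) : (Fin 3 → ℂ) → ℂ :=
  let A : (Fin 3 → ℂ) → ℂ := fun u => u 0 * f u
  let B : (Fin 3 → ℂ) → ℂ := fun u => 6 * theta 0 A u - A u
  fun u =>
    theta 0 (fun v => theta 0 f v - 2 * theta 1 f v - 2 * theta 2 f v) u
      - 12 * (6 * theta 0 B u - 5 * B u)

/-- The operator `θ_i² - (2 θ₂ + 2 θ₃ - θ₁ - 2) (2 θ₂ + 2 θ₃ - θ₁ - 1) u_i`;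
`L₂` is the case `i = 1` and `L₃` is the case `i = 2` (indices from `0`). -/
def picardFuchsBase (i : Fin 3) (f : (Fin 3 → ℂ) → ℂ) : (Fin 3 → ℂ) → ℂ :=
  let A : (Fin 3 → ℂ) → ℂ := fun u => u i * f u
  let B : (Fin 3 → ℂ) → ℂ := fun u => 2 * theta 1 A u + 2 * theta 2 A u - theta 0 A u - A u
  fun u =>
    theta i (theta i f) u
      - (2 * theta 1 B u + 2 * theta 2 B u - theta 0 B u - 2 * B u)

/-- `f` is annihilated at the point `u` by the three Picard-Fuchs operators. -/
def SolvesPicardFuchsAt (f : (Fin 3 → ℂ) → ℂ) (u : Fin 3 → ℂ) : Prop :=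
  picardFuchs₁ f u = 0 ∧ picardFuchsBase 1 f u = 0 ∧ picardFuchsBase 2 f u = 0

/-- `ϖ₀ = ϖ(u, δ₀)` is the solution of the system that is holomorphic at `u = 0`, with value `1`
there, and `ϖ i`, for `i = 0, 1, 2`, are the logarithmic solutions
`ϖ(u, δ_{i+1}) = ϖ₀ log u_{i+1} / (2πi) + O(u)`, the term `O(u)` being holomorphic at `0` and
vanishing there. The principal logarithm is used, so the equations for `ϖ i` are imposed off its
branch cut; a different branch changes `ϖ i` by an integer multiple of `ϖ₀`. -/
structure IsStandardPeriods (ϖ₀ : (Fin 3 → ℂ) → ℂ) (ϖ : Fin 3 → (Fin 3 → ℂ) → ℂ) : Prop where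
  analyticAt : AnalyticAt ℂ ϖ₀ 0
  apply_zero : ϖ₀ 0 = 1
  solves : ∀ᶠ u in 𝓝 0, SolvesPicardFuchsAt ϖ₀ u
  log_form : ∀ i, ∃ g : (Fin 3 → ℂ) → ℂ, AnalyticAt ℂ g 0 ∧ g 0 = 0 ∧
    ∀ᶠ u in 𝓝 0, (∀ j, u j ≠ 0) →
      ϖ i u = ϖ₀ u / (2 * Real.pi * I) * log (u i) + g u
  log_solves : ∀ i, ∀ᶠ u in 𝓝 0, (∀ j, u j ∈ slitPlane) → SolvesPicardFuchsAt (ϖ i) u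

/-- The mirror transformation `T_i = ϖ(u, δ_i) / ϖ(u, δ₀)`. -/
def mirrorT (ϖ₀ : (Fin 3 → ℂ) → ℂ) (ϖ : Fin 3 → (Fin 3 → ℂ) → ℂ) (i : Fin 3)
    (u : Fin 3 → ℂ) : ℂ :=
  ϖ i u / ϖ₀ u

/-- `U` is the mirror map, expressing `u` near `0` through the variables `q_i = exp (2πi T_i)`:
it is holomorphic at `q = 0`, sends `0` to `0`, and `exp (2πi T_i (U q)) = q_i`. -/
structure IsMirrorMap (ϖ₀ : (Fin 3 → ℂ) → ℂ) (ϖ : Fin 3 → (Fin 3 → ℂ) → ℂ)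
    (U : (Fin 3 → ℂ) → (Fin 3 → ℂ)) : Prop where
  analyticAt : AnalyticAt ℂ U 0
  apply_zero : U 0 = 0
  inverse : ∀ᶠ q in 𝓝 (0 : Fin 3 → ℂ), (∀ i, q i ≠ 0) →
    (∀ i, U q i ≠ 0) ∧ ∀ i, exp (2 * Real.pi * I * mirrorT ϖ₀ ϖ i (U q)) = q i

/-- `q̂₁ = exp (2πi τ₁)` with `τ₁ = T₁`. -/
def qHat₁ (q : Fin 3 → ℂ) : ℂ := q 0

/-- `q̂₂ = exp (2πi τ₂)` with `τ₂ = T₁ + T₂`. -/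
def qHat₂ (q : Fin 3 → ℂ) : ℂ := q 0 * q 1

/-! ### Modular forms as functions of the nome -/

/-- `E₄` as a function of `q = exp (2πiτ)`, with its value `1` at `q = 0`. -/
def E4 (q : ℂ) : ℂ := UpperHalfPlane.cuspFunction 1 ModularForm.E₄ q

/-- `η²⁴` as a function of `q = exp (2πiτ)`. -/
def eta24 (q : ℂ) : ℂ := UpperHalfPlane.cuspFunction 1 ModularForm.discriminant q

/-- The `j` function `j = E₄³ / η²⁴` as a function of `q = exp (2πiτ)`. -/
def j (q : ℂ) : ℂ := E4 q ^ 3 / eta24 q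

/-- The branch of `√(j (j - 1728))` that is asymptotic to `1/q` as `q → 0`. -/
def sqrtJ (q : ℂ) : ℂ := j q * (1 - 1728 / j q) ^ (1 / 2 : ℂ)

/-- The leading term of `u₁`, as a function of `a = q̂₁` and `b = q̂₂`. -/
def leadingU₁ (a b : ℂ) : ℂ :=
  2 * (j a + j b - 1728) / (j a * j b + sqrtJ a * sqrtJ b)

/-- The leading term of `u₂`, as a function of `a = q̂₁` and `b = q̂₂`. -/
def leadingU₂ (a b : ℂ) : ℂ :=
  (j a * j b + sqrtJ a * sqrtJ b) ^ 2 / (4 * j a * j b * (j a + j b - 1728) ^ 2)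

end STU

end

/-!
The system is solved by power series, and its restriction to the divisor `u₃ = 0` is matched with
Ramanujan's differential equations for `E₂`, `E₄` and `E₆`.

**Periods and mirror map.** The Frobenius series `∑ c(n + ρ) u^(n + ρ)` has coefficients that are
quotients of Gamma functions. With the exponent `ρ = κ ε` in the dual numbers, its first component
is the holomorphic solution and its second component is the holomorphic part of the logarithmic
one, so one computation in `ℂ[ε]` covers both (`frobeniusCoeff`, `picardFuchsLog₁_eq_zero`,
`picardFuchsBaseLog_eq_zero`). The coefficients grow at most exponentially
(`dualNorm_frobeniusCoeff_le`), and such a family is the family of Taylor coefficients of an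
analytic germ (`exists_analyticAt_taylorCoeff`). The map `u ↦ q` is then `u_i exp (2πi g_i / ϖ₀)`,
with derivative the identity at `0`, and the inverse function theorem gives the mirror map
(`exists_isMirrorMap`).

**Leading order.** Write `e = E₄^(1/4)` and `w = E₆ / E₄^(3/2) = (1 - 1728/j)^(1/2)`. Ramanujan's
equations say, for `D = q d/dq`,
`D e = e (E₂ - w e²) / 12`, `D w = -(1 - w²) e² / 2`, `D E₂ = (E₂² - e⁴) / 12`.
With `w` taken at `q̂₁` and `v` the same function at `q̂₂`, the asserted leading terms of `u₁, u₂`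
are `(1 - w v) / 864` and `(1 - w²) (1 - v²) / (4 (1 - w v)²)` (`leadingPoint`). Let `F` be a
solution of the system. The second derivative of `F(leadingPoint w v) / (e(q̂₁) e(q̂₂))` with respect
to `log q̂₁` is a combination of `L₁ F` and `L₂ F` on `u₃ = 0`, so it vanishes
(`exists_hasDerivAt_zero_of_solves`); by symmetry the same holds for `q̂₂`.

For `F = ϖ₀` this quotient is an analytic function of `q₁, q₂`, hence constant, because the Euler
derivations act on monomials by their exponents (`eventually_eq_const_of_euler`). It is therefore
equal to `1`, which is the formula for the period (`period_leadMap`). For `F = ϖ(u, δ_i)` the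
quotient is `log q_i / (2πi)` plus an analytic function `H` vanishing at `0`, so that `H = 0`
(`log_leadUnit`). This says that `u ↦ q` maps the asserted leading term to `(q₁, q₂, 0)`. As the
mirror map is inverse to `u ↦ q`, it takes the asserted values on the divisor `q₃ = 0`
(`IsMirrorMap.apply_divisor`), and it differs from them by `O(q₃)` elsewhere, being Lipschitz.

The expansion of `j` follows from the `q`-expansions of `E₄` and `E₆` and `1728 η²⁴ = E₄³ - E₆²`
(`j_expansion`).
-/

noncomputable section

namespace STU

/-! ### Taylor coefficients of analytic germs in three variables -/

/-- The partial derivative `∂f/∂u_i`. -/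
def partialDeriv (i : Fin 3) (f : (Fin 3 → ℂ) → ℂ) : (Fin 3 → ℂ) → ℂ :=
  fun u => fderiv ℂ f u (Pi.single i 1)

theorem partialDeriv_analyticAt {f : (Fin 3 → ℂ) → ℂ} {u : Fin 3 → ℂ} (hf : AnalyticAt ℂ f u)
    (i : Fin 3) : AnalyticAt ℂ (partialDeriv i f) u :=
  ((ContinuousLinearMap.apply ℂ ℂ (Pi.single i 1 : Fin 3 → ℂ)).analyticAt _).comp_of_eq
    hf.fderiv rfl

theorem partialDeriv_congr {f g : (Fin 3 → ℂ) → ℂ} {u : Fin 3 → ℂ} (h : f =ᶠ[𝓝 u] g)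
    (i : Fin 3) : partialDeriv i f =ᶠ[𝓝 u] partialDeriv i g :=
  h.fderiv.fun_comp fun L => L (Pi.single i 1)

theorem partialDeriv_comm {f : (Fin 3 → ℂ) → ℂ} {u : Fin 3 → ℂ} (hf : AnalyticAt ℂ f u)
    (i j : Fin 3) :
    partialDeriv i (partialDeriv j f) =ᶠ[𝓝 u] partialDeriv j (partialDeriv i f) := by
  filter_upwards [hf.eventually_analyticAt] with v hv
  have key : ∀ k l : Fin 3, partialDeriv k (partialDeriv l f) v =
      fderiv ℂ (fderiv ℂ f) v (Pi.single k 1) (Pi.single l 1) := by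
    intro k l
    unfold partialDeriv
    rw [fderiv_clm_apply hv.fderiv.differentiableAt (differentiableAt_const _)]
    simp
  rw [key, key]
  exact (hv.contDiffAt.isSymmSndFDerivAt (n := ⊤) (by simp)).eq _ _

theorem partialDeriv_add {f g : (Fin 3 → ℂ) → ℂ} {u : Fin 3 → ℂ} (hf : AnalyticAt ℂ f u)
    (hg : AnalyticAt ℂ g u) (i : Fin 3) :
    partialDeriv i (fun v => f v + g v) =ᶠ[𝓝 u]
      fun v => partialDeriv i f v + partialDeriv i g v := by
  filter_upwards [hf.eventually_analyticAt, hg.eventually_analyticAt] with v hv hv'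
  simp [partialDeriv, fderiv_fun_add hv.differentiableAt hv'.differentiableAt]

theorem partialDeriv_const_mul {f : (Fin 3 → ℂ) → ℂ} {u : Fin 3 → ℂ} (hf : AnalyticAt ℂ f u)
    (c : ℂ) (i : Fin 3) :
    partialDeriv i (fun v => c * f v) =ᶠ[𝓝 u] fun v => c * partialDeriv i f v := by
  filter_upwards [hf.eventually_analyticAt] with v hv
  simp [partialDeriv, fderiv_const_mul hv.differentiableAt]

theorem analyticAt_coord (i : Fin 3) (u : Fin 3 → ℂ) :
    AnalyticAt ℂ (fun v : Fin 3 → ℂ => v i) u :=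
  (ContinuousLinearMap.proj (R := ℂ) (φ := fun _ : Fin 3 => ℂ) i).analyticAt u

theorem hasFDerivAt_coord (i : Fin 3) (u : Fin 3 → ℂ) :
    HasFDerivAt (fun v : Fin 3 → ℂ => v i)
      (ContinuousLinearMap.proj (R := ℂ) (φ := fun _ : Fin 3 => ℂ) i) u :=
  (ContinuousLinearMap.proj (R := ℂ) (φ := fun _ : Fin 3 => ℂ) i).hasFDerivAt

theorem partialDeriv_coord_mul {f : (Fin 3 → ℂ) → ℂ} {u : Fin 3 → ℂ} (hf : AnalyticAt ℂ f u)
    (i j : Fin 3) :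
    partialDeriv j (fun v => v i * f v) =ᶠ[𝓝 u]
      fun v => v i * partialDeriv j f v + (if i = j then 1 else 0) * f v := by
  filter_upwards [hf.eventually_analyticAt] with v hv
  unfold partialDeriv
  rw [((hasFDerivAt_coord i v).fun_mul hv.differentiableAt.hasFDerivAt).fderiv]
  by_cases h : i = j
  · subst h; simp
  · simp [h]

/-- The mixed partial derivative of multi-index `n`. -/
def mixedPartial (n : Fin 3 → ℕ) (f : (Fin 3 → ℂ) → ℂ) : (Fin 3 → ℂ) → ℂ :=
  (partialDeriv 0)^[n 0] ((partialDeriv 1)^[n 1] ((partialDeriv 2)^[n 2] f))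

theorem iterate_partialDeriv_analyticAt {f : (Fin 3 → ℂ) → ℂ} {u : Fin 3 → ℂ}
    (hf : AnalyticAt ℂ f u) (i : Fin 3) (k : ℕ) : AnalyticAt ℂ ((partialDeriv i)^[k] f) u := by
  induction k with
  | zero => exact hf
  | succ k ih => rw [Function.iterate_succ_apply']; exact partialDeriv_analyticAt ih i

theorem iterate_partialDeriv_congr {f g : (Fin 3 → ℂ) → ℂ} {u : Fin 3 → ℂ} (h : f =ᶠ[𝓝 u] g)
    (i : Fin 3) (k : ℕ) : (partialDeriv i)^[k] f =ᶠ[𝓝 u] (partialDeriv i)^[k] g := by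
  induction k with
  | zero => exact h
  | succ k ih =>
    rw [Function.iterate_succ_apply', Function.iterate_succ_apply']
    exact partialDeriv_congr ih i

theorem iterate_partialDeriv_comm {f : (Fin 3 → ℂ) → ℂ} {u : Fin 3 → ℂ} (hf : AnalyticAt ℂ f u)
    (i j : Fin 3) (k : ℕ) :
    partialDeriv i ((partialDeriv j)^[k] f) =ᶠ[𝓝 u] (partialDeriv j)^[k] (partialDeriv i f) := by
  induction k with
  | zero => exact .rfl
  | succ k ih =>
    rw [Function.iterate_succ_apply', Function.iterate_succ_apply']
    exact (partialDeriv_comm (iterate_partialDeriv_analyticAt hf j k) i j).trans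
      (partialDeriv_congr ih j)

theorem mixedPartial_congr {f g : (Fin 3 → ℂ) → ℂ} {u : Fin 3 → ℂ} (h : f =ᶠ[𝓝 u] g)
    (n : Fin 3 → ℕ) : mixedPartial n f =ᶠ[𝓝 u] mixedPartial n g :=
  iterate_partialDeriv_congr (iterate_partialDeriv_congr (iterate_partialDeriv_congr h _ _) _ _) _ _

/-- Partial derivatives commute on analytic germs, so the derivative `∂_i` can be moved innermost.
This is what allows induction on the multi-index below. -/
theorem mixedPartial_add_single {f : (Fin 3 → ℂ) → ℂ} {u : Fin 3 → ℂ} (hf : AnalyticAt ℂ f u)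
    (n : Fin 3 → ℕ) (i : Fin 3) :
    mixedPartial (n + Pi.single i 1) f =ᶠ[𝓝 u] mixedPartial n (partialDeriv i f) := by
  have h2 := iterate_partialDeriv_analyticAt hf 2 (n 2)
  have h1 := iterate_partialDeriv_analyticAt h2 1 (n 1)
  unfold mixedPartial
  fin_cases i
  · simp only [Fin.zero_eta, Pi.add_apply, Pi.single_eq_same, ne_eq, one_ne_zero,
      not_false_eq_true, Pi.single_eq_of_ne, add_zero, Fin.reduceEq, Function.iterate_succ_apply]
    refine iterate_partialDeriv_congr ?_ _ _
    exact (iterate_partialDeriv_comm h2 0 1 _).trans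
      (iterate_partialDeriv_congr (iterate_partialDeriv_comm hf 0 2 _) _ _)
  · simp only [Fin.mk_one, Pi.add_apply, Pi.single_eq_same, ne_eq, zero_ne_one,
      not_false_eq_true, Pi.single_eq_of_ne, add_zero, Fin.reduceEq, Function.iterate_succ_apply]
    refine iterate_partialDeriv_congr (iterate_partialDeriv_congr ?_ _ _) _ _
    exact iterate_partialDeriv_comm hf 1 2 _
  · simp [Function.iterate_succ_apply]

/-- The Taylor coefficient of `f` at `0` of multi-index `n`. -/
def taylorCoeff (n : Fin 3 → ℕ) (f : (Fin 3 → ℂ) → ℂ) : ℂ :=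
  mixedPartial n f 0 / (∏ i, (n i).factorial : ℕ)

theorem taylorCoeff_congr {f g : (Fin 3 → ℂ) → ℂ} (h : f =ᶠ[𝓝 0] g) (n : Fin 3 → ℕ) :
    taylorCoeff n f = taylorCoeff n g := by
  rw [taylorCoeff, taylorCoeff, (mixedPartial_congr h n).eq_of_nhds]

@[simp]
theorem taylorCoeff_zero_index (f : (Fin 3 → ℂ) → ℂ) : taylorCoeff 0 f = f 0 := by
  simp [taylorCoeff, mixedPartial]

theorem taylorCoeff_partialDeriv {f : (Fin 3 → ℂ) → ℂ} (hf : AnalyticAt ℂ f 0) (n : Fin 3 → ℕ)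
    (i : Fin 3) :
    taylorCoeff n (partialDeriv i f) = (n i + 1) * taylorCoeff (n + Pi.single i 1) f := by
  rw [taylorCoeff, taylorCoeff, (mixedPartial_add_single hf n i).eq_of_nhds]
  have h : ∏ k, ((n + Pi.single i 1 : Fin 3 → ℕ) k).factorial =
      (n i + 1) * ∏ k, (n k).factorial := by
    fin_cases i <;> simp [Fin.prod_univ_three, Nat.factorial_succ] <;> ring
  rw [h]
  have h0 : ((∏ k, (n k).factorial : ℕ) : ℂ) ≠ 0 := by
    exact_mod_cast (Finset.prod_pos fun k _ => (n k).factorial_pos).ne'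
  have h1 : ((n i : ℂ) + 1) ≠ 0 := by exact_mod_cast (n i).succ_ne_zero
  push_cast at h0 ⊢
  field_simp

theorem exists_eq_add_single {n : Fin 3 → ℕ} {i : Fin 3} (h : n i ≠ 0) :
    ∃ m : Fin 3 → ℕ, n = m + Pi.single i 1 := by
  refine ⟨n - Pi.single i 1, ?_⟩
  funext k
  by_cases hk : k = i
  · subst hk
    simp only [Pi.add_apply, Pi.sub_apply, Pi.single_eq_same]; omega
  · simp [hk]

theorem multiIndex_induction {P : (Fin 3 → ℕ) → Prop} (h0 : P 0)
    (h1 : ∀ n i, P n → P (n + Pi.single i 1)) (n : Fin 3 → ℕ) : P n := by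
  induction hs : ∑ i, n i using Nat.strong_induction_on generalizing n with
  | _ s ih =>
    by_cases hn : n = 0
    · exact hn ▸ h0
    · obtain ⟨i, hi⟩ := Function.ne_iff.mp hn
      obtain ⟨m, rfl⟩ := exists_eq_add_single hi
      refine h1 _ _ (ih _ ?_ _ rfl)
      subst hs
      simp [Finset.sum_add_distrib]

theorem taylorCoeff_add {f g : (Fin 3 → ℂ) → ℂ} (hf : AnalyticAt ℂ f 0) (hg : AnalyticAt ℂ g 0)
    (n : Fin 3 → ℕ) :
    taylorCoeff n (fun u => f u + g u) = taylorCoeff n f + taylorCoeff n g := by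
  induction n using multiIndex_induction generalizing f g with
  | h0 => simp
  | h1 n i ih =>
    have h1 : ((n i : ℂ) + 1) ≠ 0 := by exact_mod_cast (n i).succ_ne_zero
    have := ih (partialDeriv_analyticAt hf i) (partialDeriv_analyticAt hg i)
    rw [← taylorCoeff_congr (partialDeriv_add hf hg i), taylorCoeff_partialDeriv (hf.fun_add hg),
      taylorCoeff_partialDeriv hf, taylorCoeff_partialDeriv hg, ← mul_add] at this
    exact mul_left_cancel₀ h1 this

theorem taylorCoeff_const_mul {f : (Fin 3 → ℂ) → ℂ} (hf : AnalyticAt ℂ f 0) (c : ℂ)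
    (n : Fin 3 → ℕ) : taylorCoeff n (fun u => c * f u) = c * taylorCoeff n f := by
  induction n using multiIndex_induction generalizing f with
  | h0 => simp
  | h1 n i ih =>
    have h1 : ((n i : ℂ) + 1) ≠ 0 := by exact_mod_cast (n i).succ_ne_zero
    have := ih (partialDeriv_analyticAt hf i)
    rw [← taylorCoeff_congr (partialDeriv_const_mul hf c i),
      taylorCoeff_partialDeriv (analyticAt_const.fun_mul hf),
      taylorCoeff_partialDeriv hf, mul_left_comm] at this
    exact mul_left_cancel₀ h1 this

theorem taylorCoeff_sub {f g : (Fin 3 → ℂ) → ℂ} (hf : AnalyticAt ℂ f 0) (hg : AnalyticAt ℂ g 0)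
    (n : Fin 3 → ℕ) :
    taylorCoeff n (fun u => f u - g u) = taylorCoeff n f - taylorCoeff n g := by
  have := taylorCoeff_add hf (analyticAt_const.fun_mul hg : AnalyticAt ℂ (fun u => (-1) * g u) 0) n
  rw [taylorCoeff_const_mul hg] at this
  simpa [sub_eq_add_neg] using this

theorem taylorCoeff_coord_mul_of_eq_zero {f : (Fin 3 → ℂ) → ℂ} (hf : AnalyticAt ℂ f 0)
    {n : Fin 3 → ℕ} {i : Fin 3} (hn : n i = 0) : taylorCoeff n (fun u => u i * f u) = 0 := by
  induction n using multiIndex_induction generalizing f with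
  | h0 => simp
  | h1 n j ih =>
    have hj : i ≠ j := by rintro rfl; simp at hn
    have h1 : ((n j : ℂ) + 1) ≠ 0 := by exact_mod_cast (n j).succ_ne_zero
    have h2 := taylorCoeff_partialDeriv ((analyticAt_coord i 0).fun_mul hf) n j
    have h3 := partialDeriv_coord_mul hf i j
    simp only [hj, if_false, zero_mul, add_zero] at h3
    have h4 := taylorCoeff_congr h3 n
    rw [ih (partialDeriv_analyticAt hf j) (by simpa [hj] using hn)] at h4
    exact (mul_eq_zero.mp (h2.symm.trans h4)).resolve_left h1

theorem taylorCoeff_coord_mul {f : (Fin 3 → ℂ) → ℂ} (hf : AnalyticAt ℂ f 0)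
    (n : Fin 3 → ℕ) (i : Fin 3) :
    taylorCoeff (n + Pi.single i 1) (fun u => u i * f u) = taylorCoeff n f := by
  have step : ∀ {g : (Fin 3 → ℂ) → ℂ} (m : Fin 3 → ℕ) (j : Fin 3), AnalyticAt ℂ g 0 →
      (m j + 1) * taylorCoeff (m + Pi.single j 1) (fun u => u i * g u) =
        taylorCoeff m (fun u => u i * partialDeriv j g u) +
          (if i = j then 1 else 0) * taylorCoeff m g := by
    intro g m j hg
    refine (taylorCoeff_partialDeriv ((analyticAt_coord i 0).fun_mul hg) m j).symm.trans ?_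
    rw [← taylorCoeff_const_mul hg,
      ← taylorCoeff_add ((analyticAt_coord i 0).fun_mul (partialDeriv_analyticAt hg j))
        (analyticAt_const.fun_mul hg)]
    exact taylorCoeff_congr (partialDeriv_coord_mul hg i j) m
  induction n using multiIndex_induction generalizing f with
  | h0 =>
    have := step 0 i hf
    simpa using this
  | h1 n j ih =>
    have h2 := step (n + Pi.single i 1) j hf
    rw [ih (partialDeriv_analyticAt hf j), taylorCoeff_partialDeriv hf] at h2
    rw [add_right_comm]
    by_cases hij : i = j
    · subst hij
      have h1 : ((n i : ℂ) + 1 + 1) ≠ 0 := by exact_mod_cast (n i + 1).succ_ne_zero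
      apply mul_left_cancel₀ h1
      simp at h2
      rw [h2]; ring
    · have h1 : ((n j : ℂ) + 1) ≠ 0 := by exact_mod_cast (n j).succ_ne_zero
      apply mul_left_cancel₀ h1
      simpa [hij, Ne.symm hij] using h2

theorem theta_analyticAt {f : (Fin 3 → ℂ) → ℂ} {u : Fin 3 → ℂ} (hf : AnalyticAt ℂ f u)
    (i : Fin 3) : AnalyticAt ℂ (theta i f) u :=
  (analyticAt_coord i u).fun_mul (partialDeriv_analyticAt hf i)

/-- `θ_i` multiplies the Taylor coefficient of multi-index `n` by `n_i`. -/
theorem taylorCoeff_theta {f : (Fin 3 → ℂ) → ℂ} (hf : AnalyticAt ℂ f 0) (n : Fin 3 → ℕ)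
    (i : Fin 3) : taylorCoeff n (theta i f) = n i * taylorCoeff n f := by
  change taylorCoeff n (fun u => u i * partialDeriv i f u) = _
  by_cases hn : n i = 0
  · rw [taylorCoeff_coord_mul_of_eq_zero (partialDeriv_analyticAt hf i) hn]; simp [hn]
  · obtain ⟨m, rfl⟩ := exists_eq_add_single hn
    rw [taylorCoeff_coord_mul (partialDeriv_analyticAt hf i), taylorCoeff_partialDeriv hf]
    simp

/-- An analytic germ whose Taylor coefficients all vanish is zero: restrict it to the complex
lines through the origin. -/
theorem eventually_eq_zero_of_taylorCoeff {f : (Fin 3 → ℂ) → ℂ} (hf : AnalyticAt ℂ f 0)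
    (h : ∀ n, taylorCoeff n f = 0) : f =ᶠ[𝓝 0] 0 := by
  have hline : ∀ v : Fin 3 → ℂ, ∀ k : ℕ, ∀ g : (Fin 3 → ℂ) → ℂ, AnalyticAt ℂ g 0 →
      (∀ n, taylorCoeff n g = 0) → iteratedDeriv k (fun t : ℂ => g (t • v)) 0 = 0 := by
    intro v k
    induction k with
    | zero =>
      intro g _ h0
      have := h0 0
      simpa using this
    | succ k ih =>
      intro g hg h0
      rw [iteratedDeriv_succ']
      have hp := fun i => partialDeriv_analyticAt hg i
      have h1 : AnalyticAt ℂ (fun u => v 0 * partialDeriv 0 g u + v 1 * partialDeriv 1 g u) 0 :=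
        (analyticAt_const.fun_mul (hp 0)).fun_add (analyticAt_const.fun_mul (hp 1))
      have h2 : AnalyticAt ℂ (fun u => v 2 * partialDeriv 2 g u) 0 :=
        analyticAt_const.fun_mul (hp 2)
      refine Eq.trans ?_ (ih (fun u => (v 0 * partialDeriv 0 g u + v 1 * partialDeriv 1 g u) +
        v 2 * partialDeriv 2 g u) (h1.fun_add h2) ?_)
      · refine Filter.EventuallyEq.iteratedDeriv_eq _ ?_
        have hc : Tendsto (fun t : ℂ => t • v) (𝓝 0) (𝓝 0) := by
          have : Continuous fun t : ℂ => t • v := by fun_prop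
          simpa using this.tendsto 0
        filter_upwards [hc.eventually hg.eventually_analyticAt] with t ht
        have hd : HasDerivAt (fun t : ℂ => t • v) v t := by
          simpa using (hasDerivAt_id t).smul_const v
        have := (ht.differentiableAt.hasFDerivAt.comp_hasDerivAt t hd).deriv
        refine this.trans ?_
        have hv : v = v 0 • Pi.single 0 1 + v 1 • Pi.single 1 1 + v 2 • Pi.single 2 1 := by
          funext k; fin_cases k <;> simp
        conv_lhs => rw [hv]
        simp only [map_add, map_smul, smul_eq_mul, partialDeriv]
        rw [← hv]
      · intro n
        rw [taylorCoeff_add h1 h2, taylorCoeff_add (analyticAt_const.fun_mul (hp 0))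
          (analyticAt_const.fun_mul (hp 1))]
        simp [taylorCoeff_const_mul (hp _), taylorCoeff_partialDeriv hg, h0]
  obtain ⟨r, hr, hball⟩ := Metric.eventually_nhds_iff_ball.mp hf.eventually_analyticAt
  filter_upwards [Metric.ball_mem_nhds (0 : Fin 3 → ℂ) hr] with v hv
  have hanal : AnalyticOnNhd ℂ (fun t : ℂ => f (t • v)) (Metric.closedBall 0 1) := by
    intro t ht
    have hmem : t • v ∈ Metric.ball (0 : Fin 3 → ℂ) r := by
      simp only [Metric.mem_ball, dist_zero_right, Metric.mem_closedBall] at *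
      calc ‖t • v‖ = ‖t‖ * ‖v‖ := norm_smul _ _
        _ ≤ 1 * ‖v‖ := by gcongr
        _ < r := by simpa using hv
    have h1 : AnalyticAt ℂ (fun t : ℂ => t • v) t := analyticAt_id.smul analyticAt_const
    exact (hball _ hmem).comp_of_eq h1 rfl
  have hzero : (fun t : ℂ => f (t • v)) =ᶠ[𝓝 0] 0 := by
    have h0 := hanal 0 (by simp)
    refine analyticOrderAt_eq_top.mp (ENat.eq_top_iff_forall_ge.mpr fun m => ?_)
    exact (natCast_le_analyticOrderAt_iff_iteratedDeriv_eq_zero h0).mpr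
      fun k _ => hline v k f hf h
  have := hanal.eqOn_zero_of_preconnected_of_eventuallyEq_zero
    (convex_closedBall (0 : ℂ) 1).isPreconnected (Metric.mem_closedBall_self zero_le_one) hzero
    (show (1 : ℂ) ∈ _ by simp)
  simpa using this


/-! ### Analytic functions with prescribed Taylor coefficients -/

/-- The resolvent `(1 - z T)⁻¹`; only its germ at `z = 0`, where the inverse exists, matters. -/
def resolventAt {𝓐 : Type*} [NormedRing 𝓐] [NormedAlgebra ℂ 𝓐] (T : 𝓐) (z : ℂ) : 𝓐 :=
  Ring.inverse (1 - z • T)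

theorem resolventAt_zero {𝓐 : Type*} [NormedRing 𝓐] [NormedAlgebra ℂ 𝓐] (T : 𝓐) :
    resolventAt T 0 = 1 := by
  simp [resolventAt]

theorem resolventAt_analyticAt {𝓐 : Type*} [NormedRing 𝓐] [NormedAlgebra ℂ 𝓐] [CompleteSpace 𝓐]
    (T : 𝓐) : AnalyticAt ℂ (resolventAt T) 0 := by
  have h1 : AnalyticAt ℂ (fun z : ℂ => 1 - z • T) 0 :=
    analyticAt_const.fun_sub (analyticAt_id.smul analyticAt_const)
  exact (analyticAt_inverse (𝕜 := ℂ) (1 : 𝓐ˣ)).comp_of_eq h1 (by simp)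

theorem commute_resolventAt {𝓐 : Type*} [NormedRing 𝓐] [NormedAlgebra ℂ 𝓐] {S T : 𝓐}
    (h : Commute S T) (z : ℂ) : Commute S (resolventAt T z) := by
  have hc : Commute S (1 - z • T) := (Commute.one_right _).sub_right (h.smul_right z)
  by_cases hu : IsUnit (1 - z • T)
  · have h1 := Ring.inverse_mul_cancel _ hu
    have h2 := Ring.mul_inverse_cancel _ hu
    change _ * Ring.inverse _ = Ring.inverse _ * _
    calc S * Ring.inverse (1 - z • T)
        = (Ring.inverse (1 - z • T) * (1 - z • T)) * (S * Ring.inverse (1 - z • T)) := by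
          rw [h1, one_mul]
      _ = Ring.inverse (1 - z • T) * ((1 - z • T) * S) * Ring.inverse (1 - z • T) := by
          simp only [mul_assoc]
      _ = Ring.inverse (1 - z • T) * S * ((1 - z • T) * Ring.inverse (1 - z • T)) := by
          rw [← hc.eq]; simp only [mul_assoc]
      _ = _ := by rw [h2, mul_one]
  · rw [resolventAt, Ring.inverse_non_unit _ hu]
    exact Commute.zero_right _

theorem eventually_resolventAt_eq {𝓐 : Type*} [NormedRing 𝓐] [NormedAlgebra ℂ 𝓐] [CompleteSpace 𝓐]
    (T : 𝓐) :
    ∀ᶠ z in 𝓝 (0 : ℂ), resolventAt T z = 1 + z • (T * resolventAt T z) := by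
  have hc : Continuous fun z : ℂ => z • T := by fun_prop
  have : ∀ᶠ z in 𝓝 (0 : ℂ), ‖z • T‖ < 1 :=
    (hc.norm.tendsto 0).eventually_lt_const (u := 1) (by simp)
  filter_upwards [this] with z hz
  have h2 := Ring.mul_inverse_cancel _ (isUnit_one_sub_of_norm_lt_one hz)
  rw [sub_mul, one_mul, smul_mul_assoc] at h2
  exact sub_eq_iff_eq_add.mp h2

/-- The function `ℓ ((1 - u₁ T₁)⁻¹ (1 - u₂ T₂)⁻¹ (1 - u₃ T₃)⁻¹)`, the generating function of the
moments `ℓ (T^n)`. -/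
def momentSeries {𝓐 : Type*} [NormedRing 𝓐] [NormedAlgebra ℂ 𝓐] (T : Fin 3 → 𝓐)
    (ℓ : 𝓐 →L[ℂ] ℂ) (u : Fin 3 → ℂ) : ℂ :=
  ℓ (resolventAt (T 0) (u 0) * resolventAt (T 1) (u 1) * resolventAt (T 2) (u 2))

theorem AnalyticAt.comp_coord {E : Type*} [NormedAddCommGroup E] [NormedSpace ℂ E] {f : ℂ → E}
    (i : Fin 3) (hf : AnalyticAt ℂ f 0) : AnalyticAt ℂ (fun u : Fin 3 → ℂ => f (u i)) 0 :=
  hf.comp_of_eq (analyticAt_coord i 0) rfl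

theorem momentSeries_analyticAt {𝓐 : Type*} [NormedRing 𝓐] [NormedAlgebra ℂ 𝓐] [CompleteSpace 𝓐]
    (T : Fin 3 → 𝓐) (ℓ : 𝓐 →L[ℂ] ℂ) :
    AnalyticAt ℂ (momentSeries T ℓ) 0 := by
  have h := fun i => AnalyticAt.comp_coord i (resolventAt_analyticAt (T i))
  exact (ℓ.analyticAt _).comp_of_eq (((h 0).mul (h 1)).mul (h 2)) rfl

/-- A function that does not depend on `u_i` has vanishing `i`-th partial derivative. -/
theorem partialDeriv_eq_zero_of_update {f : (Fin 3 → ℂ) → ℂ} (i : Fin 3)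
    (h : ∀ u z, f (Function.update u i z) = f u) : partialDeriv i f = 0 := by
  funext u
  by_cases hd : DifferentiableAt ℂ f u
  · have h1 : HasDerivAt (fun t : ℂ => u + t • (Pi.single i 1 : Fin 3 → ℂ)) (Pi.single i 1) 0 := by
      simpa using ((hasDerivAt_id (0 : ℂ)).smul_const (Pi.single i 1 : Fin 3 → ℂ)).const_add u
    have h2 := HasFDerivAt.comp_hasDerivAt_of_eq (0 : ℂ) hd.hasFDerivAt h1 (by simp)
    have h3 : (f ∘ fun t : ℂ => u + t • (Pi.single i 1 : Fin 3 → ℂ)) = fun _ => f u := by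
      funext t
      have : u + t • (Pi.single i 1 : Fin 3 → ℂ) = Function.update u i (u i + t) := by
        funext k
        by_cases hk : k = i
        · subst hk; simp
        · simp [hk]
      simp [this, h]
    rw [h3] at h2
    exact h2.unique (hasDerivAt_const _ _)
  · simp [partialDeriv, fderiv_zero_of_not_differentiableAt hd]

theorem taylorCoeff_eq_zero_of_update {f : (Fin 3 → ℂ) → ℂ} (hf : AnalyticAt ℂ f 0) {i : Fin 3}
    (h : ∀ u z, f (Function.update u i z) = f u) (n : Fin 3 → ℕ) :
    taylorCoeff (n + Pi.single i 1) f = 0 := by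
  have h1 : ((n i : ℂ) + 1) ≠ 0 := by exact_mod_cast (n i).succ_ne_zero
  have h2 := taylorCoeff_partialDeriv hf n i
  have h3 : taylorCoeff n (0 : (Fin 3 → ℂ) → ℂ) = 0 := by
    have := taylorCoeff_const_mul (analyticAt_const : AnalyticAt ℂ (fun _ : Fin 3 → ℂ => (1 : ℂ)) 0)
      0 n
    simpa [Pi.zero_def] using this
  rw [partialDeriv_eq_zero_of_update i h, h3] at h2
  exact (mul_eq_zero.mp h2.symm).resolve_left h1

/-- Raising the `i`-th index of a moment multiplies by `T_i`: split off from the moment series its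
value `g` at `u_i = 0`, using `(1 - z T)⁻¹ = 1 + z T (1 - z T)⁻¹`. -/
theorem taylorCoeff_momentSeries_add_single {𝓐 : Type*} [NormedRing 𝓐] [NormedAlgebra ℂ 𝓐]
    [CompleteSpace 𝓐] {T : Fin 3 → 𝓐} (hT : ∀ i j, Commute (T i) (T j))
    (ℓ : 𝓐 →L[ℂ] ℂ) (n : Fin 3 → ℕ) (i : Fin 3) :
    taylorCoeff (n + Pi.single i 1) (momentSeries T ℓ) =
      taylorCoeff n (momentSeries T (ℓ.comp ((ContinuousLinearMap.mul ℂ 𝓐).flip (T i)))) := by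
  set g : (Fin 3 → ℂ) → ℂ := fun u => momentSeries T ℓ (Function.update u i 0) with hg
  have hga : AnalyticAt ℂ g 0 := by
    refine (momentSeries_analyticAt T ℓ).comp_of_eq ?_ (by simp)
    refine AnalyticAt.pi fun k => ?_
    by_cases hk : k = i
    · subst hk; simpa using analyticAt_const
    · simpa [hk] using analyticAt_coord k 0
  have hs := momentSeries_analyticAt T (ℓ.comp ((ContinuousLinearMap.mul ℂ 𝓐).flip (T i)))
  have key : momentSeries T ℓ =ᶠ[𝓝 0] fun u =>
      g u + u i * momentSeries T (ℓ.comp ((ContinuousLinearMap.mul ℂ 𝓐).flip (T i))) u := by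
    have ht : Tendsto (fun u : Fin 3 → ℂ => u i) (𝓝 0) (𝓝 0) := (continuous_apply i).tendsto 0
    filter_upwards [ht.eventually (eventually_resolventAt_eq (T i))] with u hu
    have hc := fun j => (commute_resolventAt (hT i j) (u j)).eq
    simp only [momentSeries, hg, ContinuousLinearMap.comp_apply, ContinuousLinearMap.flip_apply,
      ContinuousLinearMap.mul_apply', ← smul_eq_mul (u i), ← map_smul, ← map_add]
    congr 1
    fin_cases i
    · simp only [Fin.zero_eta] at hu hc
      conv_lhs => rw [hu]
      simp [resolventAt_zero, add_mul, mul_assoc, hc]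
    · simp only [Fin.mk_one] at hu hc
      conv_lhs => rw [hu]
      simp [resolventAt_zero, add_mul, mul_add, mul_assoc, hc]
    · simp only [Fin.reduceFinMk] at hu hc
      conv_lhs => rw [hu]
      simp [resolventAt_zero, mul_add, mul_assoc, hc]
  rw [taylorCoeff_congr key, taylorCoeff_add hga ((analyticAt_coord i 0).fun_mul hs),
    taylorCoeff_coord_mul hs, taylorCoeff_eq_zero_of_update hga (fun u z => by simp [hg]), zero_add]

open scoped BoundedContinuousFunction in
/-- The shift `c ↦ R c(· + e_i)` on bounded functions of multi-indices. -/
def indexShift (R : ℂ) (i : Fin 3) :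
    ((Fin 3 → ℕ) →ᵇ ℂ) →L[ℂ] ((Fin 3 → ℕ) →ᵇ ℂ) :=
  R • LinearMap.mkContinuous
    { toFun := fun c =>
        c.compContinuous ⟨fun n => n + Pi.single i 1, continuous_of_discreteTopology⟩
      map_add' := fun _ _ => rfl
      map_smul' := fun _ _ => rfl } 1
    fun c => by
      rw [one_mul]
      exact BoundedContinuousFunction.norm_compContinuous_le c _

open scoped BoundedContinuousFunction in
theorem indexShift_apply (R : ℂ) (i : Fin 3) (c : (Fin 3 → ℕ) →ᵇ ℂ) (n : Fin 3 → ℕ) :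
    indexShift R i c n = R * c (n + Pi.single i 1) := rfl

theorem indexShift_commute (R : ℂ) (i j : Fin 3) :
    Commute (indexShift R i) (indexShift R j) := by
  ext c n
  change indexShift R i (indexShift R j c) n = indexShift R j (indexShift R i c) n
  simp only [indexShift_apply]
  rw [add_right_comm]

/-- Coefficients of at most exponential growth are the Taylor coefficients of an analytic germ:
they are the moments of the shift operators on bounded multi-sequences. -/
theorem exists_analyticAt_taylorCoeff (c : (Fin 3 → ℕ) → ℂ) (K R : ℝ) (hR : 0 < R)
    (hc : ∀ n, ‖c n‖ ≤ K * R ^ (n 0 + n 1 + n 2)) :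
    ∃ f : (Fin 3 → ℂ) → ℂ, AnalyticAt ℂ f 0 ∧ ∀ n, taylorCoeff n f = c n := by
  have hR' : (R : ℂ) ≠ 0 := by exact_mod_cast hR.ne'
  let E := BoundedContinuousFunction (Fin 3 → ℕ) ℂ
  -- the coefficients, rescaled to be bounded; the factor `R` is restored by `indexShift`
  let c' : E :=
    BoundedContinuousFunction.ofNormedAddCommGroupDiscrete
      (fun n => c n / (R : ℂ) ^ (n 0 + n 1 + n 2)) K fun n => by
        rw [norm_div, norm_pow, Complex.norm_real, Real.norm_of_nonneg hR.le,
          div_le_iff₀ (by positivity)]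
        exact hc n
  let ev : (E →L[ℂ] E) →L[ℂ] ℂ := (BoundedContinuousFunction.evalCLM ℂ (0 : Fin 3 → ℕ)).comp
    (ContinuousLinearMap.apply ℂ E c')
  have key : ∀ (n : Fin 3 → ℕ) (ℓ : (E →L[ℂ] E) →L[ℂ] ℂ) (d : E), (∀ L, ℓ L = L d 0) →
      taylorCoeff n (momentSeries (indexShift R) ℓ) = (R : ℂ) ^ (n 0 + n 1 + n 2) * d n := by
    intro n
    induction n using multiIndex_induction with
    | h0 => intro ℓ d h; simp [momentSeries, resolventAt_zero, h]
    | h1 n i ih =>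
      intro ℓ d h
      rw [taylorCoeff_momentSeries_add_single (indexShift_commute R),
        ih _ (indexShift R i d) fun L => ?_, indexShift_apply]
      · fin_cases i <;> simp <;> ring
      · exact h _
  refine ⟨momentSeries (indexShift R) ev, momentSeries_analyticAt _ _, fun n => ?_⟩
  rw [key n ev c' fun L => rfl]
  change _ * (c n / (R : ℂ) ^ (n 0 + n 1 + n 2)) = _
  field_simp


/-! ### The Picard-Fuchs operators on logarithmic solutions -/

/-- A pair `(f, g)` stands for the function `f ℓ + g`, where `ℓ` is a logarithm. -/
def logCombine (ℓ : (Fin 3 → ℂ) → ℂ) (p : ((Fin 3 → ℂ) → ℂ) × ((Fin 3 → ℂ) → ℂ)) :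
    (Fin 3 → ℂ) → ℂ :=
  fun u => p.1 u * ℓ u + p.2 u

/-- The action of `θ_j` on pairs when `θ_j ℓ = κ_j`. -/
def thetaLog (κ : Fin 3 → ℂ) (j : Fin 3) (p : ((Fin 3 → ℂ) → ℂ) × ((Fin 3 → ℂ) → ℂ)) :
    ((Fin 3 → ℂ) → ℂ) × ((Fin 3 → ℂ) → ℂ) :=
  (theta j p.1, fun u => theta j p.2 u + κ j * p.1 u)

/-- Multiplication of a pair by the coordinate `u_j`. -/
def coordMul (j : Fin 3) (p : ((Fin 3 → ℂ) → ℂ) × ((Fin 3 → ℂ) → ℂ)) :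
    ((Fin 3 → ℂ) → ℂ) × ((Fin 3 → ℂ) → ℂ) :=
  (fun u => u j * p.1 u, fun u => u j * p.2 u)

/-- The action of `picardFuchs₁` on pairs. -/
def picardFuchsLog₁ (κ : Fin 3 → ℂ) (p : ((Fin 3 → ℂ) → ℂ) × ((Fin 3 → ℂ) → ℂ)) :
    ((Fin 3 → ℂ) → ℂ) × ((Fin 3 → ℂ) → ℂ) :=
  let A := coordMul 0 p
  let B := (6 : ℂ) • thetaLog κ 0 A - A
  thetaLog κ 0 (thetaLog κ 0 p - (2 : ℂ) • thetaLog κ 1 p - (2 : ℂ) • thetaLog κ 2 p)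
    - (12 : ℂ) • ((6 : ℂ) • thetaLog κ 0 B - (5 : ℂ) • B)

/-- The action of `picardFuchsBase i` on pairs. -/
def picardFuchsBaseLog (κ : Fin 3 → ℂ) (i : Fin 3)
    (p : ((Fin 3 → ℂ) → ℂ) × ((Fin 3 → ℂ) → ℂ)) : ((Fin 3 → ℂ) → ℂ) × ((Fin 3 → ℂ) → ℂ) :=
  let A := coordMul i p
  let B := (2 : ℂ) • thetaLog κ 1 A + (2 : ℂ) • thetaLog κ 2 A - thetaLog κ 0 A - A
  thetaLog κ i (thetaLog κ i p)
    - ((2 : ℂ) • thetaLog κ 1 B + (2 : ℂ) • thetaLog κ 2 B - thetaLog κ 0 B - (2 : ℂ) • B)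

/-- Both components of the pair are analytic at `u`. -/
def AnalyticPairAt (p : ((Fin 3 → ℂ) → ℂ) × ((Fin 3 → ℂ) → ℂ)) (u : Fin 3 → ℂ) : Prop :=
  AnalyticAt ℂ p.1 u ∧ AnalyticAt ℂ p.2 u

section AnalyticPair

variable {p p' : ((Fin 3 → ℂ) → ℂ) × ((Fin 3 → ℂ) → ℂ)} {u : Fin 3 → ℂ}

theorem AnalyticPairAt.thetaLog (hp : AnalyticPairAt p u) (κ : Fin 3 → ℂ) (j : Fin 3) :
    AnalyticPairAt (thetaLog κ j p) u :=
  ⟨theta_analyticAt hp.1 j, (theta_analyticAt hp.2 j).fun_add (analyticAt_const.fun_mul hp.1)⟩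

theorem AnalyticPairAt.coordMul (hp : AnalyticPairAt p u) (j : Fin 3) :
    AnalyticPairAt (coordMul j p) u :=
  ⟨(analyticAt_coord j u).fun_mul hp.1, (analyticAt_coord j u).fun_mul hp.2⟩

theorem AnalyticPairAt.add (hp : AnalyticPairAt p u) (hp' : AnalyticPairAt p' u) :
    AnalyticPairAt (p + p') u := ⟨hp.1.add hp'.1, hp.2.add hp'.2⟩

theorem AnalyticPairAt.sub (hp : AnalyticPairAt p u) (hp' : AnalyticPairAt p' u) :
    AnalyticPairAt (p - p') u := ⟨hp.1.sub hp'.1, hp.2.sub hp'.2⟩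

theorem AnalyticPairAt.smul (hp : AnalyticPairAt p u) (c : ℂ) : AnalyticPairAt (c • p) u :=
  ⟨analyticAt_const.fun_mul hp.1, analyticAt_const.fun_mul hp.2⟩

theorem AnalyticPairAt.picardFuchsLog₁ (hp : AnalyticPairAt p u) (κ : Fin 3 → ℂ) :
    AnalyticPairAt (picardFuchsLog₁ κ p) u := by
  have hA := hp.coordMul 0
  have hB := ((hA.thetaLog κ 0).smul 6).sub hA
  exact ((((hp.thetaLog κ 0).sub ((hp.thetaLog κ 1).smul 2)).sub
    ((hp.thetaLog κ 2).smul 2)).thetaLog κ 0).sub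
    ((((hB.thetaLog κ 0).smul 6).sub (hB.smul 5)).smul 12)

theorem AnalyticPairAt.picardFuchsBaseLog (hp : AnalyticPairAt p u) (κ : Fin 3 → ℂ) (i : Fin 3) :
    AnalyticPairAt (picardFuchsBaseLog κ i p) u := by
  have hA := hp.coordMul i
  have hB := ((((hA.thetaLog κ 1).smul 2).add ((hA.thetaLog κ 2).smul 2)).sub
    (hA.thetaLog κ 0)).sub hA
  exact ((hp.thetaLog κ i).thetaLog κ i).sub
    (((((hB.thetaLog κ 1).smul 2).add ((hB.thetaLog κ 2).smul 2)).sub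
      (hB.thetaLog κ 0)).sub (hB.smul 2))

end AnalyticPair

theorem theta_congr {f g : (Fin 3 → ℂ) → ℂ} {u : Fin 3 → ℂ} (h : f =ᶠ[𝓝 u] g) (i : Fin 3) :
    theta i f =ᶠ[𝓝 u] theta i g := by
  filter_upwards [partialDeriv_congr h i] with v hv
  exact congrArg (v i * ·) hv

section LogCombine

variable {ℓ : (Fin 3 → ℂ) → ℂ} {κ : Fin 3 → ℂ} {u : Fin 3 → ℂ}
  {p : ((Fin 3 → ℂ) → ℂ) × ((Fin 3 → ℂ) → ℂ)}

/-- `thetaLog` computes `θ_j (f ℓ + g)`. -/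
theorem theta_logCombine (hℓ : AnalyticAt ℂ ℓ u)
    (hκ : ∀ j, ∀ᶠ v in 𝓝 u, theta j ℓ v = κ j) (hp : AnalyticPairAt p u) (j : Fin 3) :
    theta j (logCombine ℓ p) =ᶠ[𝓝 u] logCombine ℓ (thetaLog κ j p) := by
  filter_upwards [hℓ.eventually_analyticAt, hκ j, hp.1.eventually_analyticAt,
    hp.2.eventually_analyticAt] with v h1 h2 h3 h4
  simp only [theta] at h2
  have e : logCombine ℓ p = fun y => p.1 y * ℓ y + p.2 y := rfl
  rw [e]
  simp only [theta, logCombine, thetaLog]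
  rw [fderiv_fun_add (h3.differentiableAt.fun_mul h1.differentiableAt) h4.differentiableAt,
    fderiv_fun_mul h3.differentiableAt h1.differentiableAt]
  simp only [add_apply, smul_apply, smul_eq_mul]
  linear_combination p.1 v * h2

theorem picardFuchs₁_logCombine (hℓ : AnalyticAt ℂ ℓ u)
    (hκ : ∀ j, ∀ᶠ v in 𝓝 u, theta j ℓ v = κ j) (hp : AnalyticPairAt p u) :
    picardFuchs₁ (logCombine ℓ p) =ᶠ[𝓝 u] logCombine ℓ (picardFuchsLog₁ κ p) := by
  have hA := hp.coordMul 0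
  have hB := ((hA.thetaLog κ 0).smul 6).sub hA
  have hC := ((hp.thetaLog κ 0).sub ((hp.thetaLog κ 1).smul 2)).sub ((hp.thetaLog κ 2).smul 2)
  have eA : ∀ v, v 0 * logCombine ℓ p v = logCombine ℓ (coordMul 0 p) v := by
    intro v; simp only [logCombine, coordMul]; ring
  have eB : (fun v => 6 * theta 0 (logCombine ℓ (coordMul 0 p)) v - logCombine ℓ (coordMul 0 p) v)
      =ᶠ[𝓝 u] logCombine ℓ ((6 : ℂ) • thetaLog κ 0 (coordMul 0 p) - coordMul 0 p) := by
    filter_upwards [theta_logCombine hℓ hκ hA 0] with v hv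
    rw [hv]; simp [logCombine]; ring
  have eC : (fun v => theta 0 (logCombine ℓ p) v - 2 * theta 1 (logCombine ℓ p) v
      - 2 * theta 2 (logCombine ℓ p) v) =ᶠ[𝓝 u]
      logCombine ℓ (thetaLog κ 0 p - (2 : ℂ) • thetaLog κ 1 p - (2 : ℂ) • thetaLog κ 2 p) := by
    filter_upwards [theta_logCombine hℓ hκ hp 0, theta_logCombine hℓ hκ hp 1,
      theta_logCombine hℓ hκ hp 2] with v h0 h1 h2
    rw [h0, h1, h2]; simp [logCombine]; ring
  have e1 := (theta_congr eB 0).trans (theta_logCombine hℓ hκ hB 0)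
  have e2 := (theta_congr eC 0).trans (theta_logCombine hℓ hκ hC 0)
  unfold picardFuchs₁
  simp only [eA]
  filter_upwards [eB, e1, e2] with v h0 h1 h2
  rw [h2, h1, h0]
  simp [logCombine, picardFuchsLog₁]; ring

theorem picardFuchsBase_logCombine (hℓ : AnalyticAt ℂ ℓ u)
    (hκ : ∀ j, ∀ᶠ v in 𝓝 u, theta j ℓ v = κ j) (hp : AnalyticPairAt p u) (i : Fin 3) :
    picardFuchsBase i (logCombine ℓ p) =ᶠ[𝓝 u] logCombine ℓ (picardFuchsBaseLog κ i p) := by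
  have hA := hp.coordMul i
  have hB := ((((hA.thetaLog κ 1).smul 2).add ((hA.thetaLog κ 2).smul 2)).sub
    (hA.thetaLog κ 0)).sub hA
  have eA : ∀ v, v i * logCombine ℓ p v = logCombine ℓ (coordMul i p) v := by
    intro v; simp only [logCombine, coordMul]; ring
  have eB : (fun v => 2 * theta 1 (logCombine ℓ (coordMul i p)) v
        + 2 * theta 2 (logCombine ℓ (coordMul i p)) v - theta 0 (logCombine ℓ (coordMul i p)) v
        - logCombine ℓ (coordMul i p) v)
      =ᶠ[𝓝 u] logCombine ℓ ((2 : ℂ) • thetaLog κ 1 (coordMul i p)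
        + (2 : ℂ) • thetaLog κ 2 (coordMul i p) - thetaLog κ 0 (coordMul i p) - coordMul i p) := by
    filter_upwards [theta_logCombine hℓ hκ hA 0, theta_logCombine hℓ hκ hA 1,
      theta_logCombine hℓ hκ hA 2] with v h0 h1 h2
    rw [h0, h1, h2]; simp [logCombine]; ring
  have e1 := fun j => (theta_congr eB j).trans (theta_logCombine hℓ hκ hB j)
  have e2 := (theta_congr (theta_logCombine hℓ hκ hp i) i).trans
    (theta_logCombine hℓ hκ (hp.thetaLog κ i) i)
  unfold picardFuchsBase
  simp only [eA]
  filter_upwards [eB, e1 0, e1 1, e1 2, e2] with v hb h0 h1 h2 h3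
  rw [h0, h1, h2, h3, hb]
  simp [logCombine, picardFuchsBaseLog]; ring

end LogCombine

/-! ### The Frobenius method with dual numbers -/

/-- The dual number `k + κ ε`. -/
def dualLin (k κ : ℂ) : DualNumber ℂ := TrivSqZeroExt.inl k + TrivSqZeroExt.inr κ

/-- The inverse of `k + κ ε`, for `k ≠ 0`. -/
def dualLinInv (k κ : ℂ) : DualNumber ℂ := dualLin k⁻¹ (-κ / k ^ 2)

@[simp] theorem fst_dualLin (k κ : ℂ) : (dualLin k κ).fst = k := by simp [dualLin]
@[simp] theorem snd_dualLin (k κ : ℂ) : (dualLin k κ).snd = κ := by simp [dualLin]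

theorem dual_ext {x y : DualNumber ℂ} (h1 : x.fst = y.fst) (h2 : x.snd = y.snd) : x = y :=
  TrivSqZeroExt.ext h1 h2

theorem dualLin_mul_inv {k : ℂ} (hk : k ≠ 0) (κ : ℂ) : dualLin k κ * dualLinInv k κ = 1 := by
  apply dual_ext
  · simp [dualLinInv, hk]
  · simp [dualLinInv]; field_simp; ring

/-- The Taylor coefficients of a pair, as one dual number. -/
def dualCoeff (n : Fin 3 → ℕ) (p : ((Fin 3 → ℂ) → ℂ) × ((Fin 3 → ℂ) → ℂ)) : DualNumber ℂ :=
  dualLin (taylorCoeff n p.1) (taylorCoeff n p.2)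

section DualCoeff

variable {p p' : ((Fin 3 → ℂ) → ℂ) × ((Fin 3 → ℂ) → ℂ)}

theorem dualCoeff_add (hp : AnalyticPairAt p 0) (hp' : AnalyticPairAt p' 0) (n : Fin 3 → ℕ) :
    dualCoeff n (p + p') = dualCoeff n p + dualCoeff n p' := by
  apply dual_ext
  · simp [dualCoeff]
    exact taylorCoeff_add hp.1 hp'.1 n
  · simp [dualCoeff]
    exact taylorCoeff_add hp.2 hp'.2 n

theorem dualCoeff_sub (hp : AnalyticPairAt p 0) (hp' : AnalyticPairAt p' 0) (n : Fin 3 → ℕ) :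
    dualCoeff n (p - p') = dualCoeff n p - dualCoeff n p' := by
  apply dual_ext
  · simp [dualCoeff]
    exact taylorCoeff_sub hp.1 hp'.1 n
  · simp [dualCoeff]
    exact taylorCoeff_sub hp.2 hp'.2 n

theorem dualCoeff_smul (hp : AnalyticPairAt p 0) (c : ℂ) (n : Fin 3 → ℕ) :
    dualCoeff n (c • p) = dualLin c 0 * dualCoeff n p := by
  apply dual_ext
  · simp [dualCoeff]
    exact taylorCoeff_const_mul hp.1 c n
  · simp [dualCoeff]
    exact taylorCoeff_const_mul hp.2 c n

/-- On Taylor coefficients, `θ_j` acts on pairs by the dual number `n_j + κ_j ε`; this is `θ_j`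
acting on `u^(n + ρ)` with exponent `ρ = κ ε`. -/
theorem dualCoeff_thetaLog (hp : AnalyticPairAt p 0) (κ : Fin 3 → ℂ) (j : Fin 3)
    (n : Fin 3 → ℕ) : dualCoeff n (thetaLog κ j p) = dualLin (n j) (κ j) * dualCoeff n p := by
  apply dual_ext
  · simp [dualCoeff]
    exact taylorCoeff_theta hp.1 n j
  · have := taylorCoeff_add (theta_analyticAt hp.2 j)
      (analyticAt_const.fun_mul hp.1 : AnalyticAt ℂ (fun u => κ j * p.1 u) 0) n
    rw [taylorCoeff_theta hp.2, taylorCoeff_const_mul hp.1] at this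
    simp only [dualCoeff, thetaLog, snd_dualLin, this, DualNumber.snd_mul, fst_dualLin]

theorem dualCoeff_coordMul (hp : AnalyticPairAt p 0) (j : Fin 3) (n : Fin 3 → ℕ) :
    dualCoeff (n + Pi.single j 1) (coordMul j p) = dualCoeff n p := by
  apply dual_ext
  · simp [dualCoeff]
    exact taylorCoeff_coord_mul hp.1 n j
  · simp [dualCoeff]
    exact taylorCoeff_coord_mul hp.2 n j

theorem dualCoeff_coordMul_of_eq_zero (hp : AnalyticPairAt p 0) {j : Fin 3} {n : Fin 3 → ℕ}
    (hn : n j = 0) : dualCoeff n (coordMul j p) = 0 := by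
  apply dual_ext
  · simp [dualCoeff]
    exact taylorCoeff_coord_mul_of_eq_zero hp.1 hn
  · simp [dualCoeff]
    exact taylorCoeff_coord_mul_of_eq_zero hp.2 hn

theorem dualLin_ofNat (k : ℕ) [k.AtLeastTwo] : dualLin ofNat(k) 0 = ofNat(k) := by
  rw [dualLin, TrivSqZeroExt.inr_zero, add_zero]
  exact TrivSqZeroExt.inl_natCast k

theorem dualCoeff_picardFuchsLog₁ (hp : AnalyticPairAt p 0) (κ : Fin 3 → ℂ) (n : Fin 3 → ℕ) :
    dualCoeff n (picardFuchsLog₁ κ p) =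
      dualLin (n 0) (κ 0) * (dualLin (n 0) (κ 0) - 2 * dualLin (n 1) (κ 1)
        - 2 * dualLin (n 2) (κ 2)) * dualCoeff n p
      - 12 * (6 * dualLin (n 0) (κ 0) - 5) * (6 * dualLin (n 0) (κ 0) - 1)
        * dualCoeff n (coordMul 0 p) := by
  have hA := hp.coordMul 0
  have hA1 := (hA.thetaLog κ 0).smul 6
  have hB := hA1.sub hA
  have hB1 := (hB.thetaLog κ 0).smul 6
  have h0 := hp.thetaLog κ 0
  have h1 := (hp.thetaLog κ 1).smul 2
  have h2 := (hp.thetaLog κ 2).smul 2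
  have hC := (h0.sub h1).sub h2
  unfold picardFuchsLog₁
  rw [dualCoeff_sub (hC.thetaLog κ 0) ((hB1.sub (hB.smul 5)).smul 12), dualCoeff_thetaLog hC,
    dualCoeff_sub (h0.sub h1) h2, dualCoeff_sub h0 h1, dualCoeff_smul (hp.thetaLog κ 1),
    dualCoeff_smul (hp.thetaLog κ 2), dualCoeff_thetaLog hp, dualCoeff_thetaLog hp,
    dualCoeff_thetaLog hp, dualCoeff_smul (hB1.sub (hB.smul 5)), dualCoeff_sub hB1 (hB.smul 5),
    dualCoeff_smul (hB.thetaLog κ 0), dualCoeff_smul hB, dualCoeff_thetaLog hB,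
    dualCoeff_sub hA1 hA, dualCoeff_smul (hA.thetaLog κ 0), dualCoeff_thetaLog hA]
  simp only [dualLin_ofNat]
  ring

theorem dualCoeff_picardFuchsBaseLog (hp : AnalyticPairAt p 0) (κ : Fin 3 → ℂ) (i : Fin 3)
    (n : Fin 3 → ℕ) :
    dualCoeff n (picardFuchsBaseLog κ i p) =
      dualLin (n i) (κ i) ^ 2 * dualCoeff n p
      - (2 * dualLin (n 1) (κ 1) + 2 * dualLin (n 2) (κ 2) - dualLin (n 0) (κ 0) - 2)
        * (2 * dualLin (n 1) (κ 1) + 2 * dualLin (n 2) (κ 2) - dualLin (n 0) (κ 0) - 1)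
        * dualCoeff n (coordMul i p) := by
  have hA := hp.coordMul i
  have a1 := (hA.thetaLog κ 1).smul 2
  have a2 := (hA.thetaLog κ 2).smul 2
  have a0 := hA.thetaLog κ 0
  have hB := ((a1.add a2).sub a0).sub hA
  have b1 := (hB.thetaLog κ 1).smul 2
  have b2 := (hB.thetaLog κ 2).smul 2
  have b0 := hB.thetaLog κ 0
  unfold picardFuchsBaseLog
  rw [dualCoeff_sub ((hp.thetaLog κ i).thetaLog κ i) (((b1.add b2).sub b0).sub (hB.smul 2)),
    dualCoeff_thetaLog (hp.thetaLog κ i), dualCoeff_thetaLog hp,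
    dualCoeff_sub ((b1.add b2).sub b0) (hB.smul 2), dualCoeff_sub (b1.add b2) b0,
    dualCoeff_add b1 b2, dualCoeff_smul (hB.thetaLog κ 1), dualCoeff_smul (hB.thetaLog κ 2),
    dualCoeff_smul hB, dualCoeff_thetaLog hB, dualCoeff_thetaLog hB, dualCoeff_thetaLog hB,
    dualCoeff_sub ((a1.add a2).sub a0) hA, dualCoeff_sub (a1.add a2) a0, dualCoeff_add a1 a2,
    dualCoeff_smul (hA.thetaLog κ 1), dualCoeff_smul (hA.thetaLog κ 2),
    dualCoeff_thetaLog hA, dualCoeff_thetaLog hA, dualCoeff_thetaLog hA]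
  simp only [dualLin_ofNat]
  ring

end DualCoeff


/-! ### The coefficients of the Frobenius solutions -/

/-- `Γ(6ρ + 6k + 1) / (Γ(3ρ + 3k + 1) Γ(2ρ + 2k + 1))` at `ρ = κ ε`, normalized to be `1` at
`k = 0`. -/
def frobeniusNum (κ : ℂ) : ℕ → DualNumber ℂ
  | 0 => 1
  | k + 1 => 12 * (6 * dualLin (k + 1 : ℕ) κ - 5) * (6 * dualLin (k + 1 : ℕ) κ - 1) *
      dualLinInv (k + 1 : ℕ) κ * frobeniusNum κ k

/-- `1 / Γ(ρ + k + 1)` at `ρ = κ ε`, normalized to be `1` at `k = 0`. -/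
def frobeniusInv (κ : ℂ) : ℕ → DualNumber ℂ
  | 0 => 1
  | k + 1 => dualLinInv (k + 1 : ℕ) κ * frobeniusInv κ k

/-- `1 / Γ(ρ - k)` at `ρ = κ ε`, with the normalization of `frobeniusInv`. -/
def frobeniusInvNeg (κ : ℂ) : ℕ → DualNumber ℂ
  | 0 => dualLin 0 κ
  | k + 1 => dualLin (-(k + 1 : ℕ)) κ * frobeniusInvNeg κ k

/-- `1 / Γ(ρ + m + 1)` at `ρ = κ ε`, for an integer `m`. -/
def frobeniusInvInt (κ : ℂ) : ℤ → DualNumber ℂ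
  | .ofNat k => frobeniusInv κ k
  | .negSucc k => frobeniusInvNeg κ k

theorem dualLin_mul_frobeniusNum (κ : ℂ) (k : ℕ) :
    dualLin (k + 1 : ℕ) κ * frobeniusNum κ (k + 1) =
      12 * (6 * dualLin (k + 1 : ℕ) κ - 5) * (6 * dualLin (k + 1 : ℕ) κ - 1) *
        frobeniusNum κ k := by
  have h := dualLin_mul_inv (k := (k + 1 : ℕ)) (by exact_mod_cast k.succ_ne_zero) κ
  rw [frobeniusNum]
  linear_combination (12 * (6 * dualLin (k + 1 : ℕ) κ - 5) * (6 * dualLin (k + 1 : ℕ) κ - 1) *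
        frobeniusNum κ k) * h

theorem dualLin_mul_frobeniusInv (κ : ℂ) (k : ℕ) :
    dualLin (k + 1 : ℕ) κ * frobeniusInv κ (k + 1) = frobeniusInv κ k := by
  have h := dualLin_mul_inv (k := (k + 1 : ℕ)) (by exact_mod_cast k.succ_ne_zero) κ
  rw [frobeniusInv]
  linear_combination frobeniusInv κ k * h

theorem dualLin_mul_frobeniusInvInt (κ : ℂ) (m : ℤ) :
    dualLin m κ * frobeniusInvInt κ m = frobeniusInvInt κ (m - 1) := by
  obtain ⟨k, rfl⟩ | ⟨k, rfl⟩ : (∃ k : ℕ, m = k) ∨ ∃ k : ℕ, m = Int.negSucc k := by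
    cases m
    · exact Or.inl ⟨_, rfl⟩
    · exact Or.inr ⟨_, rfl⟩
  · cases k with
    | zero =>
      change dualLin ((0 : ℤ) : ℂ) κ * 1 = dualLin 0 κ
      simp
    | succ k =>
      have e : ((k + 1 : ℕ) : ℤ) - 1 = (k : ℕ) := by push_cast; ring
      rw [e]
      exact_mod_cast dualLin_mul_frobeniusInv κ k
  · have e : Int.negSucc k - 1 = Int.negSucc (k + 1) := by omega
    rw [e]
    change _ = dualLin (-(k + 1 : ℕ)) κ * frobeniusInvNeg κ k
    congr 2
    rw [Int.cast_negSucc]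

theorem fst_frobeniusInvNeg (κ : ℂ) (k : ℕ) : (frobeniusInvNeg κ k).fst = 0 := by
  induction k with
  | zero => simp [frobeniusInvNeg]
  | succ k ih => simp [frobeniusInvNeg, ih]

/-- The Taylor coefficients of the Frobenius solution `∑ c(n + ρ) u^(n + ρ)` at `ρ = κ ε`. -/
def frobeniusCoeff (κ : Fin 3 → ℂ) (n : Fin 3 → ℕ) : DualNumber ℂ :=
  frobeniusNum (κ 0) (n 0) * frobeniusInv (κ 1) (n 1) ^ 2 * frobeniusInv (κ 2) (n 2) ^ 2 *
    frobeniusInvInt (κ 0 - 2 * κ 1 - 2 * κ 2) ((n 0 : ℤ) - 2 * n 1 - 2 * n 2)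

/-- The first components do not depend on `κ`: all logarithmic solutions have the same
holomorphic solution in front of the logarithm. -/
theorem fst_frobeniusCoeff (κ : Fin 3 → ℂ) (n : Fin 3 → ℕ) :
    (frobeniusCoeff κ n).fst = (frobeniusCoeff 0 n).fst := by
  have h1 : ∀ κ k, (frobeniusNum κ k).fst = (frobeniusNum 0 k).fst := by
    intro κ k
    induction k with
    | zero => rfl
    | succ k ih =>
      simp only [frobeniusNum, TrivSqZeroExt.fst_mul, TrivSqZeroExt.fst_sub, fst_dualLin, ih,
        dualLinInv]
  have h2 : ∀ κ k, (frobeniusInv κ k).fst = (frobeniusInv 0 k).fst := by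
    intro κ k
    induction k with
    | zero => rfl
    | succ k ih => simp [frobeniusInv, ih, dualLinInv]
  have h3 : ∀ κ m, (frobeniusInvInt κ m).fst = (frobeniusInvInt 0 m).fst := by
    intro κ m
    cases m with
    | ofNat k => exact h2 κ k
    | negSucc k => exact (fst_frobeniusInvNeg κ k).trans (fst_frobeniusInvNeg 0 k).symm
  simp only [frobeniusCoeff, TrivSqZeroExt.fst_mul, TrivSqZeroExt.fst_pow]
  rw [h1, h2 (κ 1), h2 (κ 2), h3]
  simp

theorem dualLin_combination (κ : Fin 3 → ℂ) (n : Fin 3 → ℕ) :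
    dualLin (n 0) (κ 0) - 2 * dualLin (n 1) (κ 1) - 2 * dualLin (n 2) (κ 2) =
      dualLin (((n 0 : ℤ) - 2 * n 1 - 2 * n 2 : ℤ) : ℂ) (κ 0 - 2 * κ 1 - 2 * κ 2) := by
  rw [← dualLin_ofNat 2]
  apply dual_ext <;> simp

theorem dualLin_add_one (k κ : ℂ) : dualLin (k + 1) κ = dualLin k κ + 1 := by
  apply dual_ext <;> simp

theorem dualLin_zero_mul (κ κ' : ℂ) : dualLin 0 κ * dualLin 0 κ' = 0 := by
  apply dual_ext <;> simp

/-- For `m ≤ 0` the dual number `(m + κ' ε) / Γ(κ' ε + m + 1) = 1 / Γ(κ' ε + m)` is a multiple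
of `ε`, since `1 / Γ` vanishes at `m`. -/
theorem dualLin_zero_mul_frobeniusInvInt (κ κ' : ℂ) {m : ℤ} (hm : m ≤ 0) :
    dualLin 0 κ * (dualLin m κ' * frobeniusInvInt κ' m) = 0 := by
  rw [dualLin_mul_frobeniusInvInt]
  obtain ⟨k, hk⟩ : ∃ k : ℕ, m - 1 = Int.negSucc k := Int.eq_negSucc_of_lt_zero (by omega)
  rw [hk]
  change _ * frobeniusInvNeg κ' k = 0
  apply dual_ext <;> simp [fst_frobeniusInvNeg]

/-- The recursion of `L₁`. At `n₁ = 0`, where there is no preceding coefficient, the leading term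
vanishes because `ε² = 0`. -/
theorem picardFuchsLog₁_eq_zero {p : ((Fin 3 → ℂ) → ℂ) × ((Fin 3 → ℂ) → ℂ)}
    (hp : AnalyticPairAt p 0) {κ : Fin 3 → ℂ} (hc : ∀ n, dualCoeff n p = frobeniusCoeff κ n)
    (n : Fin 3 → ℕ) : dualCoeff n (picardFuchsLog₁ κ p) = 0 := by
  rw [dualCoeff_picardFuchsLog₁ hp, dualLin_combination, hc]
  by_cases hn : n 0 = 0
  · rw [dualCoeff_coordMul_of_eq_zero hp hn]
    have := dualLin_zero_mul_frobeniusInvInt (κ 0) (κ 0 - 2 * κ 1 - 2 * κ 2)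
      (m := (n 0 : ℤ) - 2 * n 1 - 2 * n 2) (by omega)
    rw [hn] at this ⊢
    simp only [frobeniusCoeff, hn, Nat.cast_zero] at this ⊢
    linear_combination (frobeniusNum (κ 0) 0 * frobeniusInv (κ 1) (n 1) ^ 2 *
      frobeniusInv (κ 2) (n 2) ^ 2) * this
  · obtain ⟨m, rfl⟩ := exists_eq_add_single hn
    rw [dualCoeff_coordMul hp, hc]
    have h1 := dualLin_mul_frobeniusNum (κ 0) (m 0)
    have h2 := dualLin_mul_frobeniusInvInt (κ 0 - 2 * κ 1 - 2 * κ 2)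
      (((m 0 + 1 : ℕ) : ℤ) - 2 * m 1 - 2 * m 2)
    have e : ((m 0 + 1 : ℕ) : ℤ) - 2 * m 1 - 2 * m 2 - 1 = (m 0 : ℤ) - 2 * m 1 - 2 * m 2 := by
      push_cast; ring
    rw [e] at h2
    simp only [frobeniusCoeff, Pi.add_apply, Pi.single_eq_same, ne_eq, one_ne_zero,
      not_false_eq_true, Pi.single_eq_of_ne, add_zero, Fin.reduceEq]
    linear_combination (dualLin (((m 0 + 1 : ℕ) : ℤ) - 2 * m 1 - 2 * m 2 : ℤ)
      (κ 0 - 2 * κ 1 - 2 * κ 2) * frobeniusInvInt (κ 0 - 2 * κ 1 - 2 * κ 2)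
      (((m 0 + 1 : ℕ) : ℤ) - 2 * m 1 - 2 * m 2) * frobeniusInv (κ 1) (m 1) ^ 2 *
      frobeniusInv (κ 2) (m 2) ^ 2) * h1 + (12 * (6 * dualLin (m 0 + 1 : ℕ) (κ 0) - 5) *
      (6 * dualLin (m 0 + 1 : ℕ) (κ 0) - 1) * frobeniusNum (κ 0) (m 0) *
      frobeniusInv (κ 1) (m 1) ^ 2 * frobeniusInv (κ 2) (m 2) ^ 2) * h2

/-- The recursion of `L₂` and `L₃`, with the term `n_i = 0` again killed by `ε² = 0`. -/
theorem picardFuchsBaseLog_eq_zero {p : ((Fin 3 → ℂ) → ℂ) × ((Fin 3 → ℂ) → ℂ)}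
    (hp : AnalyticPairAt p 0) {κ : Fin 3 → ℂ} (hc : ∀ n, dualCoeff n p = frobeniusCoeff κ n)
    {i : Fin 3} (hi : i ≠ 0) (n : Fin 3 → ℕ) :
    dualCoeff n (picardFuchsBaseLog κ i p) = 0 := by
  have hcomb := dualLin_combination κ n
  have e1 : 2 * dualLin (n 1) (κ 1) + 2 * dualLin (n 2) (κ 2) - dualLin (n 0) (κ 0) - 2 =
      -(dualLin (((n 0 : ℤ) - 2 * n 1 - 2 * n 2 : ℤ) : ℂ) (κ 0 - 2 * κ 1 - 2 * κ 2) + 1 + 1) := by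
    linear_combination -hcomb
  have e2 : 2 * dualLin (n 1) (κ 1) + 2 * dualLin (n 2) (κ 2) - dualLin (n 0) (κ 0) - 1 =
      -(dualLin (((n 0 : ℤ) - 2 * n 1 - 2 * n 2 : ℤ) : ℂ) (κ 0 - 2 * κ 1 - 2 * κ 2) + 1) := by
    linear_combination -hcomb
  rw [dualCoeff_picardFuchsBaseLog hp, e1, e2, hc, ← dualLin_add_one, ← dualLin_add_one]
  by_cases hn : n i = 0
  · rw [dualCoeff_coordMul_of_eq_zero hp hn, hn, Nat.cast_zero, pow_two, dualLin_zero_mul]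
    ring
  · obtain ⟨m, rfl⟩ := exists_eq_add_single hn
    rw [dualCoeff_coordMul hp, hc]
    have h1 := dualLin_mul_frobeniusInv (κ i) (m i)
    have h2 := dualLin_mul_frobeniusInvInt (κ 0 - 2 * κ 1 - 2 * κ 2)
      ((m 0 : ℤ) - 2 * m 1 - 2 * m 2)
    have h3 := dualLin_mul_frobeniusInvInt (κ 0 - 2 * κ 1 - 2 * κ 2)
      ((m 0 : ℤ) - 2 * m 1 - 2 * m 2 - 1)
    have h23 := congrArg₂ (· * ·) h1 h1
    fin_cases i
    · exact absurd rfl hi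
    · have ea : (m 0 : ℤ) - 2 * ((m 1 + 1 : ℕ) : ℤ) - 2 * m 2 =
          (m 0 : ℤ) - 2 * m 1 - 2 * m 2 - 1 - 1 := by push_cast; ring
      simp only [frobeniusCoeff, Fin.mk_one, Pi.add_apply, Pi.single_eq_same, ne_eq, one_ne_zero,
        not_false_eq_true, Pi.single_eq_of_ne, add_zero, Fin.reduceEq, zero_ne_one] at *
      rw [ea, ← h3, ← h2]
      have eb : (((m 0 : ℤ) - 2 * m 1 - 2 * m 2 - 1 - 1 : ℤ) : ℂ) + 1 =
        (((m 0 : ℤ) - 2 * m 1 - 2 * m 2 - 1 : ℤ) : ℂ) := by push_cast; ring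
      have ec : (((m 0 : ℤ) - 2 * m 1 - 2 * m 2 - 1 : ℤ) : ℂ) + 1 =
        (((m 0 : ℤ) - 2 * m 1 - 2 * m 2 : ℤ) : ℂ) := by push_cast; ring
      rw [eb, ec]
      set r := frobeniusInvInt (κ 0 - 2 * κ 1 - 2 * κ 2) ((m 0 : ℤ) - 2 * m 1 - 2 * m 2)
      linear_combination (frobeniusNum (κ 0) (m 0) * frobeniusInv (κ 2) (m 2) ^ 2 * r *
        dualLin (((m 0 : ℤ) - 2 * m 1 - 2 * m 2 - 1 : ℤ) : ℂ) (κ 0 - 2 * κ 1 - 2 * κ 2) *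
        dualLin (((m 0 : ℤ) - 2 * m 1 - 2 * m 2 : ℤ) : ℂ) (κ 0 - 2 * κ 1 - 2 * κ 2)) * h23
    · have ea : (m 0 : ℤ) - 2 * m 1 - 2 * ((m 2 + 1 : ℕ) : ℤ) =
          (m 0 : ℤ) - 2 * m 1 - 2 * m 2 - 1 - 1 := by push_cast; ring
      simp only [frobeniusCoeff, Fin.reduceFinMk, Pi.add_apply, Pi.single_eq_same, ne_eq,
        not_false_eq_true, Pi.single_eq_of_ne, add_zero, Fin.reduceEq] at *
      rw [ea, ← h3, ← h2]
      have eb : (((m 0 : ℤ) - 2 * m 1 - 2 * m 2 - 1 - 1 : ℤ) : ℂ) + 1 =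
        (((m 0 : ℤ) - 2 * m 1 - 2 * m 2 - 1 : ℤ) : ℂ) := by push_cast; ring
      have ec : (((m 0 : ℤ) - 2 * m 1 - 2 * m 2 - 1 : ℤ) : ℂ) + 1 =
        (((m 0 : ℤ) - 2 * m 1 - 2 * m 2 : ℤ) : ℂ) := by push_cast; ring
      rw [eb, ec]
      set r := frobeniusInvInt (κ 0 - 2 * κ 1 - 2 * κ 2) ((m 0 : ℤ) - 2 * m 1 - 2 * m 2)
      linear_combination (frobeniusNum (κ 0) (m 0) * frobeniusInv (κ 1) (m 1) ^ 2 * r *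
        dualLin (((m 0 : ℤ) - 2 * m 1 - 2 * m 2 - 1 : ℤ) : ℂ) (κ 0 - 2 * κ 1 - 2 * κ 2) *
        dualLin (((m 0 : ℤ) - 2 * m 1 - 2 * m 2 : ℤ) : ℂ) (κ 0 - 2 * κ 1 - 2 * κ 2)) * h23


/-! ### Growth of the Frobenius coefficients -/

/-- The `ℓ¹` norm of a dual number. -/
def dualNorm (x : DualNumber ℂ) : ℝ := ‖x.fst‖ + ‖x.snd‖

theorem dualNorm_nonneg (x : DualNumber ℂ) : 0 ≤ dualNorm x := by unfold dualNorm; positivity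

theorem dualNorm_mul_le (x y : DualNumber ℂ) : dualNorm (x * y) ≤ dualNorm x * dualNorm y := by
  unfold dualNorm
  rw [TrivSqZeroExt.fst_mul, DualNumber.snd_mul, norm_mul]
  have := norm_add_le (x.fst * y.snd) (x.snd * y.fst)
  rw [norm_mul, norm_mul] at this
  nlinarith [mul_nonneg (norm_nonneg x.snd) (norm_nonneg y.snd)]

theorem dualNorm_sub_le (x y : DualNumber ℂ) : dualNorm (x - y) ≤ dualNorm x + dualNorm y := by
  unfold dualNorm
  rw [TrivSqZeroExt.fst_sub, TrivSqZeroExt.snd_sub]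
  linarith [norm_sub_le x.fst y.fst, norm_sub_le x.snd y.snd]

theorem dualNorm_dualLin (k κ : ℂ) : dualNorm (dualLin k κ) = ‖k‖ + ‖κ‖ := by simp [dualNorm]

theorem dualNorm_one : dualNorm 1 = 1 := by simp [dualNorm]

theorem dualNorm_ofNat (k : ℕ) [k.AtLeastTwo] : dualNorm ofNat(k) = ofNat(k) := by
  rw [← dualLin_ofNat, dualNorm_dualLin, norm_zero, add_zero]
  exact Complex.norm_natCast k

theorem dualNorm_mul_le_of_le {x y : DualNumber ℂ} {a b : ℝ} (hx : dualNorm x ≤ a)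
    (hy : dualNorm y ≤ b) : dualNorm (x * y) ≤ a * b :=
  (dualNorm_mul_le x y).trans
    (mul_le_mul hx hy (dualNorm_nonneg y) ((dualNorm_nonneg x).trans hx))

theorem dualNorm_dualLinInv_le {κ : ℂ} (hκ : ‖κ‖ ≤ 2) (k : ℕ) :
    dualNorm (dualLinInv (k + 1 : ℕ) κ) ≤ 3 / (k + 1) := by
  rw [dualLinInv, dualNorm_dualLin, norm_inv, norm_div, norm_neg, norm_pow, Complex.norm_natCast]
  push_cast
  have h1 : (0 : ℝ) < k + 1 := by positivity
  have h2 : ‖κ‖ / ((k : ℝ) + 1) ^ 2 ≤ 2 / (k + 1) := by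
    rw [div_le_div_iff₀ (by positivity) h1]
    have : (1 : ℝ) ≤ k + 1 := by linarith [k.cast_nonneg (α := ℝ)]
    nlinarith [norm_nonneg κ]
  calc ((k : ℝ) + 1)⁻¹ + ‖κ‖ / ((k : ℝ) + 1) ^ 2 ≤ 1 / (k + 1) + 2 / (k + 1) := by
        rw [one_div]; gcongr
    _ = 3 / (k + 1) := by rw [← add_div]; norm_num

theorem dualNorm_frobeniusNum_le {κ : ℂ} (hκ : ‖κ‖ ≤ 2) (k : ℕ) :
    dualNorm (frobeniusNum κ k) ≤ 16000 ^ k * k.factorial := by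
  induction k with
  | zero => simp [frobeniusNum, dualNorm_one]
  | succ k ih =>
    have h0 : (0 : ℝ) ≤ k := k.cast_nonneg
    have hX : dualNorm (6 * dualLin (k + 1 : ℕ) κ) ≤ 6 * (k + 1 + 2) := by
      refine dualNorm_mul_le_of_le (dualNorm_ofNat 6).le ?_
      rw [dualNorm_dualLin, Complex.norm_natCast]; push_cast; linarith
    have h5 : dualNorm (6 * dualLin (k + 1 : ℕ) κ - 5) ≤ 23 * (k + 1) := by
      refine (dualNorm_sub_le _ _).trans ?_
      rw [dualNorm_ofNat]; linarith
    have h1 : dualNorm (6 * dualLin (k + 1 : ℕ) κ - 1) ≤ 19 * (k + 1) := by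
      refine (dualNorm_sub_le _ _).trans ?_
      rw [dualNorm_one]; linarith
    rw [frobeniusNum]
    refine (dualNorm_mul_le_of_le (dualNorm_mul_le_of_le (dualNorm_mul_le_of_le
      (dualNorm_mul_le_of_le (dualNorm_ofNat 12).le h5) h1) (dualNorm_dualLinInv_le hκ k))
      ih).trans ?_
    rw [Nat.factorial_succ, pow_succ]
    have h2 : (0 : ℝ) < k + 1 := by positivity
    have e : (12 : ℝ) * (23 * (k + 1)) * (19 * (k + 1)) * (3 / (k + 1)) = 15732 * (k + 1) := by
      field_simp; ring
    rw [show (OfNat.ofNat 12 : ℝ) = 12 from rfl, e]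
    push_cast
    have h3 : (0 : ℝ) ≤ 16000 ^ k * k.factorial * (k + 1) := by positivity
    linarith

theorem dualNorm_frobeniusInv_le {κ : ℂ} (hκ : ‖κ‖ ≤ 2) (k : ℕ) :
    dualNorm (frobeniusInv κ k) ≤ 3 ^ k / k.factorial := by
  induction k with
  | zero => simp [frobeniusInv, dualNorm_one]
  | succ k ih =>
    rw [frobeniusInv]
    refine (dualNorm_mul_le_of_le (dualNorm_dualLinInv_le hκ k) ih).trans (le_of_eq ?_)
    rw [Nat.factorial_succ, pow_succ]
    push_cast
    field_simp

theorem dualNorm_frobeniusInvNeg_le {κ : ℂ} (hκ : ‖κ‖ ≤ 2) (k : ℕ) :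
    dualNorm (frobeniusInvNeg κ k) ≤ 2 * 3 ^ k * k.factorial := by
  induction k with
  | zero => simpa [frobeniusInvNeg, dualNorm_dualLin] using hκ
  | succ k ih =>
    rw [frobeniusInvNeg]
    have h1 : dualNorm (dualLin (-(k + 1 : ℕ)) κ) ≤ 3 * (k + 1) := by
      rw [dualNorm_dualLin, norm_neg, Complex.norm_natCast]
      push_cast
      linarith [k.cast_nonneg (α := ℝ)]
    refine (dualNorm_mul_le_of_le h1 ih).trans (le_of_eq ?_)
    rw [Nat.factorial_succ, pow_succ]
    push_cast
    ring

theorem factorial_add_le (p q : ℕ) :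
    ((p + q).factorial : ℝ) ≤ 2 ^ (p + q) * p.factorial * q.factorial := by
  have h := Nat.add_choose_mul_factorial_mul_factorial p q
  have h2 := Nat.choose_le_two_pow (p + q) q
  rw [← h]
  push_cast
  have h3 : (((p + q).choose q : ℕ) : ℝ) ≤ 2 ^ (p + q) := by exact_mod_cast h2
  gcongr

theorem factorial_two_mul_add_le (p q : ℕ) :
    ((2 * p + 2 * q).factorial : ℝ) ≤ 16 ^ (p + q) * p.factorial ^ 2 * q.factorial ^ 2 := by
  have hp := factorial_add_le p p
  have hq := factorial_add_le q q
  rw [← two_mul] at hp hq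
  calc ((2 * p + 2 * q).factorial : ℝ)
      ≤ 2 ^ (2 * p + 2 * q) * (2 * p).factorial * (2 * q).factorial := factorial_add_le _ _
    _ ≤ 2 ^ (2 * p + 2 * q) * (2 ^ (2 * p) * p.factorial * p.factorial) *
          (2 ^ (2 * q) * q.factorial * q.factorial) := by gcongr
    _ = 16 ^ (p + q) * p.factorial ^ 2 * q.factorial ^ 2 := by
        rw [show (16 : ℝ) = 2 ^ 4 by norm_num, ← pow_mul]
        ring

/-- The coefficients grow at most exponentially. The factorials of `n₁`, `n₂`, `n₃` and
`|n₁ - 2 n₂ - 2 n₃|` balance up to multinomial coefficients, according to the sign of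
`n₁ - 2 n₂ - 2 n₃`. -/
theorem dualNorm_frobeniusCoeff_le {κ : Fin 3 → ℂ} (h0 : ‖κ 0‖ ≤ 2) (h1 : ‖κ 1‖ ≤ 2)
    (h2 : ‖κ 2‖ ≤ 2) (h3 : ‖κ 0 - 2 * κ 1 - 2 * κ 2‖ ≤ 2) (n : Fin 3 → ℕ) :
    dualNorm (frobeniusCoeff κ n) ≤ 2 * 96000 ^ (n 0 + n 1 + n 2) := by
  have b0 := dualNorm_frobeniusNum_le h0 (n 0)
  have b1 := dualNorm_frobeniusInv_le h1 (n 1)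
  have b2 := dualNorm_frobeniusInv_le h2 (n 2)
  have b11 := dualNorm_mul_le_of_le b1 b1
  have b22 := dualNorm_mul_le_of_le b2 b2
  rw [← pow_two, ← pow_two] at b11 b22
  unfold frobeniusCoeff
  have hF := factorial_two_mul_add_le (n 1) (n 2)
  obtain ⟨s, hs⟩ | ⟨t, ht⟩ : (∃ s : ℕ, (n 0 : ℤ) - 2 * n 1 - 2 * n 2 = s) ∨
      ∃ t : ℕ, (n 0 : ℤ) - 2 * n 1 - 2 * n 2 = Int.negSucc t := by
    cases (n 0 : ℤ) - 2 * n 1 - 2 * n 2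
    · exact Or.inl ⟨_, rfl⟩
    · exact Or.inr ⟨_, rfl⟩
  · rw [hs]
    have b3 := dualNorm_frobeniusInv_le h3 s
    refine (dualNorm_mul_le_of_le (dualNorm_mul_le_of_le (dualNorm_mul_le_of_le b0 b11) b22)
      b3).trans ?_
    have en : n 0 = s + (2 * n 1 + 2 * n 2) := by omega
    have hfac : ((n 0).factorial : ℝ) ≤ 2 ^ (n 0) * s.factorial *
        (16 ^ (n 1 + n 2) * (n 1).factorial ^ 2 * (n 2).factorial ^ 2) := by
      calc ((n 0).factorial : ℝ) = (s + (2 * n 1 + 2 * n 2)).factorial := by rw [← en]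
        _ ≤ 2 ^ (n 0) * s.factorial * (2 * n 1 + 2 * n 2).factorial := by
            rw [en]; exact factorial_add_le _ _
        _ ≤ _ := by gcongr
    calc (16000 : ℝ) ^ n 0 * (n 0).factorial * (3 ^ n 1 / (n 1).factorial) ^ 2 *
          (3 ^ n 2 / (n 2).factorial) ^ 2 * (3 ^ s / s.factorial)
        ≤ 16000 ^ n 0 * (2 ^ (n 0) * s.factorial *
          (16 ^ (n 1 + n 2) * (n 1).factorial ^ 2 * (n 2).factorial ^ 2)) *
          (3 ^ n 1 / (n 1).factorial) ^ 2 * (3 ^ n 2 / (n 2).factorial) ^ 2 *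
          (3 ^ s / s.factorial) := by gcongr
      _ = 32000 ^ n 0 * 144 ^ (n 1 + n 2) * 3 ^ s := by
          rw [show (32000 : ℝ) = 16000 * 2 by norm_num, show (144 : ℝ) = 16 * 3 ^ 2 by norm_num,
            mul_pow, mul_pow, ← pow_mul, pow_add (16 : ℝ)]
          field_simp
          ring
      _ ≤ 32000 ^ n 0 * 96000 ^ (n 1 + n 2) * 3 ^ n 0 := by
          gcongr
          · norm_num
          · norm_num
          · omega
      _ = 1 * 96000 ^ (n 0 + n 1 + n 2) := by
          rw [show (96000 : ℝ) ^ (n 0 + n 1 + n 2) = 96000 ^ n 0 * 96000 ^ (n 1 + n 2) by ring]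
          rw [show (96000 : ℝ) ^ n 0 = 32000 ^ n 0 * 3 ^ n 0 by rw [← mul_pow]; norm_num]
          ring
      _ ≤ 2 * 96000 ^ (n 0 + n 1 + n 2) := by gcongr; norm_num
  · rw [ht]
    have b3 := dualNorm_frobeniusInvNeg_le h3 t
    refine (dualNorm_mul_le_of_le (dualNorm_mul_le_of_le (dualNorm_mul_le_of_le b0 b11) b22)
      b3).trans ?_
    have en : n 0 + t ≤ 2 * n 1 + 2 * n 2 := by omega
    have hfac : ((n 0).factorial : ℝ) * t.factorial ≤
        16 ^ (n 1 + n 2) * (n 1).factorial ^ 2 * (n 2).factorial ^ 2 := by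
      refine le_trans ?_ hF
      exact_mod_cast (Nat.factorial_mul_factorial_dvd_factorial_add (n 0) t |>
        Nat.le_of_dvd (Nat.factorial_pos _)).trans (Nat.factorial_le en)
    calc (16000 : ℝ) ^ n 0 * ((n 0).factorial : ℝ) * (3 ^ n 1 / (n 1).factorial) ^ 2 *
          (3 ^ n 2 / (n 2).factorial) ^ 2 * (2 * 3 ^ t * t.factorial)
        = 16000 ^ n 0 * (((n 0).factorial : ℝ) * t.factorial) * (3 ^ n 1 / (n 1).factorial) ^ 2 *
          (3 ^ n 2 / (n 2).factorial) ^ 2 * (2 * 3 ^ t) := by ring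
      _ ≤ 16000 ^ n 0 * (16 ^ (n 1 + n 2) * ((n 1).factorial : ℝ) ^ 2 * (n 2).factorial ^ 2) *
          (3 ^ n 1 / (n 1).factorial) ^ 2 *
          (3 ^ n 2 / (n 2).factorial) ^ 2 * (2 * 3 ^ t) := by gcongr
      _ = 2 * (16000 ^ n 0 * 144 ^ (n 1 + n 2) * 3 ^ t) := by
          rw [show (144 : ℝ) = 16 * 3 ^ 2 by norm_num, mul_pow, ← pow_mul, pow_add (16 : ℝ)]
          field_simp
          ring
      _ ≤ 2 * (96000 ^ n 0 * 144 ^ (n 1 + n 2) * 3 ^ (2 * (n 1 + n 2))) := by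
          gcongr
          · norm_num
          · norm_num
          · omega
      _ = 2 * (96000 ^ n 0 * 1296 ^ (n 1 + n 2)) := by
          rw [pow_mul, mul_assoc, ← mul_pow]; norm_num
      _ ≤ 2 * (96000 ^ n 0 * 96000 ^ (n 1 + n 2)) := by gcongr; norm_num
      _ = 2 * 96000 ^ (n 0 + n 1 + n 2) := by ring

/-! ### Existence of the periods -/

/-- `θ_j (log u_i / (2πi))` is `1 / (2πi)` for `j = i` and `0` otherwise. -/
theorem theta_log_div {i : Fin 3} {u : Fin 3 → ℂ} (hu : u i ∈ slitPlane) (j : Fin 3) :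
    ∀ᶠ v in 𝓝 u, theta j (fun v => log (v i) / (2 * Real.pi * I)) v =
      (Pi.single i (1 / (2 * Real.pi * I)) : Fin 3 → ℂ) j := by
  have h : ∀ᶠ v in 𝓝 u, v i ∈ slitPlane :=
    (continuous_apply i).continuousAt.eventually_mem (isOpen_slitPlane.mem_nhds hu)
  filter_upwards [h] with v hv
  have h1 : HasFDerivAt (fun v : Fin 3 → ℂ => log (v i) / (2 * Real.pi * I)) _ v :=
    ((hasFDerivAt_coord i v).clog hv).mul_const (2 * Real.pi * I : ℂ)⁻¹
  rw [theta, h1.fderiv]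
  have hv0 : v i ≠ 0 := slitPlane_ne_zero hv
  by_cases hij : j = i
  · subst hij
    simp; field_simp
  · simp [hij, Ne.symm hij]

theorem analyticAt_log_div {i : Fin 3} {u : Fin 3 → ℂ} (hu : u i ∈ slitPlane) :
    AnalyticAt ℂ (fun v : Fin 3 → ℂ => log (v i) / (2 * Real.pi * I)) u :=
  ((analyticAt_coord i u).clog hu).div_const

/-- A combination `f ℓ + g` solves the system where both components of the pairs obtained by
applying the operators to `(f, g)` vanish. -/
theorem solves_of_logCombine {ℓ : (Fin 3 → ℂ) → ℂ} {κ u : Fin 3 → ℂ}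
    {p : ((Fin 3 → ℂ) → ℂ) × ((Fin 3 → ℂ) → ℂ)} (hℓ : AnalyticAt ℂ ℓ u)
    (hκ : ∀ j, ∀ᶠ v in 𝓝 u, theta j ℓ v = κ j) (hp : AnalyticPairAt p u)
    (h0 : (picardFuchsLog₁ κ p).1 u = 0 ∧ (picardFuchsLog₁ κ p).2 u = 0)
    (h : ∀ i : Fin 3, i ≠ 0 → (picardFuchsBaseLog κ i p).1 u = 0 ∧
      (picardFuchsBaseLog κ i p).2 u = 0) :
    SolvesPicardFuchsAt (logCombine ℓ p) u := by
  refine ⟨?_, ?_, ?_⟩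
  · rw [(picardFuchs₁_logCombine hℓ hκ hp).eq_of_nhds]; simp [logCombine, h0]
  · rw [(picardFuchsBase_logCombine hℓ hκ hp 1).eq_of_nhds]; simp [logCombine, h 1 (by simp)]
  · rw [(picardFuchsBase_logCombine hℓ hκ hp 2).eq_of_nhds]; simp [logCombine, h 2 (by simp)]

theorem eventually_pair_eq_zero {p : ((Fin 3 → ℂ) → ℂ) × ((Fin 3 → ℂ) → ℂ)}
    (hp : AnalyticPairAt p 0) (h : ∀ n, dualCoeff n p = 0) :
    ∀ᶠ u in 𝓝 0, p.1 u = 0 ∧ p.2 u = 0 := by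
  have h1 := eventually_eq_zero_of_taylorCoeff hp.1 fun n => by
    simpa [dualCoeff] using congrArg TrivSqZeroExt.fst (h n)
  have h2 := eventually_eq_zero_of_taylorCoeff hp.2 fun n => by
    simpa [dualCoeff] using congrArg TrivSqZeroExt.snd (h n)
  filter_upwards [h1, h2] with u hu hu'
  exact ⟨hu, hu'⟩

theorem norm_single_le (i : Fin 3) :
    ∀ j, ‖(Pi.single i (1 / (2 * Real.pi * I)) : Fin 3 → ℂ) j‖ ≤ 1 / 6 := by
  intro j
  have h : ‖(1 / (2 * Real.pi * I) : ℂ)‖ ≤ 1 / 6 := by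
    rw [norm_div, norm_one, norm_mul, norm_mul, Complex.norm_I, Complex.norm_real,
      Real.norm_of_nonneg Real.pi_pos.le, Complex.norm_ofNat]
    apply one_div_le_one_div_of_le (by norm_num)
    linarith [Real.pi_gt_three]
  by_cases hij : j = i
  · subst hij; simpa using h
  · simp [hij]

/-- The standard periods exist: the components of the Frobenius coefficients with `κ = 0` off the
`i`-th place and `κ_i = 1 / (2πi)` are the Taylor coefficients of `ϖ₀` and `g_i`. -/
theorem exists_isStandardPeriods : ∃ ϖ₀ ϖ, IsStandardPeriods ϖ₀ ϖ := by
  have hbound : ∀ κ : Fin 3 → ℂ, (∀ j, ‖κ j‖ ≤ 1 / 6) → ∀ n,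
      dualNorm (frobeniusCoeff κ n) ≤ 2 * 96000 ^ (n 0 + n 1 + n 2) := by
    intro κ hκ n
    refine dualNorm_frobeniusCoeff_le ?_ ?_ ?_ ?_ n
    · linarith [hκ 0]
    · linarith [hκ 1]
    · linarith [hκ 2]
    · have h1 := norm_sub_le (κ 0 - 2 * κ 1) (2 * κ 2)
      have h2 := norm_sub_le (κ 0) (2 * κ 1)
      rw [norm_mul, Complex.norm_ofNat] at h1 h2
      linarith [hκ 0, hκ 1, hκ 2]
  obtain ⟨f, hf, hfc⟩ := exists_analyticAt_taylorCoeff (fun n => (frobeniusCoeff 0 n).fst) 2 96000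
    (by norm_num) fun n => le_trans (le_add_of_nonneg_right (norm_nonneg _))
      (hbound 0 (by simp) n)
  have hg : ∀ i : Fin 3, ∃ g : (Fin 3 → ℂ) → ℂ, AnalyticAt ℂ g 0 ∧ ∀ n, taylorCoeff n g =
      (frobeniusCoeff (Pi.single i (1 / (2 * Real.pi * I))) n).snd := fun i =>
    exists_analyticAt_taylorCoeff _ 2 96000 (by norm_num) fun n =>
      le_trans (le_add_of_nonneg_left (norm_nonneg _)) (hbound _ (norm_single_le i) n)
  choose g hga hgc using hg
  have hp : ∀ i, AnalyticPairAt (f, g i) 0 := fun i => ⟨hf, hga i⟩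
  have hpc : ∀ i n, dualCoeff n (f, g i) =
      frobeniusCoeff (Pi.single i (1 / (2 * Real.pi * I))) n := by
    intro i n
    apply dual_ext
    · rw [fst_frobeniusCoeff]; simp [dualCoeff, hfc]
    · simp [dualCoeff, hgc]
  have hone : ∀ κ, frobeniusCoeff κ 0 = 1 := by
    intro κ
    simp [frobeniusCoeff, frobeniusNum, frobeniusInv]
    rfl
  have hs1 := fun i => eventually_pair_eq_zero ((hp i).picardFuchsLog₁ _)
    (picardFuchsLog₁_eq_zero (hp i) (hpc i))
  have hs2 := fun (i j : Fin 3) (hj : j ≠ 0) => eventually_pair_eq_zero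
    ((hp i).picardFuchsBaseLog _ j) (picardFuchsBaseLog_eq_zero (hp i) (hpc i) hj)
  refine ⟨f, fun i u => f u / (2 * Real.pi * I) * log (u i) + g i u, hf, ?_, ?_, ?_, ?_⟩
  · rw [← taylorCoeff_zero_index f, hfc, hone]; simp
  · filter_upwards [hs1 0, hs2 0 1 (by simp), hs2 0 2 (by simp)] with u h0 h1 h2
    exact ⟨h0.1, h1.1, h2.1⟩
  · intro i
    refine ⟨g i, hga i, ?_, .of_forall fun u _ => rfl⟩
    rw [← taylorCoeff_zero_index (g i), hgc, hone]; simp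
  · intro i
    filter_upwards [hs1 i, hs2 i 1 (by simp), hs2 i 2 (by simp), hf.eventually_analyticAt,
      (hga i).eventually_analyticAt] with u h0 h1 h2 hfu hgu hu
    have e : (fun u : Fin 3 → ℂ => f u / (2 * Real.pi * I) * log (u i) + g i u) =
        logCombine (fun v => log (v i) / (2 * Real.pi * I)) (f, g i) := by
      funext v; simp only [logCombine]; ring
    rw [e]
    refine solves_of_logCombine (analyticAt_log_div (hu i)) (theta_log_div (hu i)) ⟨hfu, hgu⟩ h0 ?_
    intro j hj
    fin_cases j
    · exact absurd rfl hj
    · exact h1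
    · exact h2


/-! ### The mirror map -/

/-- The points with nonzero coordinates are dense. -/
theorem generic_neBot (q : Fin 3 → ℂ) : (𝓝[{q : Fin 3 → ℂ | ∀ i, q i ≠ 0}] q).NeBot := by
  have h : Dense {q : Fin 3 → ℂ | ∀ i, q i ≠ 0} := by
    have := dense_pi Set.univ (s := fun _ : Fin 3 => ({0}ᶜ : Set ℂ))
      fun i _ => dense_compl_singleton 0
    convert this using 1
    ext q; simp
  exact mem_closure_iff_nhdsWithin_neBot.mp (h q)

/-- Functions that are continuous near `0` agree there if they agree off the coordinate
hyperplanes. -/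
theorem eventuallyEq_of_generic {E : Type*} [TopologicalSpace E] [T2Space E]
    {f g : (Fin 3 → ℂ) → E}
    (hf : ∀ᶠ q in 𝓝 0, ContinuousAt f q) (hg : ∀ᶠ q in 𝓝 0, ContinuousAt g q)
    (h : ∀ᶠ q in 𝓝 (0 : Fin 3 → ℂ), (∀ i, q i ≠ 0) → f q = g q) : f =ᶠ[𝓝 0] g := by
  filter_upwards [hf, hg, h.eventually_nhds] with q hfq hgq hq
  have := generic_neBot q
  refine tendsto_nhds_unique (l := 𝓝[{q : Fin 3 → ℂ | ∀ i, q i ≠ 0}] q)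
    (hfq.tendsto.mono_left nhdsWithin_le_nhds)
    ((hgq.tendsto.mono_left nhdsWithin_le_nhds).congr' ?_)
  filter_upwards [nhdsWithin_le_nhds hq, self_mem_nhdsWithin] with q' h1 h2
  exact (h1 h2).symm

theorem eventually_continuousAt {E F : Type*} [NormedAddCommGroup E] [NormedSpace ℂ E]
    [NormedAddCommGroup F] [NormedSpace ℂ F] [CompleteSpace F] {f : E → F} {x : E}
    (hf : AnalyticAt ℂ f x) : ∀ᶠ y in 𝓝 x, ContinuousAt f y :=
  hf.eventually_analyticAt.mono fun _ h => h.continuousAt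

/-- The map `u ↦ q`, with components `u_i exp (2πi g_i / ϖ₀)`. -/
def nomeMap (f : (Fin 3 → ℂ) → ℂ) (g : Fin 3 → (Fin 3 → ℂ) → ℂ) (u : Fin 3 → ℂ) : Fin 3 → ℂ :=
  fun i => u i * exp (2 * Real.pi * I * (g i u / f u))

section NomeMap

variable {f : (Fin 3 → ℂ) → ℂ} {g : Fin 3 → (Fin 3 → ℂ) → ℂ}

theorem nomeMap_analyticAt (hf : AnalyticAt ℂ f 0) (hf0 : f 0 = 1)
    (hg : ∀ i, AnalyticAt ℂ (g i) 0) : AnalyticAt ℂ (nomeMap f g) 0 :=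
  AnalyticAt.pi fun i => (analyticAt_coord i 0).fun_mul
    (analyticAt_const.fun_mul ((hg i).fun_div hf (by simp [hf0]))).cexp

theorem nomeMap_zero : nomeMap f g 0 = 0 := by
  funext i; simp [nomeMap]

theorem nomeMap_hasStrictFDerivAt (hf : AnalyticAt ℂ f 0) (hf0 : f 0 = 1)
    (hg : ∀ i, AnalyticAt ℂ (g i) 0) (hg0 : ∀ i, g i 0 = 0) :
    HasStrictFDerivAt (nomeMap f g)
      ((ContinuousLinearEquiv.refl ℂ (Fin 3 → ℂ) : (Fin 3 → ℂ) ≃L[ℂ] (Fin 3 → ℂ)) :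
        (Fin 3 → ℂ) →L[ℂ] (Fin 3 → ℂ)) 0 := by
  have h1 := (nomeMap_analyticAt hf hf0 hg).hasStrictFDerivAt
  have h : HasFDerivAt (nomeMap f g) (ContinuousLinearMap.id ℂ (Fin 3 → ℂ)) 0 := by
    rw [hasFDerivAt_pi']
    intro i
    have h2 : AnalyticAt ℂ (fun u => exp (2 * Real.pi * I * (g i u / f u))) 0 :=
      (analyticAt_const.fun_mul ((hg i).fun_div hf (by simp [hf0]))).cexp
    have h3 := (hasFDerivAt_coord i 0).fun_mul h2.differentiableAt.hasFDerivAt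
    refine h3.congr_fderiv ?_
    ext v
    simp [hg0]
  rwa [h.fderiv] at h1

/-- `nomeMap` is `u ↦ q` off the coordinate hyperplanes, and extends it across them. -/
theorem exp_mirrorT {ϖ₀ : (Fin 3 → ℂ) → ℂ} {ϖ : Fin 3 → (Fin 3 → ℂ) → ℂ} {u : Fin 3 → ℂ}
    {i : Fin 3} (h0 : ϖ₀ u ≠ 0) (hu : u i ≠ 0)
    (h : ϖ i u = ϖ₀ u / (2 * Real.pi * I) * log (u i) + g i u) :
    exp (2 * Real.pi * I * mirrorT ϖ₀ ϖ i u) = nomeMap ϖ₀ g u i := by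
  have e : 2 * Real.pi * I * mirrorT ϖ₀ ϖ i u =
      log (u i) + 2 * Real.pi * I * (g i u / ϖ₀ u) := by
    have hpi : (2 * Real.pi * I : ℂ) ≠ 0 := Complex.two_pi_I_ne_zero
    rw [mirrorT, h]
    field_simp
  rw [e, exp_add, exp_log hu, nomeMap]

theorem exists_isMirrorMap {ϖ₀ : (Fin 3 → ℂ) → ℂ} {ϖ : Fin 3 → (Fin 3 → ℂ) → ℂ}
    (h : IsStandardPeriods ϖ₀ ϖ) : ∃ U, IsMirrorMap ϖ₀ ϖ U := by
  choose g hg hg0 hϖ using h.log_form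
  have hQ := nomeMap_analyticAt h.analyticAt h.apply_zero hg
  have hQ' := nomeMap_hasStrictFDerivAt h.analyticAt h.apply_zero hg hg0
  have hU : AnalyticAt ℂ (hQ'.localInverse (nomeMap ϖ₀ g) _ 0) 0 := by
    have h0 := hQ'.image_mem_toOpenPartialHomeomorph_target
    have hs := hQ'.localInverse_apply_image
    rw [nomeMap_zero] at h0 hs
    refine (hQ'.toOpenPartialHomeomorph (nomeMap ϖ₀ g)).analyticAt_symm
      (i := ContinuousLinearEquiv.refl ℂ (Fin 3 → ℂ)) h0 ?_ ?_
    · change AnalyticAt ℂ (nomeMap ϖ₀ g) (hQ'.localInverse (nomeMap ϖ₀ g) _ 0 0)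
      rwa [hs]
    · change fderiv ℂ (nomeMap ϖ₀ g) (hQ'.localInverse (nomeMap ϖ₀ g) _ 0 0) = _
      rw [hs]
      exact hQ'.hasFDerivAt.fderiv
  have hU0 : hQ'.localInverse (nomeMap ϖ₀ g) _ 0 0 = 0 := by
    have := hQ'.localInverse_apply_image
    rwa [nomeMap_zero] at this
  have hinv := hQ'.eventually_right_inverse
  rw [nomeMap_zero] at hinv
  generalize hQ'.localInverse (nomeMap ϖ₀ g) _ 0 = U at hU hU0 hinv
  refine ⟨U, hU, hU0, ?_⟩
  have ht : Tendsto U (𝓝 0) (𝓝 0) := by simpa [hU0] using hU.continuousAt.tendsto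
  have hne : ∀ᶠ u in 𝓝 0, ϖ₀ u ≠ 0 :=
    h.analyticAt.continuousAt.eventually_ne (by simp [h.apply_zero])
  filter_upwards [hinv, ht.eventually hne, ht.eventually (eventually_all.mpr hϖ)] with q h1 h2 h3 hq
  have hne' : ∀ i, U q i ≠ 0 := by
    intro i hi
    refine hq i ?_
    rw [← h1]
    simp [nomeMap, hi]
  refine ⟨hne', fun i => ?_⟩
  rw [exp_mirrorT h2 (hne' i) (h3 i hne'), h1]

/-- A mirror map inverts `nomeMap` near the origin. -/
theorem IsMirrorMap.comp_nomeMap {ϖ₀ : (Fin 3 → ℂ) → ℂ} {ϖ : Fin 3 → (Fin 3 → ℂ) → ℂ}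
    {U : (Fin 3 → ℂ) → (Fin 3 → ℂ)} (hU : IsMirrorMap ϖ₀ ϖ U) (h : IsStandardPeriods ϖ₀ ϖ)
    (hg : ∀ i, AnalyticAt ℂ (g i) 0) (hg0 : ∀ i, g i 0 = 0)
    (hϖ : ∀ i, ∀ᶠ u in 𝓝 0, (∀ j, u j ≠ 0) →
      ϖ i u = ϖ₀ u / (2 * Real.pi * I) * log (u i) + g i u) :
    ∀ᶠ u in 𝓝 0, U (nomeMap ϖ₀ g u) = u := by
  have hQ := nomeMap_analyticAt h.analyticAt h.apply_zero hg
  have hQ' := nomeMap_hasStrictFDerivAt h.analyticAt h.apply_zero hg hg0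
  have ht : Tendsto U (𝓝 0) (𝓝 0) := by
    simpa [hU.apply_zero] using hU.analyticAt.continuousAt.tendsto
  have htQ : Tendsto (nomeMap ϖ₀ g) (𝓝 0) (𝓝 0) := by
    simpa [nomeMap_zero] using hQ.continuousAt.tendsto
  have hne : ∀ᶠ u in 𝓝 0, ϖ₀ u ≠ 0 :=
    h.analyticAt.continuousAt.eventually_ne (by simp [h.apply_zero])
  have hright : ∀ᶠ q in 𝓝 0, nomeMap ϖ₀ g (U q) = q := by
    refine eventuallyEq_of_generic (eventually_continuousAt (hQ.comp_of_eq hU.analyticAt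
      hU.apply_zero)) (.of_forall fun q => continuousAt_id) ?_
    filter_upwards [hU.inverse, ht.eventually hne, ht.eventually (eventually_all.mpr hϖ)]
      with q h1 h2 h3 hq
    obtain ⟨h4, h5⟩ := h1 hq
    funext i
    rw [← exp_mirrorT h2 (h4 i) (h3 i h4), h5]
  have hleft := hQ'.eventually_left_inverse
  have hUV : ∀ᶠ q in 𝓝 0, U q = hQ'.localInverse (nomeMap ϖ₀ g) _ 0 q := by
    filter_upwards [hright, ht.eventually hleft] with q h1 h2
    rw [h1] at h2
    exact h2.symm
  filter_upwards [htQ.eventually hUV, hleft] with u h1 h2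
  rw [h1, h2]

end NomeMap


/-! ### Ramanujan's differential equations -/

section Ramanujan

open UpperHalfPlane hiding I
open EisensteinSeries Derivative ModularForm
open scoped Manifold MatrixGroups CongruenceSubgroup

/-- A function on the upper half plane is a convergent power series in `q = exp (2πiτ)`: it is
`1`-periodic, holomorphic and bounded at `i∞`. -/
structure IsNomeSeries (f : ℍ → ℂ) : Prop where
  periodic : Function.Periodic (f ∘ ofComplex) (1 : ℝ)
  holo : MDiff f
  bdd : IsBoundedAtImInfty f

namespace IsNomeSeries

variable {f g : ℍ → ℂ}

theorem analyticAt (hf : IsNomeSeries f) : AnalyticAt ℂ (cuspFunction 1 f) 0 :=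
  analyticAt_cuspFunction_zero one_pos hf.periodic hf.holo hf.bdd

theorem of_modularForm {k : ℤ} (f : ModularForm 𝒮ℒ k) : IsNomeSeries f :=
  haveI : Fact (IsCusp OnePoint.infty 𝒮ℒ) :=
    ⟨Subgroup.isCusp_of_mem_strictPeriods one_pos one_mem_strictPeriods_SL⟩
  ⟨SlashInvariantFormClass.periodic_comp_ofComplex f one_mem_strictPeriods_SL,
    ModularFormClass.holo f, ModularFormClass.bdd_at_infty f⟩

theorem mul (hf : IsNomeSeries f) (hg : IsNomeSeries g) : IsNomeSeries (f * g) :=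
  ⟨fun z => congrArg₂ (· * ·) (hf.periodic z) (hg.periodic z), hf.holo.mul hg.holo,
    hf.bdd.mul hg.bdd⟩

theorem sub (hf : IsNomeSeries f) (hg : IsNomeSeries g) : IsNomeSeries (f - g) :=
  ⟨fun z => congrArg₂ (· - ·) (hf.periodic z) (hg.periodic z), hf.holo.sub hg.holo,
    hf.bdd.sub hg.bdd⟩

theorem smul (c : ℂ) (hf : IsNomeSeries f) : IsNomeSeries (c • f) :=
  ⟨fun z => congrArg (c • ·) (hf.periodic z), hf.holo.const_smul c, hf.bdd.const_smul_left c⟩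

theorem cuspFunction_mul (hf : IsNomeSeries f) (hg : IsNomeSeries g) :
    cuspFunction 1 (f * g) = cuspFunction 1 f * cuspFunction 1 g :=
  UpperHalfPlane.cuspFunction_mul hf.analyticAt.continuousAt hg.analyticAt.continuousAt

theorem cuspFunction_sub (hf : IsNomeSeries f) (hg : IsNomeSeries g) :
    cuspFunction 1 (f - g) = cuspFunction 1 f - cuspFunction 1 g :=
  UpperHalfPlane.cuspFunction_sub hf.analyticAt.continuousAt hg.analyticAt.continuousAt

theorem cuspFunction_smul (c : ℂ) (hf : IsNomeSeries f) :
    cuspFunction 1 (c • f) = c • cuspFunction 1 f :=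
  UpperHalfPlane.cuspFunction_smul hf.analyticAt.continuousAt c

theorem periodic_of_comp_qParam {G : ℂ → ℂ}
    (h : ∀ τ : ℍ, f τ = G (Function.Periodic.qParam 1 τ)) :
    Function.Periodic (f ∘ ofComplex) (1 : ℝ) := by
  intro w
  by_cases! hw : 0 < w.im
  · have hw' : 0 < (w + (1 : ℝ)).im := by simpa using hw
    simp only [Function.comp_apply, ofComplex_apply_of_im_pos hw', ofComplex_apply_of_im_pos hw, h]
    congr 1
    simpa [Function.Periodic.qParam, mul_add] using exp_periodic (2 * Real.pi * I * w)
  · have hw' : (w + (1 : ℝ)).im ≤ 0 := by simpa using hw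
    exact congrArg f (ofComplex_apply_eq_of_im_nonpos hw' hw)

theorem of_comp_qParam {G : ℂ → ℂ} (hG : ContinuousAt G 0) (hf : MDiff f)
    (h : ∀ τ : ℍ, f τ = G (Function.Periodic.qParam 1 τ)) : IsNomeSeries f := by
  refine ⟨periodic_of_comp_qParam h, hf, ?_⟩
  have h1 : Tendsto f atImInfty (𝓝 (G 0)) := by
    rw [show f = fun τ : ℍ => G (Function.Periodic.qParam 1 τ) from funext h]
    exact hG.tendsto.comp (qParam_tendsto_atImInfty one_pos)
  exact h1.isBigO_one ℝ

/-- The value of `cuspFunction` at `0` is defined as a limit, so it agrees with a continuous `G`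
at `q = 0` too. -/
theorem cuspFunction_eq_of_comp_qParam {G : ℂ → ℂ} (hG : ContinuousAt G 0) (hf : MDiff f)
    (h : ∀ τ : ℍ, f τ = G (Function.Periodic.qParam 1 τ)) : cuspFunction 1 f =ᶠ[𝓝 0] G := by
  have hc := (of_comp_qParam hG hf h).analyticAt.continuousAt
  have h1 : ∀ᶠ q in 𝓝[≠] (0 : ℂ), cuspFunction 1 f q = G q := by
    filter_upwards [self_mem_nhdsWithin, nhdsWithin_le_nhds (Metric.ball_mem_nhds 0 one_pos)]
      with q hq hq'
    have hq1 : 0 < (Function.Periodic.invQParam 1 q).im :=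
      Function.Periodic.im_invQParam_pos_of_norm_lt_one one_pos (by simpa using hq') hq
    have h2 := eq_cuspFunction (f := f) ⟨_, hq1⟩ one_ne_zero (periodic_of_comp_qParam h)
    rw [h] at h2
    simpa [Function.Periodic.qParam_right_inv one_ne_zero hq] using h2
  have h0 : cuspFunction 1 f 0 = G 0 :=
    tendsto_nhds_unique ((hc.tendsto.mono_left nhdsWithin_le_nhds).congr' h1)
      (hG.tendsto.mono_left nhdsWithin_le_nhds)
  filter_upwards [eventually_nhdsWithin_iff.mp h1] with q hq
  by_cases hq0 : q = 0
  · rw [hq0, h0]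
  · exact hq hq0

theorem E2 : IsNomeSeries EisensteinSeries.E2 := by
  refine ⟨periodic_of_comp_qParam (G := fun q => ∑' m : ℕ,
    (if m = 0 then 1 else -24 * ArithmeticFunction.sigma 1 m : ℂ) • q ^ m) fun τ => ?_,
    E2_mdifferentiable, isBoundedAtImInfty_E2⟩
  simpa [Function.Periodic.qParam] using (hasSum_qExpansion_E2 (z := τ)).tsum_eq.symm

theorem cuspFunction_E2_zero : cuspFunction 1 EisensteinSeries.E2 0 = 1 := by
  have h := (hasFPowerSeriesOnBall_cuspFunction one_pos E2.analyticAt (fun τ => by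
    simpa only [Function.Periodic.qParam, ofReal_one, div_one]
      using hasSum_qExpansion_E2 (z := τ))).coeff_zero ![]
  simpa [FormalMultilinearSeries.ofScalars] using h.symm

/-- The operator `(2πi)⁻¹ d/dτ` is `q d/dq` in the variable `q`. -/
theorem derivative_apply (hf : IsNomeSeries f) (τ : ℍ) :
    normalizedDerivOfComplex f τ =
      Function.Periodic.qParam 1 τ * deriv (cuspFunction 1 f) (Function.Periodic.qParam 1 τ) := by
  have h1 : f ∘ ofComplex =
      cuspFunction 1 f ∘ fun z => Function.Periodic.qParam 1 z :=
    funext fun z => (Function.Periodic.eq_cuspFunction one_ne_zero hf.periodic z).symm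
  have h2 : HasDerivAt (fun z : ℂ => Function.Periodic.qParam 1 z)
      (Function.Periodic.qParam 1 τ * (2 * Real.pi * I)) τ := by
    have : HasDerivAt (fun z : ℂ => 2 * Real.pi * I * z / (1 : ℝ)) (2 * Real.pi * I) (τ : ℂ) := by
      simpa using (hasDerivAt_id (τ : ℂ)).const_mul (2 * Real.pi * I)
    exact this.cexp
  have h3 := (differentiableAt_cuspFunction one_pos hf.periodic hf.holo hf.bdd
    (Function.Periodic.norm_qParam_lt_one one_pos τ.im_pos)).hasDerivAt
  rw [normalizedDerivOfComplex, h1, (h3.comp (τ : ℂ) h2).deriv]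
  field_simp [Complex.two_pi_I_ne_zero]

theorem derivative_continuousAt (hf : IsNomeSeries f) :
    ContinuousAt (fun q => q * deriv (cuspFunction 1 f) q) 0 :=
  continuousAt_id.mul hf.analyticAt.deriv.continuousAt

theorem derivative (hf : IsNomeSeries f) : IsNomeSeries (normalizedDerivOfComplex f) :=
  of_comp_qParam hf.derivative_continuousAt (normalizedDerivOfComplex_mdifferentiable hf.holo)
    hf.derivative_apply

theorem cuspFunction_derivative (hf : IsNomeSeries f) :
    cuspFunction 1 (normalizedDerivOfComplex f) =ᶠ[𝓝 0]
      fun q => q * deriv (cuspFunction 1 f) q :=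
  cuspFunction_eq_of_comp_qParam hf.derivative_continuousAt
    (normalizedDerivOfComplex_mdifferentiable hf.holo) hf.derivative_apply

end IsNomeSeries

/-- A modular form of weight less than `12` whose constant term vanishes is zero. -/
theorem eq_zero_of_slash_invariant {k : ℕ} (hk : k < 12) {f : ℍ → ℂ} (hf : IsNomeSeries f)
    (hinv : ∀ γ : SL(2, ℤ), f ∣[(k : ℤ)] γ = f) (h0 : cuspFunction 1 f 0 = 0) : f = 0 := by
  let F : ModularForm 𝒮ℒ (k : ℤ) :=
    { toFun := f
      slash_action_eq' := by
        rintro _ ⟨γ, rfl⟩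
        exact hinv γ
      holo' := hf.holo
      bdd_at_cusps' := fun {c} hc => by
        rw [OnePoint.isBoundedAt_iff_forall_SL2Z hc]
        intro γ _
        rw [hinv γ]
        exact hf.bdd }
  have hF : F = 0 := by
    refine sturm_bound_levelOne_nat ?_
    rw [Nat.div_eq_of_lt hk]
    have h1 : (qExpansion 1 F).coeff 0 = 0 := by
      simpa [qExpansion_coeff] using! h0
    exact Order.one_le_iff_pos.mp (PowerSeries.le_order _ 1 fun i hi => by
      obtain rfl : i = 0 := by simpa using hi
      exact h1)
  exact congrArg (fun G : ModularForm 𝒮ℒ (k : ℤ) => (G : ℍ → ℂ)) hF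

/-- The derivative of the cocycle `D2` that measures the failure of `E₂` to be modular. -/
theorem derivative_D2 (γ : SL(2, ℤ)) (z : ℍ) : normalizedDerivOfComplex (D2 γ) z =
    -(γ 1 0 / denom γ z) ^ 2 := by
  have h1 := (hasDerivAt_denom_zpow (γ : GL (Fin 2) ℝ) (-1) z).const_mul
    (2 * Real.pi * I * γ 1 0)
  have h2 : D2 γ ∘ ofComplex =ᶠ[𝓝 (z : ℂ)]
      fun w => 2 * Real.pi * I * γ 1 0 * denom γ w ^ (-1 : ℤ) := by
    filter_upwards [isOpen_upperHalfPlaneSet.mem_nhds z.im_pos] with w hw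
    simp [D2, ofComplex_apply_of_im_pos hw, div_eq_mul_inv]
  have hz := denom_ne_zero (γ : GL (Fin 2) ℝ) z
  rw [normalizedDerivOfComplex, h2.deriv_eq, h1.deriv]
  have : denom (γ : GL (Fin 2) ℝ) z ^ (-1 - 1 : ℤ) = (denom (γ : GL (Fin 2) ℝ) z ^ 2)⁻¹ := by
    norm_cast
  rw [this]
  field_simp [Complex.two_pi_I_ne_zero]
  simp [sq]

/-- `D E₂ - E₂² / 12` is modular of weight `4`, although `E₂` is only quasimodular: the two
correction terms cancel. -/
theorem serreDerivative_E2_slash (γ : SL(2, ℤ)) :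
    (normalizedDerivOfComplex EisensteinSeries.E2 -
      (12⁻¹ : ℂ) • (EisensteinSeries.E2 * EisensteinSeries.E2)) ∣[(4 : ℤ)] γ =
    normalizedDerivOfComplex EisensteinSeries.E2 -
      (12⁻¹ : ℂ) • (EisensteinSeries.E2 * EisensteinSeries.E2) := by
  set P : ℍ → ℂ := (1 / (2 * riemannZeta 2)) • D2 γ with hP
  have hslash : EisensteinSeries.E2 ∣[(2 : ℤ)] γ = EisensteinSeries.E2 - P := E2_slash_action γ
  have hD2 : MDiff (D2 γ) := by
    rw [UpperHalfPlane.mdifferentiable_iff]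
    intro w hw
    have h1 := (hasDerivAt_denom_zpow (γ : GL (Fin 2) ℝ) (-1) ⟨w, hw⟩).const_mul
      (2 * Real.pi * I * γ 1 0)
    refine (h1.differentiableAt.congr_of_eventuallyEq ?_).differentiableWithinAt
    filter_upwards [isOpen_upperHalfPlaneSet.mem_nhds hw] with v hv
    simp [D2, ofComplex_apply_of_im_pos hv, div_eq_mul_inv]
  have hDP (z : ℍ) : normalizedDerivOfComplex P z = P z ^ 2 / 12 := by
    rw [hP, normalizedDerivOfComplex_smul _ _ hD2]
    simp only [Pi.smul_apply, smul_eq_mul, derivative_D2, D2, riemannZeta_two]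
    have := I_sq
    have hpi : (Real.pi : ℂ) ≠ 0 := by exact_mod_cast Real.pi_ne_zero
    have hz := denom_ne_zero (γ : GL (Fin 2) ℝ) z
    field_simp
    linear_combination (-12 * (γ 1 0 : ℂ) ^ 2) * this
  have h1 := normalizedDerivOfComplex_SL_slash (k := 2) E2_mdifferentiable (γ := γ)
  rw [hslash, normalizedDerivOfComplex_sub _ _ E2_mdifferentiable (hD2.const_smul _), ← hP] at h1
  have h2 := mul_slash_SL2 2 2 γ EisensteinSeries.E2 EisensteinSeries.E2
  rw [hslash] at h2
  rw [show (2 : ℤ) + 2 = 4 from rfl] at h1 h2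
  rw [sub_eq_add_neg, SlashAction.add_slash, SlashAction.neg_slash, SL_smul_slash, h2]
  funext z
  have h3 := congrFun h1 z
  have h4 := hDP z
  have h5 : P z = 1 / (2 * (Real.pi ^ 2 / 6)) * (2 * Real.pi * I * γ 1 0 / denom γ z) := by
    simp [hP, D2, riemannZeta_two]
  have hz := denom_ne_zero (γ : GL (Fin 2) ℝ) z
  have hpi : (Real.pi : ℂ) ≠ 0 := by exact_mod_cast Real.pi_ne_zero
  have h6 : (2 : ℤ) * (2 * Real.pi * I)⁻¹ * ((γ 1 0 : ℂ) / denom γ z) = -(P z / 6) := by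
    rw [h5]
    field_simp
    push_cast
    linear_combination 2 * (γ 1 0 : ℂ) * I_sq
  simp only [Pi.sub_apply, Pi.add_apply, Pi.neg_apply, Pi.smul_apply, Pi.mul_apply,
    smul_eq_mul, h6, h4]
    at h3 ⊢
  linear_combination -h3

/-- `E₂` as a function of `q = exp (2πiτ)`. -/
def nomeE2 (q : ℂ) : ℂ := cuspFunction 1 EisensteinSeries.E2 q

/-- `E₆` as a function of `q = exp (2πiτ)`. -/
def nomeE6 (q : ℂ) : ℂ := cuspFunction 1 E₆ q

theorem E4_zero : E4 0 = 1 := by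
  have := E_qExpansion_coeff_zero (k := 4) (by norm_num) ⟨2, rfl⟩
  rw [qExpansion_coeff] at this
  simpa using! this

theorem nomeE6_zero : nomeE6 0 = 1 := by
  have := E_qExpansion_coeff_zero (k := 6) (by norm_num) ⟨3, rfl⟩
  rw [qExpansion_coeff] at this
  simpa using! this

theorem nomeE2_zero : nomeE2 0 = 1 := IsNomeSeries.cuspFunction_E2_zero

theorem E4_analyticAt : AnalyticAt ℂ E4 0 := (IsNomeSeries.of_modularForm E₄).analyticAt

theorem nomeE6_analyticAt : AnalyticAt ℂ nomeE6 0 := (IsNomeSeries.of_modularForm E₆).analyticAt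

theorem nomeE2_analyticAt : AnalyticAt ℂ nomeE2 0 := IsNomeSeries.E2.analyticAt

theorem slash_E₄ (γ : SL(2, ℤ)) : (E₄ : ℍ → ℂ) ∣[(4 : ℤ)] γ = E₄ :=
  E₄.slash_action_eq' _ ⟨γ, rfl⟩

theorem slash_E₆ (γ : SL(2, ℤ)) : (E₆ : ℍ → ℂ) ∣[(6 : ℤ)] γ = E₆ :=
  E₆.slash_action_eq' _ ⟨γ, rfl⟩

theorem cuspFunction_sub_smul_mul_sub_smul {f g h k : ℍ → ℂ} (hf : IsNomeSeries f)
    (hg : IsNomeSeries g) (hh : IsNomeSeries h) (hk : IsNomeSeries k) (c d : ℂ) :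
    cuspFunction 1 (normalizedDerivOfComplex f - c • (g * h) - d • k) =ᶠ[𝓝 0] fun q =>
      q * deriv (cuspFunction 1 f) q - c * (cuspFunction 1 g q * cuspFunction 1 h q) -
        d * cuspFunction 1 k q := by
  rw [(hf.derivative.sub ((hg.mul hh).smul c)).cuspFunction_sub (hk.smul d),
    hf.derivative.cuspFunction_sub ((hg.mul hh).smul c), (hg.mul hh).cuspFunction_smul,
    hg.cuspFunction_mul hh, hk.cuspFunction_smul]
  filter_upwards [hf.cuspFunction_derivative] with q hq
  simp [hq]

/-- An identity `D f = c g h + d l` holds as soon as the difference of the two sides is modular of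
weight less than `12` and its constant term, to which `D f` does not contribute, vanishes. -/
theorem eventuallyEq_of_slash_invariant {k : ℕ} (hk : k < 12) {f g h l : ℍ → ℂ}
    (hf : IsNomeSeries f) (hg : IsNomeSeries g) (hh : IsNomeSeries h) (hl : IsNomeSeries l)
    (c d : ℂ)
    (hinv : ∀ γ : SL(2, ℤ), (normalizedDerivOfComplex f - c • (g * h) - d • l) ∣[(k : ℤ)] γ =
      normalizedDerivOfComplex f - c • (g * h) - d • l)
    (h0 : c * (cuspFunction 1 g 0 * cuspFunction 1 h 0) + d * cuspFunction 1 l 0 = 0) :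
    ∀ᶠ q in 𝓝 0, q * deriv (cuspFunction 1 f) q =
      c * (cuspFunction 1 g q * cuspFunction 1 h q) + d * cuspFunction 1 l q := by
  have h1 := cuspFunction_sub_smul_mul_sub_smul hf hg hh hl c d
  have h2 := eq_zero_of_slash_invariant hk
    ((hf.derivative.sub ((hg.mul hh).smul c)).sub (hl.smul d)) hinv (by
      rw [h1.self_of_nhds]
      linear_combination -h0)
  have h3 : cuspFunction 1 (0 : ℍ → ℂ) = 0 := by
    simpa using IsNomeSeries.E2.cuspFunction_smul 0
  rw [h2, h3] at h1
  filter_upwards [h1] with q hq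
  simp only [Pi.zero_apply] at hq
  linear_combination -hq

/-- Ramanujan's equation `D E₄ = (E₂ E₄ - E₆) / 3`. -/
theorem ramanujan_E4 :
    ∀ᶠ q in 𝓝 0, q * deriv E4 q = (nomeE2 q * E4 q - nomeE6 q) / 3 := by
  have h := eventuallyEq_of_slash_invariant (k := 6) (by norm_num)
    (IsNomeSeries.of_modularForm E₄) IsNomeSeries.E2 (IsNomeSeries.of_modularForm E₄)
    (IsNomeSeries.of_modularForm E₆) 3⁻¹ (-3⁻¹) (fun γ => by
      have h1 := serreDerivative_slash_invariant E₄.holo' (slash_E₄ γ)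
      have h2 : normalizedDerivOfComplex E₄ - (3⁻¹ : ℂ) • (EisensteinSeries.E2 * ⇑E₄) =
          serreDerivative (4 : ℤ) E₄ := by
        funext z
        simp only [serreDerivative, Pi.sub_apply, Pi.smul_apply, Pi.mul_apply, smul_eq_mul]
        push_cast
        ring
      rw [h2, sub_eq_add_neg, SlashAction.add_slash, SlashAction.neg_slash, SL_smul_slash]
      exact congrArg₂ (fun a b : ℍ → ℂ => a + -((-3⁻¹ : ℂ) • b)) h1 (slash_E₆ γ))
    (by
      have h1 := nomeE2_zero
      have h2 := E4_zero
      have h3 := nomeE6_zero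
      simp only [nomeE2, E4, nomeE6] at h1 h2 h3
      rw [h1, h2, h3]
      norm_num)
  filter_upwards [h] with q hq
  simp only [nomeE2, E4, nomeE6]
  refine Eq.trans hq ?_
  ring

/-- Ramanujan's equation `D E₆ = (E₂ E₆ - E₄²) / 2`. -/
theorem ramanujan_E6 :
    ∀ᶠ q in 𝓝 0, q * deriv nomeE6 q = (nomeE2 q * nomeE6 q - E4 q ^ 2) / 2 := by
  have h := eventuallyEq_of_slash_invariant (k := 8) (by norm_num)
    (IsNomeSeries.of_modularForm E₆) IsNomeSeries.E2 (IsNomeSeries.of_modularForm E₆)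
    ((IsNomeSeries.of_modularForm E₄).mul (IsNomeSeries.of_modularForm E₄)) 2⁻¹ (-2⁻¹) (fun γ => by
      have h1 := serreDerivative_slash_invariant E₆.holo' (slash_E₆ γ)
      have h2 : normalizedDerivOfComplex E₆ - (2⁻¹ : ℂ) • (EisensteinSeries.E2 * ⇑E₆) =
          serreDerivative (6 : ℤ) E₆ := by
        funext z
        simp only [serreDerivative, Pi.sub_apply, Pi.smul_apply, Pi.mul_apply, smul_eq_mul]
        push_cast
        ring
      have h3 := mul_slash_SL2 4 4 γ E₄ E₄
      rw [slash_E₄] at h3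
      rw [h2, sub_eq_add_neg, SlashAction.add_slash, SlashAction.neg_slash, SL_smul_slash]
      exact congrArg₂ (fun a b : ℍ → ℂ => a + -((-2⁻¹ : ℂ) • b)) h1 h3)
    (by
      rw [(IsNomeSeries.of_modularForm E₄).cuspFunction_mul (IsNomeSeries.of_modularForm E₄)]
      have h1 := nomeE2_zero
      have h2 := E4_zero
      have h3 := nomeE6_zero
      simp only [nomeE2, E4, nomeE6] at h1 h2 h3
      rw [Pi.mul_apply, h1, h2, h3]
      norm_num)
  rw [(IsNomeSeries.of_modularForm E₄).cuspFunction_mul (IsNomeSeries.of_modularForm E₄)] at h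
  filter_upwards [h] with q hq
  simp only [nomeE2, E4, nomeE6]
  refine Eq.trans hq ?_
  simp only [Pi.mul_apply]
  ring

/-- Ramanujan's equation `D E₂ = (E₂² - E₄) / 12`. -/
theorem ramanujan_E2 :
    ∀ᶠ q in 𝓝 0, q * deriv nomeE2 q = (nomeE2 q ^ 2 - E4 q) / 12 := by
  have h := eventuallyEq_of_slash_invariant (k := 4) (by norm_num)
    IsNomeSeries.E2 IsNomeSeries.E2 IsNomeSeries.E2
    (IsNomeSeries.of_modularForm E₄) 12⁻¹ (-12⁻¹) (fun γ => by
      rw [sub_eq_add_neg, SlashAction.add_slash, SlashAction.neg_slash, SL_smul_slash]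
      exact congrArg₂ (fun a b : ℍ → ℂ => a + -((-12⁻¹ : ℂ) • b))
        (serreDerivative_E2_slash γ) (slash_E₄ γ))
    (by
      have h1 := nomeE2_zero
      have h2 := E4_zero
      simp only [nomeE2, E4] at h1 h2
      rw [h1, h2]
      norm_num)
  filter_upwards [h] with q hq
  simp only [nomeE2, E4]
  refine Eq.trans hq ?_
  ring

theorem eta24_eq (q : ℂ) : eta24 q = (E4 q ^ 3 - nomeE6 q ^ 2) / 1728 := by
  have h4 := IsNomeSeries.of_modularForm E₄
  have h6 := IsNomeSeries.of_modularForm E₆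
  have h : (discriminant : ℍ → ℂ) = (1728⁻¹ : ℂ) • (E₄ * (E₄ * E₄) - E₆ * E₆) := by
    funext z
    rw [discriminant_eq_E₄_cube_sub_E₆_sq]
    simp only [Pi.smul_apply, Pi.sub_apply, Pi.mul_apply, smul_eq_mul]
    ring
  rw [eta24, h, ((h4.mul (h4.mul h4)).sub (h6.mul h6)).cuspFunction_smul,
    (h4.mul (h4.mul h4)).cuspFunction_sub (h6.mul h6), h4.cuspFunction_mul (h4.mul h4),
    h4.cuspFunction_mul h4, h6.cuspFunction_mul h6]
  simp only [Pi.smul_apply, Pi.sub_apply, Pi.mul_apply, smul_eq_mul, E4, nomeE6]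
  ring

end Ramanujan


section JFunction

open UpperHalfPlane hiding I
open EisensteinSeries ModularForm
open scoped MatrixGroups

/-! ### The expansion of the `j` function -/

/-- The Taylor polynomial of degree three of a modular form in the variable `q`. -/
theorem isBigO_sub_taylor_three {k : ℤ} (f : ModularForm 𝒮ℒ k) {c : ℕ → ℂ}
    (hc : ∀ m, (qExpansion 1 f).coeff m = c m) :
    (fun q => cuspFunction 1 f q - (c 0 + c 1 * q + c 2 * q ^ 2 + c 3 * q ^ 3))
      =O[𝓝 0] fun q : ℂ => q ^ 4 := by
  have hf := IsNomeSeries.of_modularForm f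
  have h := hasFPowerSeriesOnBall_cuspFunction one_pos hf.analyticAt
    (hasSum_qExpansion one_pos hf.periodic hf.holo hf.bdd)
  have h1 := h.hasFPowerSeriesAt.isBigO_sub_partialSum_pow 4
  refine (h1.congr_left fun q => ?_).trans
    (IsBigO.of_bound' (.of_forall fun q => by simp))
  simp [FormalMultilinearSeries.partialSum, Finset.sum_range_succ, hc,
    FormalMultilinearSeries.ofScalars, mul_comm]

theorem E4_expansion :
    (fun q => E4 q - (1 + 240 * q + 2160 * q ^ 2 + 6720 * q ^ 3)) =O[𝓝 0] fun q : ℂ => q ^ 4 := by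
  have h := isBigO_sub_taylor_three E₄ (E_qExpansion_coeff (by norm_num) ⟨2, rfl⟩)
  have hb : bernoulli 4 = -1 / 30 := by decide +kernel
  have h2 : ArithmeticFunction.sigma 3 2 = 9 := by decide +kernel
  have h3 : ArithmeticFunction.sigma 3 3 = 28 := by decide +kernel
  norm_num [hb, h2, h3] at h
  exact h

theorem nomeE6_expansion :
    (fun q => nomeE6 q - (1 - 504 * q - 16632 * q ^ 2 - 122976 * q ^ 3))
      =O[𝓝 0] fun q : ℂ => q ^ 4 := by
  have h := isBigO_sub_taylor_three E₆ (E_qExpansion_coeff (by norm_num) ⟨3, rfl⟩)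
  have hb : bernoulli 6 = 1 / 42 := by decide +kernel
  have h2 : ArithmeticFunction.sigma 5 2 = 33 := by decide +kernel
  have h3 : ArithmeticFunction.sigma 5 3 = 244 := by decide +kernel
  norm_num [hb, h2, h3] at h
  refine h.congr_left fun q => ?_
  rw [nomeE6]
  ring

theorem eta24_zero : eta24 0 = 0 := by
  rw [eta24_eq, E4_zero, nomeE6_zero]
  norm_num

theorem eta24_analyticAt : AnalyticAt ℂ eta24 0 := by
  rw [show eta24 = fun q => (E4 q ^ 3 - nomeE6 q ^ 2) / 1728 from funext eta24_eq]
  exact ((E4_analyticAt.fun_pow 3).fun_sub (nomeE6_analyticAt.fun_pow 2)).fun_div analyticAt_const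
    (by norm_num)

theorem deriv_eta24_zero : deriv eta24 0 = 1 := by
  have h := discriminant_qExpansion_coeff_one
  rw [qExpansion_coeff] at h
  simpa using! h

/-- The unit `η²⁴ / q`. -/
def eta24Unit : ℂ → ℂ := dslope eta24 0

theorem eta24_eq_mul (q : ℂ) : eta24 q = q * eta24Unit q := by
  have := sub_smul_dslope eta24 0 q
  simpa [eta24_zero, eta24Unit] using this.symm

theorem eta24Unit_zero : eta24Unit 0 = 1 := by
  rw [eta24Unit, dslope_same, deriv_eta24_zero]

theorem analyticAt_dslope_self {f : ℂ → ℂ} {z : ℂ} (hf : AnalyticAt ℂ f z) :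
    AnalyticAt ℂ (dslope f z) z := by
  obtain ⟨p, hp⟩ := hf
  exact ⟨_, hp.has_fpower_series_dslope_fslope⟩

theorem eta24Unit_analyticAt : AnalyticAt ℂ eta24Unit 0 := analyticAt_dslope_self eta24_analyticAt

/-- The expansion of `j`, multiplied by `q η²⁴`. -/
theorem E4_cube_mul_sub_eta24_mul :
    (fun q => E4 q ^ 3 * q - eta24 q * (1 + 744 * q + 196884 * q ^ 2))
      =O[𝓝 0] fun q : ℂ => q ^ 4 := by
  have h4 : ContinuousAt E4 0 := E4_analyticAt.continuousAt
  have h6 : ContinuousAt nomeE6 0 := nomeE6_analyticAt.continuousAt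
  -- The difference vanishes to order four when `E₄` and `E₆` are replaced by their Taylor
  -- polynomials, so it is a combination of `q ^ 4` and of the two remainders.
  have key (q : ℂ) : E4 q ^ 3 * q - eta24 q * (1 + 744 * q + 196884 * q ^ 2) =
      (E4 q - (1 + 240 * q + 2160 * q ^ 2 + 6720 * q ^ 3)) *
        ((E4 q ^ 2 + E4 q * (1 + 240 * q + 2160 * q ^ 2 + 6720 * q ^ 3) +
          (1 + 240 * q + 2160 * q ^ 2 + 6720 * q ^ 3) ^ 2) *
          (q - (1 + 744 * q + 196884 * q ^ 2) / 1728)) +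
      (nomeE6 q - (1 - 504 * q - 16632 * q ^ 2 - 122976 * q ^ 3)) *
        ((nomeE6 q + (1 - 504 * q - 16632 * q ^ 2 - 122976 * q ^ 3)) *
          ((1 + 744 * q + 196884 * q ^ 2) / 1728)) +
      q ^ 4 * (21494407 + 348584256 * q + 4792942460 * q ^ 2 - 34733984160 * q ^ 3
        - 1750177553472 * q ^ 4 - 14254900352000 * q ^ 5 - 33168317952000 * q ^ 6
        - 34575980544000 * q ^ 7) := by
    rw [eta24_eq]
    ring
  have aux {f g h : ℂ → ℂ} (hf : f =O[𝓝 0] h) (hg : ContinuousAt g 0) :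
      (fun q => f q * g q) =O[𝓝 0] h := by
    simpa using hf.mul (hg.tendsto.isBigO_one ℂ)
  refine (((aux E4_expansion ?_).add (aux nomeE6_expansion ?_)).add
    (aux (isBigO_refl (fun q : ℂ => q ^ 4) _) ?_)).congr_left fun q => (key q).symm
  all_goals fun_prop

theorem j_expansion :
    (fun q : ℂ => j q - (1 / q + 744 + 196884 * q)) =O[𝓝[≠] 0] fun q : ℂ => q ^ 2 := by
  have hc := eta24Unit_analyticAt.continuousAt
  have hne : ∀ᶠ q in 𝓝 (0 : ℂ), eta24Unit q ≠ 0 := hc.eventually_ne (by simp [eta24Unit_zero])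
  have h1 : (fun q => (eta24Unit q)⁻¹) =O[𝓝[≠] 0] fun _ => (1 : ℂ) :=
    ((hc.inv₀ (by simp [eta24Unit_zero])).tendsto.isBigO_one ℂ).mono nhdsWithin_le_nhds
  have h2 := (E4_cube_mul_sub_eta24_mul.mono nhdsWithin_le_nhds).mul
    (h1.mul (isBigO_refl (fun q : ℂ => (q ^ 2)⁻¹) (𝓝[≠] 0)))
  refine h2.congr' ?_ ?_
  · filter_upwards [self_mem_nhdsWithin, nhdsWithin_le_nhds hne] with q hq hq'
    have hq0 : q ≠ 0 := hq
    rw [j, eta24_eq_mul]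
    field_simp
  · filter_upwards [self_mem_nhdsWithin] with q hq
    have hq0 : q ≠ 0 := hq
    field_simp

/-! ### The functions `E₄^(1/4)` and `(1 - 1728/j)^(1/2)` near `q = 0` -/

/-- The fourth root of `E₄`, as a function of `q`. -/
def rootE4 (q : ℂ) : ℂ := E4 q ^ (1 / 4 : ℂ)

/-- `E₆ / E₄^(3/2)`, which near `q = 0` is the square root of `1 - 1728 / j`. -/
def ratioE6 (q : ℂ) : ℂ := nomeE6 q / rootE4 q ^ 6

/-- `1 / (q j)`, a unit near `q = 0`. -/
def jInvUnit (q : ℂ) : ℂ := eta24Unit q / E4 q ^ 3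

theorem rootE4_pow_four (q : ℂ) : rootE4 q ^ 4 = E4 q := by
  rw [rootE4, show (1 / 4 : ℂ) = ((4 : ℕ) : ℂ)⁻¹ by norm_num]
  exact cpow_nat_inv_pow _ (by norm_num)

theorem rootE4_zero : rootE4 0 = 1 := by
  rw [rootE4, E4_zero, one_cpow]

theorem rootE4_analyticAt : AnalyticAt ℂ rootE4 0 :=
  E4_analyticAt.cpow analyticAt_const (by simp [E4_zero])

theorem rootE4_eventually_ne : ∀ᶠ q in 𝓝 0, rootE4 q ≠ 0 :=
  rootE4_analyticAt.continuousAt.eventually_ne (by simp [rootE4_zero])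

theorem ratioE6_zero : ratioE6 0 = 1 := by
  simp [ratioE6, nomeE6_zero, rootE4_zero]

theorem ratioE6_analyticAt : AnalyticAt ℂ ratioE6 0 :=
  nomeE6_analyticAt.fun_div (rootE4_analyticAt.fun_pow 6) (by simp [rootE4_zero])

theorem jInvUnit_zero : jInvUnit 0 = 1 := by
  simp [jInvUnit, eta24Unit_zero, E4_zero]

theorem jInvUnit_analyticAt : AnalyticAt ℂ jInvUnit 0 :=
  eta24Unit_analyticAt.fun_div (E4_analyticAt.fun_pow 3) (by simp [E4_zero])

theorem inv_j (q : ℂ) : (j q)⁻¹ = q * jInvUnit q := by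
  rw [j, inv_div, eta24_eq_mul, jInvUnit, mul_div_assoc]

theorem ratioE6_sq : ∀ᶠ q in 𝓝 0, ratioE6 q ^ 2 = 1 - 1728 * (q * jInvUnit q) := by
  filter_upwards [rootE4_eventually_ne] with q hq
  rw [ratioE6, ← inv_j, j, inv_div, eta24_eq, ← rootE4_pow_four]
  field_simp
  ring

/-- Near `q = 0` the number `E₆ / E₄^(3/2)` has positive real part, so it is the principal square
root of `1 - 1728 / j`. -/
theorem sqrtJ_eq : ∀ᶠ q in 𝓝 0, sqrtJ q = j q * ratioE6 q := by
  have h1 : ∀ᶠ q in 𝓝 0, 0 < (ratioE6 q).re :=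
    (continuous_re.continuousAt.comp ratioE6_analyticAt.continuousAt).eventually_const_lt
      (by simp [ratioE6_zero])
  filter_upwards [h1, ratioE6_sq] with q h2 h3
  rw [sqrtJ, div_eq_mul_inv, inv_j, ← h3, show (1 / 2 : ℂ) = 2⁻¹ by norm_num,
    sq_cpow_two_inv h2]

theorem rootE4_derivative : ∀ᶠ q in 𝓝 0,
    q * deriv rootE4 q = rootE4 q * (nomeE2 q - ratioE6 q * rootE4 q ^ 2) / 12 := by
  filter_upwards [ramanujan_E4, rootE4_eventually_ne, rootE4_analyticAt.eventually_analyticAt]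
    with q h1 h2 h3
  have h4 : deriv E4 q = 4 * rootE4 q ^ 3 * deriv rootE4 q := by
    rw [show E4 = fun q => rootE4 q ^ 4 from funext fun q => (rootE4_pow_four q).symm]
    simpa using (h3.differentiableAt.hasDerivAt.fun_pow 4).deriv
  rw [h4, ← rootE4_pow_four] at h1
  rw [ratioE6]
  field_simp
  linear_combination 3 * h1

theorem ratioE6_derivative : ∀ᶠ q in 𝓝 0,
    q * deriv ratioE6 q = -((1 - ratioE6 q ^ 2) * rootE4 q ^ 2 / 2) := by
  filter_upwards [ramanujan_E6, rootE4_derivative, rootE4_eventually_ne,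
    rootE4_analyticAt.eventually_analyticAt, nomeE6_analyticAt.eventually_analyticAt]
    with q h1 h2 h3 h4 h5
  have h6 := (h5.differentiableAt.hasDerivAt.fun_div
    (h4.differentiableAt.hasDerivAt.fun_pow 6) (pow_ne_zero 6 h3)).deriv
  rw [← rootE4_pow_four] at h1
  calc q * deriv ratioE6 q
      = ((q * deriv nomeE6 q) * rootE4 q ^ 6 -
          6 * nomeE6 q * rootE4 q ^ 5 * (q * deriv rootE4 q)) / (rootE4 q ^ 6) ^ 2 := by
        rw [show ratioE6 = fun q => nomeE6 q / rootE4 q ^ 6 from rfl, h6]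
        push_cast
        ring
    _ = -((1 - ratioE6 q ^ 2) * rootE4 q ^ 2 / 2) := by
        rw [h1, h2, ratioE6]
        field_simp
        ring

end JFunction


/-! ### The Picard-Fuchs equations on the divisor `u₃ = 0` -/

section Theta

variable {f g : (Fin 3 → ℂ) → ℂ} {u : Fin 3 → ℂ}

theorem theta_add (hf : AnalyticAt ℂ f u) (hg : AnalyticAt ℂ g u) (i : Fin 3) :
    theta i (fun v => f v + g v) =ᶠ[𝓝 u] fun v => theta i f v + theta i g v := by
  filter_upwards [partialDeriv_add hf hg i] with v hv
  exact (congrArg (v i * ·) hv).trans (mul_add _ _ _)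

theorem theta_const_mul (hf : AnalyticAt ℂ f u) (c : ℂ) (i : Fin 3) :
    theta i (fun v => c * f v) =ᶠ[𝓝 u] fun v => c * theta i f v := by
  filter_upwards [partialDeriv_const_mul hf c i] with v hv
  exact (congrArg (v i * ·) hv).trans (mul_left_comm _ _ _)

theorem theta_sub (hf : AnalyticAt ℂ f u) (hg : AnalyticAt ℂ g u) (i : Fin 3) :
    theta i (fun v => f v - g v) =ᶠ[𝓝 u] fun v => theta i f v - theta i g v := by
  filter_upwards [hf.eventually_analyticAt, hg.eventually_analyticAt] with v hv hv'
  simp only [theta, fderiv_fun_sub hv.differentiableAt hv'.differentiableAt,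
    _root_.sub_apply, mul_sub]

theorem theta_coord_mul (hf : AnalyticAt ℂ f u) (i j : Fin 3) :
    theta j (fun v => v i * f v) =ᶠ[𝓝 u]
      fun v => v i * (theta j f v + (if i = j then 1 else 0) * f v) := by
  filter_upwards [partialDeriv_coord_mul hf i j] with v hv
  refine (congrArg (v j * ·) hv).trans ?_
  split_ifs with h
  · rw [h]
    rfl
  · simp only [theta, partialDeriv]
    ring

theorem theta_comm (hf : AnalyticAt ℂ f u) (i j : Fin 3) :
    theta i (theta j f) =ᶠ[𝓝 u] theta j (theta i f) := by
  have h1 := partialDeriv_coord_mul (partialDeriv_analyticAt hf j) j i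
  have h2 := partialDeriv_coord_mul (partialDeriv_analyticAt hf i) i j
  filter_upwards [h1, h2, partialDeriv_comm hf i j] with v h1 h2 h3
  change v i * partialDeriv i (fun v => v j * partialDeriv j f v) v =
    v j * partialDeriv j (fun v => v i * partialDeriv i f v) v
  rw [h1, h2, h3]
  by_cases h : i = j
  · subst h; ring
  · simp [h, Ne.symm h]; ring

theorem theta_theta_eq_zero (hf : AnalyticAt ℂ f u) {k : Fin 3} (hu : u k = 0) (i : Fin 3) :
    theta i (theta k f) u = 0 := by
  rw [(theta_comm hf i k).eq_of_nhds, theta, hu, zero_mul]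

/-- The equation `L₁` on the divisor `u₃ = 0`. -/
theorem picardFuchs₁_of_eq_zero (hf : AnalyticAt ℂ f u) (hu : u 2 = 0) :
    picardFuchs₁ f u = theta 0 (theta 0 f) u - 2 * theta 0 (theta 1 f) u -
      12 * u 0 * (36 * theta 0 (theta 0 f) u + 36 * theta 0 f u + 5 * f u) := by
  have t0 := theta_analyticAt hf 0
  have t1 := theta_analyticAt hf 1
  have t2 := theta_analyticAt hf 2
  have c {g : (Fin 3 → ℂ) → ℂ} (hg : AnalyticAt ℂ g u) (a : ℂ) :
      AnalyticAt ℂ (fun v => a * g v) u := analyticAt_const.fun_mul hg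
  have e1 : theta 0 (fun v => theta 0 f v - 2 * theta 1 f v - 2 * theta 2 f v) u =
      theta 0 (theta 0 f) u - 2 * theta 0 (theta 1 f) u := by
    rw [(theta_sub (t0.fun_sub (c t1 2)) (c t2 2) 0).eq_of_nhds,
      (theta_sub t0 (c t1 2) 0).eq_of_nhds, (theta_const_mul t1 2 0).eq_of_nhds,
      (theta_const_mul t2 2 0).eq_of_nhds, theta_theta_eq_zero hf hu]
    ring
  have e2 : (fun v => 6 * theta 0 (fun v => v 0 * f v) v - v 0 * f v) =ᶠ[𝓝 u]
      fun v => v 0 * (6 * theta 0 f v + 5 * f v) := by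
    filter_upwards [theta_coord_mul hf 0 0] with v hv
    rw [hv, if_pos rfl]
    ring
  have e3 : theta 0 (fun v => 6 * theta 0 (fun v => v 0 * f v) v - v 0 * f v) u =
      u 0 * (6 * theta 0 (theta 0 f) u + 11 * theta 0 f u + 5 * f u) := by
    rw [(theta_congr e2 0).eq_of_nhds,
      (theta_coord_mul ((c t0 6).fun_add (c hf 5)) 0 0).eq_of_nhds, if_pos rfl,
      (theta_add (c t0 6) (c hf 5) 0).eq_of_nhds, (theta_const_mul t0 6 0).eq_of_nhds,
      (theta_const_mul hf 5 0).eq_of_nhds]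
    ring
  have e4 := e2.eq_of_nhds
  simp only [picardFuchs₁]
  rw [e1, e3, e4]
  ring

/-- The equation `L₂` on the divisor `u₃ = 0`. -/
theorem picardFuchsBase_one_of_eq_zero (hf : AnalyticAt ℂ f u) (hu : u 2 = 0) :
    picardFuchsBase 1 f u = theta 1 (theta 1 f) u -
      u 1 * (4 * theta 1 (theta 1 f) u - 4 * theta 0 (theta 1 f) u + theta 0 (theta 0 f) u +
        2 * theta 1 f u - theta 0 f u) := by
  have t0 := theta_analyticAt hf 0
  have t1 := theta_analyticAt hf 1
  have t2 := theta_analyticAt hf 2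
  have c {g : (Fin 3 → ℂ) → ℂ} (hg : AnalyticAt ℂ g u) (a : ℂ) :
      AnalyticAt ℂ (fun v => a * g v) u := analyticAt_const.fun_mul hg
  have e2 : (fun v => 2 * theta 1 (fun v => v 1 * f v) v + 2 * theta 2 (fun v => v 1 * f v) v -
      theta 0 (fun v => v 1 * f v) v - v 1 * f v) =ᶠ[𝓝 u]
      fun v => v 1 * (2 * theta 1 f v + 2 * theta 2 f v - theta 0 f v + f v) := by
    filter_upwards [theta_coord_mul hf 1 0, theta_coord_mul hf 1 1, theta_coord_mul hf 1 2]
      with v h0 h1 h2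
    rw [h0, h1, h2, if_pos rfl, if_neg (by decide), if_neg (by decide)]
    ring
  have e3 (i : Fin 3) : theta i (fun v => 2 * theta 1 (fun v => v 1 * f v) v +
      2 * theta 2 (fun v => v 1 * f v) v - theta 0 (fun v => v 1 * f v) v - v 1 * f v) u =
      u 1 * (2 * theta i (theta 1 f) u - theta i (theta 0 f) u + theta i f u +
        (if 1 = i then 1 else 0) * (2 * theta 1 f u - theta 0 f u + f u)) := by
    rw [(theta_congr e2 i).eq_of_nhds,
      (theta_coord_mul ((((c t1 2).fun_add (c t2 2)).fun_sub t0).fun_add hf) 1 i).eq_of_nhds,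
      (theta_add (((c t1 2).fun_add (c t2 2)).fun_sub t0) hf i).eq_of_nhds,
      (theta_sub ((c t1 2).fun_add (c t2 2)) t0 i).eq_of_nhds,
      (theta_add (c t1 2) (c t2 2) i).eq_of_nhds, (theta_const_mul t1 2 i).eq_of_nhds,
      (theta_const_mul t2 2 i).eq_of_nhds, theta_theta_eq_zero hf hu,
      show theta 2 f u = 0 by rw [theta, hu, zero_mul]]
    ring
  have e5 (g : (Fin 3 → ℂ) → ℂ) : theta 2 g u = 0 := by rw [theta, hu, zero_mul]
  have e4 := e2.eq_of_nhds
  simp only [picardFuchsBase]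
  rw [e5, e4, e3, e3, if_pos rfl, if_neg (by decide), (theta_comm hf 1 0).eq_of_nhds, e5]
  ring

theorem picardFuchs₁_congr (h : f =ᶠ[𝓝 u] g) : picardFuchs₁ f =ᶠ[𝓝 u] picardFuchs₁ g := by
  have hA : (fun v => v 0 * f v) =ᶠ[𝓝 u] fun v => v 0 * g v := h.mono fun v hv => by simp [hv]
  have hB : (fun v => 6 * theta 0 (fun v => v 0 * f v) v - v 0 * f v) =ᶠ[𝓝 u]
      fun v => 6 * theta 0 (fun v => v 0 * g v) v - v 0 * g v := by
    filter_upwards [hA, theta_congr hA 0] with v h1 h2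
    rw [h1, h2]
  have hC : (fun v => theta 0 f v - 2 * theta 1 f v - 2 * theta 2 f v) =ᶠ[𝓝 u]
      fun v => theta 0 g v - 2 * theta 1 g v - 2 * theta 2 g v := by
    filter_upwards [theta_congr h 0, theta_congr h 1, theta_congr h 2] with v h0 h1 h2
    rw [h0, h1, h2]
  filter_upwards [hB, theta_congr hB 0, theta_congr hC 0] with v h1 h2 h3
  simp only [picardFuchs₁]
  rw [h1, h2, h3]

theorem picardFuchsBase_congr (h : f =ᶠ[𝓝 u] g) (i : Fin 3) :
    picardFuchsBase i f =ᶠ[𝓝 u] picardFuchsBase i g := by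
  have hA : (fun v => v i * f v) =ᶠ[𝓝 u] fun v => v i * g v := h.mono fun v hv => by simp [hv]
  have hB : (fun v => 2 * theta 1 (fun v => v i * f v) v + 2 * theta 2 (fun v => v i * f v) v -
      theta 0 (fun v => v i * f v) v - v i * f v) =ᶠ[𝓝 u]
      fun v => 2 * theta 1 (fun v => v i * g v) v + 2 * theta 2 (fun v => v i * g v) v -
      theta 0 (fun v => v i * g v) v - v i * g v := by
    filter_upwards [hA, theta_congr hA 0, theta_congr hA 1, theta_congr hA 2] with v h h0 h1 h2
    rw [h, h0, h1, h2]
  filter_upwards [hB, theta_congr hB 0, theta_congr hB 1, theta_congr hB 2,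
    theta_congr (theta_congr h i) i] with v h h0 h1 h2 h3
  simp only [picardFuchsBase]
  rw [h, h0, h1, h2, h3]

theorem picardFuchs₁_analyticAt (hf : AnalyticAt ℂ f u) : AnalyticAt ℂ (picardFuchs₁ f) u := by
  have c {g : (Fin 3 → ℂ) → ℂ} (hg : AnalyticAt ℂ g u) (a : ℂ) :
      AnalyticAt ℂ (fun v => a * g v) u := analyticAt_const.fun_mul hg
  have hA := (analyticAt_coord 0 u).fun_mul hf
  have hB := (c (theta_analyticAt hA 0) 6).fun_sub hA
  have t := theta_analyticAt hf
  exact (theta_analyticAt (((t 0).fun_sub (c (t 1) 2)).fun_sub (c (t 2) 2)) 0).fun_sub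
    (c ((c (theta_analyticAt hB 0) 6).fun_sub (c hB 5)) 12)

theorem picardFuchsBase_analyticAt (hf : AnalyticAt ℂ f u) (i : Fin 3) :
    AnalyticAt ℂ (picardFuchsBase i f) u := by
  have c {g : (Fin 3 → ℂ) → ℂ} (hg : AnalyticAt ℂ g u) (a : ℂ) :
      AnalyticAt ℂ (fun v => a * g v) u := analyticAt_const.fun_mul hg
  have hA := (analyticAt_coord i u).fun_mul hf
  have hB := (((c (theta_analyticAt hA 1) 2).fun_add (c (theta_analyticAt hA 2) 2)).fun_sub
    (theta_analyticAt hA 0)).fun_sub hA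
  exact (theta_analyticAt (theta_analyticAt hf i) i).fun_sub
    ((((c (theta_analyticAt hB 1) 2).fun_add (c (theta_analyticAt hB 2) 2)).fun_sub
      (theta_analyticAt hB 0)).fun_sub (c hB 2))

end Theta


/-! ### Solutions along the leading order of the mirror map -/

/-- The leading order of the mirror map on the divisor `u₃ = 0`, in terms of the values `w`, `v`
of `(1 - 1728/j)^(1/2)` at `q̂₁` and `q̂₂`. -/
def leadingPoint (w v : ℂ) : Fin 3 → ℂ :=
  ![(1 - w * v) / 864, (1 - w ^ 2) * (1 - v ^ 2) / (4 * (1 - w * v) ^ 2), 0]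

theorem leadingPoint_comm (w v : ℂ) : leadingPoint w v = leadingPoint v w := by
  simp only [leadingPoint, mul_comm w v, mul_comm (1 - w ^ 2)]

section Curve

variable {F : (Fin 3 → ℂ) → ℂ} {w : ℂ → ℂ} {v ε t : ℂ}

/-- The logarithmic derivatives of the coordinates of `leadingPoint` when `w` satisfies the
differential equation of `(1 - 1728/j)^(1/2)`. -/
theorem hasDerivAt_leadingPoint (hw : HasDerivAt w (-((1 - w t ^ 2) * ε / 2)) t)
    (hv : 1 - w t * v ≠ 0) :
    HasDerivAt (fun s => leadingPoint (w s) v)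
      (fun i => ε * (![v * (1 - w t ^ 2) / (2 * (1 - w t * v)), (w t - v) / (1 - w t * v), 0] :
        Fin 3 → ℂ) i * leadingPoint (w t) v i) t := by
  rw [hasDerivAt_pi]
  intro i
  fin_cases i
  · have h := ((hw.mul_const v).const_sub 1).div_const 864
    refine h.congr_deriv ?_
    simp [leadingPoint]
    field_simp
  · have h1 := ((hw.mul_const v).const_sub 1)
    have h := (((hw.fun_pow 2).const_sub 1).mul_const (1 - v ^ 2)).fun_div
      ((h1.fun_pow 2).const_mul 4) (by simpa using hv)
    refine h.congr_deriv ?_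
    simp [leadingPoint]
    field_simp
    ring
  · simpa [leadingPoint] using hasDerivAt_const t (0 : ℂ)

theorem hasDerivAt_comp_leadingPoint (hw : HasDerivAt w (-((1 - w t ^ 2) * ε / 2)) t)
    (hv : 1 - w t * v ≠ 0) (hF : DifferentiableAt ℂ F (leadingPoint (w t) v)) :
    HasDerivAt (fun s => F (leadingPoint (w s) v))
      (ε * (v * (1 - w t ^ 2) / (2 * (1 - w t * v)) * theta 0 F (leadingPoint (w t) v) +
        (w t - v) / (1 - w t * v) * theta 1 F (leadingPoint (w t) v))) t := by
  have h := hF.hasFDerivAt.comp_hasDerivAt t (hasDerivAt_leadingPoint hw hv)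
  refine h.congr_deriv ?_
  rw [show (fun i => ε * (![v * (1 - w t ^ 2) / (2 * (1 - w t * v)), (w t - v) / (1 - w t * v),
      0] : Fin 3 → ℂ) i * leadingPoint (w t) v i) =
      (ε * (v * (1 - w t ^ 2) / (2 * (1 - w t * v))) * leadingPoint (w t) v 0) •
        (Pi.single 0 1 : Fin 3 → ℂ) +
      (ε * ((w t - v) / (1 - w t * v)) * leadingPoint (w t) v 1) • (Pi.single 1 1 : Fin 3 → ℂ)
      from ?_]
  · rw [map_add, map_smul, map_smul, theta, theta]
    simp only [smul_eq_mul]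
    ring
  · funext i
    fin_cases i <;> simp

/-- If `F` is killed by `L₁` and `L₂` at a point of the divisor `u₃ = 0`, then
`F ∘ leadingPoint`, divided by `E₄^(1/4)`, has vanishing second derivative with respect to the
logarithm of the nome. The functions `e, w, E` stand for `E₄^(1/4)`, `(1 - 1728/j)^(1/2)` and `E₂`,
as functions of that logarithm. -/
theorem exists_hasDerivAt_zero_of_solves {e E : ℂ → ℂ} {c : ℂ}
    (he : ∀ᶠ s in 𝓝 t, HasDerivAt e (e s * (E s - w s * e s ^ 2) / 12) s)
    (hw : ∀ᶠ s in 𝓝 t, HasDerivAt w (-((1 - w s ^ 2) * e s ^ 2 / 2)) s)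
    (hE : HasDerivAt E ((E t ^ 2 - e t ^ 4) / 12) t)
    (he0 : e t ≠ 0) (hv : 1 - w t * v ≠ 0) (hF : AnalyticAt ℂ F (leadingPoint (w t) v))
    (h₁ : picardFuchs₁ F (leadingPoint (w t) v) = 0)
    (h₂ : picardFuchsBase 1 F (leadingPoint (w t) v) = 0) :
    ∃ K : ℂ → ℂ, (∀ᶠ s in 𝓝 t,
      HasDerivAt (fun r => F (leadingPoint (w r) v) / (e r * c)) (K s) s) ∧ HasDerivAt K 0 t := by
  have hw0 := hw.self_of_nhds
  have he' := he.self_of_nhds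
  have hcw : ContinuousAt w t := hw0.continuousAt
  have hlead : Tendsto (fun s => leadingPoint (w s) v) (𝓝 t) (𝓝 (leadingPoint (w t) v)) :=
    (hasDerivAt_leadingPoint hw0 hv).continuousAt.tendsto
  have hv' : ∀ᶠ s in 𝓝 t, 1 - w s * v ≠ 0 :=
    (continuousAt_const.sub (hcw.mul continuousAt_const)).eventually_ne hv
  -- the first derivative, from the chain rule and the equations for `e` and `w`
  refine ⟨fun s => (e s * (v * (1 - w s ^ 2) / (2 * (1 - w s * v)) *
      theta 0 F (leadingPoint (w s) v) +
      (w s - v) / (1 - w s * v) * theta 1 F (leadingPoint (w s) v)) -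
      F (leadingPoint (w s) v) * ((E s - w s * e s ^ 2) / 12) / e s) / c, ?_, ?_⟩
  · filter_upwards [he, hw, hv', hlead.eventually hF.eventually_analyticAt,
      he'.continuousAt.eventually_ne he0] with s he hw hv hF he0
    have h := ((hasDerivAt_comp_leadingPoint hw hv hF.differentiableAt).fun_div he he0).div_const c
    simp only [← div_mul_eq_div_div] at h ⊢
    refine h.congr_deriv ?_
    field_simp
  · have hG := hasDerivAt_comp_leadingPoint hw0 hv hF.differentiableAt
    have hG0 := hasDerivAt_comp_leadingPoint hw0 hv (theta_analyticAt hF 0).differentiableAt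
    have hG1 := hasDerivAt_comp_leadingPoint hw0 hv (theta_analyticAt hF 1).differentiableAt
    have hξ := (((hw0.fun_pow 2).const_sub 1).const_mul v).fun_div
      (((hw0.mul_const v).const_sub 1).const_mul 2) (mul_ne_zero two_ne_zero hv)
    have hη := (hw0.sub_const v).fun_div ((hw0.mul_const v).const_sub 1) hv
    have hm := (hE.fun_sub (hw0.fun_mul (he'.fun_pow 2))).div_const 12
    have h := ((he'.fun_mul ((hξ.fun_mul hG0).fun_add (hη.fun_mul hG1))).fun_sub
      ((hG.fun_mul hm).fun_div he' he0)).div_const c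
    refine h.congr_deriv ?_
    rw [picardFuchs₁_of_eq_zero hF (by simp [leadingPoint])] at h₁
    rw [picardFuchsBase_one_of_eq_zero hF (by simp [leadingPoint])] at h₂
    rw [(theta_comm hF 1 0).eq_of_nhds]
    rw [show leadingPoint (w t) v 0 = (1 - w t * v) / 864 from rfl] at h₁
    rw [show leadingPoint (w t) v 1 = (1 - w t ^ 2) * (1 - v ^ 2) / (4 * (1 - w t * v) ^ 2)
      from rfl] at h₂
    generalize theta 0 (theta 0 F) (leadingPoint (w t) v) = f00 at *
    generalize theta 0 (theta 1 F) (leadingPoint (w t) v) = f01 at *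
    generalize theta 1 (theta 1 F) (leadingPoint (w t) v) = f11 at *
    generalize theta 0 F (leadingPoint (w t) v) = f0 at *
    generalize theta 1 F (leadingPoint (w t) v) = f1 at *
    generalize F (leadingPoint (w t) v) = f at *
    refine div_eq_zero_iff.mpr (Or.inl ?_)
    -- the second derivative, as a combination of `L₁ F` and `L₂ F`
    linear_combination (norm := skip) e t ^ 3 * ((1 - w t ^ 2) / (2 * (1 - w t * v))) * h₁ +
      e t ^ 3 * h₂
    clear h hG hG0 hG1 hm hη hξ hv' hlead hcw he' hw0 hE hw he h₁ h₂ hF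
    generalize w t = W at *
    generalize e t = ε at *
    generalize E t = ε₂ at *
    push_cast
    field_simp
    ring

end Curve


/-! ### Euler derivations -/

/-- The Euler derivation `∑ c_i θ_i`. -/
def euler (c : Fin 3 → ℂ) (f : (Fin 3 → ℂ) → ℂ) : (Fin 3 → ℂ) → ℂ :=
  fun q => ∑ i, c i * theta i f q

/-- The flow of the Euler derivation `∑ c_i θ_i`. -/
def eulerFlow (c q : Fin 3 → ℂ) (t : ℂ) : Fin 3 → ℂ := fun i => q i * exp (c i * t)

section Euler

variable {c q : Fin 3 → ℂ} {f g : (Fin 3 → ℂ) → ℂ}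

theorem euler_analyticAt (hf : AnalyticAt ℂ f q) (c : Fin 3 → ℂ) : AnalyticAt ℂ (euler c f) q :=
  Finset.univ.analyticAt_fun_sum fun i _ => analyticAt_const.fun_mul (theta_analyticAt hf i)

theorem euler_congr (h : f =ᶠ[𝓝 q] g) (c : Fin 3 → ℂ) : euler c f =ᶠ[𝓝 q] euler c g := by
  filter_upwards [eventually_all.mpr fun i => theta_congr h i] with v hv
  simp only [euler, hv]

theorem euler_add (hf : AnalyticAt ℂ f q) (hg : AnalyticAt ℂ g q) (c : Fin 3 → ℂ) :
    euler c (fun v => f v + g v) =ᶠ[𝓝 q] fun v => euler c f v + euler c g v := by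
  filter_upwards [eventually_all.mpr fun i => theta_add hf hg i] with v hv
  simp only [euler, hv, mul_add, Finset.sum_add_distrib]

theorem taylorCoeff_euler (hf : AnalyticAt ℂ f 0) (c : Fin 3 → ℂ) (n : Fin 3 → ℕ) :
    taylorCoeff n (euler c f) = (∑ i, c i * n i) * taylorCoeff n f := by
  have h (i : Fin 3) : AnalyticAt ℂ (fun v => c i * theta i f v) 0 :=
    analyticAt_const.fun_mul (theta_analyticAt hf i)
  have e : euler c f = fun v => c 0 * theta 0 f v + c 1 * theta 1 f v + c 2 * theta 2 f v :=
    funext fun v => Fin.sum_univ_three _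
  rw [e, taylorCoeff_add ((h 0).fun_add (h 1)) (h 2), taylorCoeff_add (h 0) (h 1),
    taylorCoeff_const_mul (theta_analyticAt hf 0), taylorCoeff_const_mul (theta_analyticAt hf 1),
    taylorCoeff_const_mul (theta_analyticAt hf 2), taylorCoeff_theta hf, taylorCoeff_theta hf,
    taylorCoeff_theta hf, Fin.sum_univ_three]
  ring

theorem eulerFlow_zero (c q : Fin 3 → ℂ) : eulerFlow c q 0 = q := by
  funext i; simp [eulerFlow]

theorem hasDerivAt_eulerFlow (c q : Fin 3 → ℂ) (t : ℂ) :
    HasDerivAt (eulerFlow c q) (fun i => c i * eulerFlow c q t i) t := by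
  rw [hasDerivAt_pi]
  intro i
  have h := (((hasDerivAt_id t).const_mul (c i)).cexp).const_mul (q i)
  refine h.congr_deriv ?_
  simp [eulerFlow]
  ring

theorem hasDerivAt_comp_eulerFlow {t : ℂ} (hf : DifferentiableAt ℂ f (eulerFlow c q t)) :
    HasDerivAt (fun s => f (eulerFlow c q s)) (euler c f (eulerFlow c q t)) t := by
  refine (hf.hasFDerivAt.comp_hasDerivAt t (hasDerivAt_eulerFlow c q t)).congr_deriv ?_
  rw [euler, pi_eq_sum_univ' (fun i => c i * eulerFlow c q t i), map_sum]
  refine Finset.sum_congr rfl fun i _ => ?_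
  rw [map_smul, theta, smul_eq_mul, mul_assoc]

theorem tendsto_eulerFlow (c q : Fin 3 → ℂ) : Tendsto (eulerFlow c q) (𝓝 0) (𝓝 q) := by
  simpa [eulerFlow_zero] using (hasDerivAt_eulerFlow c q 0).continuousAt.tendsto

/-- The second Euler derivative is the second derivative along the flow, so it vanishes if the
first derivative `K` along the flow is stationary. -/
theorem euler_euler_eq_zero (hf : AnalyticAt ℂ f q) {K : ℂ → ℂ}
    (hK : ∀ᶠ s in 𝓝 0, HasDerivAt (fun r => f (eulerFlow c q r)) (K s) s)
    (hK' : HasDerivAt K 0 0) : euler c (euler c f) q = 0 := by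
  have h1 : K =ᶠ[𝓝 0] fun s => euler c f (eulerFlow c q s) := by
    filter_upwards [hK, (tendsto_eulerFlow c q).eventually hf.eventually_analyticAt] with s hs hs'
    exact hs.unique (hasDerivAt_comp_eulerFlow hs'.differentiableAt)
  have h2 := hasDerivAt_comp_eulerFlow (c := c) (q := q) (t := 0)
    (by rw [eulerFlow_zero]; exact (euler_analyticAt hf c).differentiableAt)
  rw [eulerFlow_zero] at h2
  exact (h2.congr_of_eventuallyEq h1).unique hK'

/-- `θ log q_i` is constant, so that the second Euler derivatives of `log q_i` vanish. -/
theorem euler_euler_log_div {i : Fin 3} (hq : q i ∈ slitPlane) (a : ℂ) (c : Fin 3 → ℂ) :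
    euler c (euler c fun v => log (v i) / a) q = 0 := by
  refine euler_euler_eq_zero (K := fun _ => c i / a) ((analyticAt_coord i q).clog hq).div_const ?_
    (hasDerivAt_const _ _)
  have h1 : ∀ᶠ v in 𝓝 q, v i ∈ slitPlane :=
    (continuous_apply i).continuousAt.eventually_mem (isOpen_slitPlane.mem_nhds hq)
  filter_upwards [(tendsto_eulerFlow c q).eventually h1] with s hs
  refine (((hasDerivAt_pi.mp (hasDerivAt_eulerFlow c q s) i).clog hs).div_const a).congr_deriv ?_
  rw [mul_div_assoc, div_self (slitPlane_ne_zero hs), mul_one]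

end Euler

/-- The derivation `q̂₁ ∂/∂q̂₁` in the variables `q̂₁ = q₁`, `q̂₂ = q₁ q₂`. -/
def dirA : Fin 3 → ℂ := ![1, -1, 0]

/-- The derivation `q̂₂ ∂/∂q̂₂` in the variables `q̂₁ = q₁`, `q̂₂ = q₁ q₂`. -/
def dirB : Fin 3 → ℂ := ![0, 1, 0]

theorem taylorCoeff_const {n : Fin 3 → ℕ} (hn : n ≠ 0) (a : ℂ) :
    taylorCoeff n (fun _ => a) = 0 := by
  obtain ⟨i, hi⟩ := Function.ne_iff.mp hn
  obtain ⟨m, rfl⟩ := exists_eq_add_single hi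
  exact taylorCoeff_eq_zero_of_update analyticAt_const (fun _ _ => rfl) m

/-- An analytic function of `q₁` and `q₂` killed by the squares of both derivations is constant:
the derivations act on monomials by their exponents. -/
theorem eventually_eq_const_of_euler {h : (Fin 3 → ℂ) → ℂ} (hh : AnalyticAt ℂ h 0)
    (hu : ∀ u z, h (Function.update u 2 z) = h u)
    (hA : euler dirA (euler dirA h) =ᶠ[𝓝 0] 0) (hB : euler dirB (euler dirB h) =ᶠ[𝓝 0] 0) :
    ∀ᶠ q in 𝓝 0, h q = h 0 := by
  have h0 (n : Fin 3 → ℕ) : taylorCoeff n (0 : (Fin 3 → ℂ) → ℂ) = 0 := by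
    have := taylorCoeff_const_mul (hh) 0 n
    simpa [Pi.zero_def] using this
  have key : (fun q => h q - h 0) =ᶠ[𝓝 0] 0 := by
    refine eventually_eq_zero_of_taylorCoeff (hh.fun_sub analyticAt_const) fun n => ?_
    rw [taylorCoeff_sub hh analyticAt_const]
    by_cases hn : n = 0
    · subst hn; simp
    rw [taylorCoeff_const hn, sub_zero]
    have h1 := taylorCoeff_congr hA n
    have h2 := taylorCoeff_congr hB n
    rw [taylorCoeff_euler (euler_analyticAt hh _), taylorCoeff_euler hh, h0] at h1 h2
    simp only [dirA, dirB, Fin.sum_univ_three, Matrix.cons_val_zero, Matrix.cons_val_one,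
      Matrix.cons_val, one_mul, neg_mul, zero_mul, add_zero, zero_add, mul_eq_zero] at h1 h2
    by_contra hne
    have e1 : n 1 = 0 := by simpa [hne] using h2
    have e0 : n 0 = 0 := by simpa [hne, e1] using h1
    have e2 : n 2 ≠ 0 := fun e2 => hn (by funext i; fin_cases i <;> assumption)
    obtain ⟨m, rfl⟩ := exists_eq_add_single e2
    exact hne (taylorCoeff_eq_zero_of_update hh hu m)
  filter_upwards [key] with q hq
  exact sub_eq_zero.mp hq

/-- An analytic function near `0` vanishing where `Re q₁ > 0` and `Re q₂ > 0` is zero. -/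
theorem eventually_eq_zero_of_re_pos {h : (Fin 3 → ℂ) → ℂ} (hh : AnalyticAt ℂ h 0)
    (h0 : ∀ᶠ q in 𝓝 (0 : Fin 3 → ℂ), 0 < (q 0).re → 0 < (q 1).re → h q = 0) :
    h =ᶠ[𝓝 0] 0 := by
  obtain ⟨r, hr, hball⟩ := Metric.eventually_nhds_iff_ball.mp (hh.eventually_analyticAt.and h0)
  have hp : (fun _ => ((r / 2 : ℝ) : ℂ) : Fin 3 → ℂ) ∈ Metric.ball (0 : Fin 3 → ℂ) r := by
    rw [mem_ball_zero_iff, pi_norm_lt_iff hr]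
    intro i
    simp [abs_of_pos hr, hr]
  have hre (i : Fin 3) : ∀ᶠ q in 𝓝 (fun _ => ((r / 2 : ℝ) : ℂ) : Fin 3 → ℂ), 0 < (q i).re :=
    (continuous_re.comp (continuous_apply i)).continuousAt.eventually_const_lt (by simpa using hr)
  have h1 : h =ᶠ[𝓝 (fun _ => ((r / 2 : ℝ) : ℂ) : Fin 3 → ℂ)] 0 := by
    filter_upwards [Metric.isOpen_ball.mem_nhds hp, hre 0, hre 1] with q hq h2 h3
    exact (hball q hq).2 h2 h3
  have h2 := AnalyticOnNhd.eqOn_zero_of_preconnected_of_eventuallyEq_zero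
    (fun q hq => (hball q hq).1) (convex_ball (0 : Fin 3 → ℂ) r).isPreconnected hp h1
  exact h2.eventuallyEq_of_mem (Metric.ball_mem_nhds 0 hr)


/-! ### The leading order of the mirror map -/

/-- The differential equations of `E₄^(1/4)`, `(1 - 1728/j)^(1/2)` and `E₂` at `z`. -/
structure RamanujanAt (z : ℂ) : Prop where
  ne_zero : rootE4 z ≠ 0
  root : HasDerivAt (fun s => rootE4 (z * exp s))
    (rootE4 z * (nomeE2 z - ratioE6 z * rootE4 z ^ 2) / 12) 0
  ratio : HasDerivAt (fun s => ratioE6 (z * exp s))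
    (-((1 - ratioE6 z ^ 2) * rootE4 z ^ 2 / 2)) 0
  quasi : HasDerivAt (fun s => nomeE2 (z * exp s)) ((nomeE2 z ^ 2 - rootE4 z ^ 4) / 12) 0

theorem hasDerivAt_comp_mul_exp {f : ℂ → ℂ} {z : ℂ} (hf : DifferentiableAt ℂ f z) :
    HasDerivAt (fun s => f (z * exp s)) (z * deriv f z) 0 := by
  have h1 : HasDerivAt (fun s => z * exp s) z 0 := by
    simpa using (hasDerivAt_exp 0).const_mul z
  have h2 : HasDerivAt f (deriv f z) (z * exp 0) := by simpa using hf.hasDerivAt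
  exact (h2.comp 0 h1).congr_deriv (mul_comm _ _)

theorem eventually_ramanujanAt : ∀ᶠ z in 𝓝 0, RamanujanAt z := by
  filter_upwards [rootE4_eventually_ne, rootE4_derivative, ratioE6_derivative, ramanujan_E2,
    rootE4_analyticAt.eventually_analyticAt, ratioE6_analyticAt.eventually_analyticAt,
    nomeE2_analyticAt.eventually_analyticAt] with z h0 h1 h2 h3 h4 h5 h6
  refine ⟨h0, ?_, ?_, ?_⟩
  · rw [← h1]; exact hasDerivAt_comp_mul_exp h4.differentiableAt
  · rw [← h2]; exact hasDerivAt_comp_mul_exp h5.differentiableAt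
  · rw [rootE4_pow_four, ← h3]; exact hasDerivAt_comp_mul_exp h6.differentiableAt

/-- Translation along the logarithm of the nome. -/
theorem hasDerivAt_mul_exp_shift {f : ℂ → ℂ} {f' z s : ℂ}
    (h : HasDerivAt (fun r => f (z * exp s * exp r)) f' 0) :
    HasDerivAt (fun r => f (z * exp r)) f' s := by
  have h1 : HasDerivAt (fun r => r - s) 1 s := (hasDerivAt_id s).sub_const s
  have h2 := HasDerivAt.comp_of_eq s h h1 (sub_self s).symm
  simp only [Function.comp_def, mul_assoc, ← exp_add, add_sub_cancel, mul_one] at h2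
  exact h2

/-- The case of a single nome `z`, which moves as `z exp s` along the flow while the other nome
`z'` stays fixed. -/
theorem euler_euler_eq_zero_of_solves {c q : Fin 3 → ℂ} {k F : (Fin 3 → ℂ) → ℂ} {z z' : ℂ}
    (hz : ∀ᶠ y in 𝓝 z, RamanujanAt y) (hk : AnalyticAt ℂ k q)
    (hF : AnalyticAt ℂ F (leadingPoint (ratioE6 z) (ratioE6 z')))
    (h₁ : picardFuchs₁ F (leadingPoint (ratioE6 z) (ratioE6 z')) = 0)
    (h₂ : picardFuchsBase 1 F (leadingPoint (ratioE6 z) (ratioE6 z')) = 0)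
    (hne : 1 - ratioE6 z * ratioE6 z' ≠ 0)
    (hkF : ∀ᶠ s in 𝓝 0, k (eulerFlow c q s) =
      F (leadingPoint (ratioE6 (z * exp s)) (ratioE6 z')) /
        (rootE4 (z * exp s) * rootE4 z')) :
    euler c (euler c k) q = 0 := by
  have ht : Tendsto (fun s : ℂ => z * exp s) (𝓝 0) (𝓝 z) := by
    have : Continuous fun s : ℂ => z * exp s := by fun_prop
    simpa using this.tendsto 0
  have h := ht.eventually hz
  obtain ⟨K, hK, hK'⟩ := exists_hasDerivAt_zero_of_solves (t := 0) (c := rootE4 z')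
    (v := ratioE6 z') (e := fun s => rootE4 (z * exp s)) (w := fun s => ratioE6 (z * exp s))
    (E := fun s => nomeE2 (z * exp s)) (F := F)
    (h.mono fun s hs => hasDerivAt_mul_exp_shift hs.root)
    (h.mono fun s hs => hasDerivAt_mul_exp_shift hs.ratio)
    (by simpa using hz.self_of_nhds.quasi) (by simpa using hz.self_of_nhds.ne_zero)
    (by simpa using hne) (by simpa using hF) (by simpa using h₁) (by simpa using h₂)
  refine euler_euler_eq_zero hk (K := K) ?_ hK'
  filter_upwards [hK, hkF.eventually_nhds] with s hs hs'
  exact hs.congr_of_eventuallyEq hs'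

/-- The unit `u₁ / q₁` on the divisor `u₃ = 0`. -/
def leadUnit₁ (q : Fin 3 → ℂ) : ℂ :=
  2 * (jInvUnit (q 0) + q 1 * jInvUnit (q 0 * q 1) -
    1728 * (q 0 * q 1) * (jInvUnit (q 0) * jInvUnit (q 0 * q 1))) /
    (1 + ratioE6 (q 0) * ratioE6 (q 0 * q 1))

/-- The unit `u₂ / q₂` on the divisor `u₃ = 0`. -/
def leadUnit₂ (q : Fin 3 → ℂ) : ℂ :=
  jInvUnit (q 0) * jInvUnit (q 0 * q 1) / leadUnit₁ q ^ 2

/-- The leading order of the mirror map, as an analytic function near `q = 0`. -/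
def leadMap (q : Fin 3 → ℂ) : Fin 3 → ℂ := ![q 0 * leadUnit₁ q, q 1 * leadUnit₂ q, 0]

theorem AnalyticAt.comp_qHat₂ {f : ℂ → ℂ} (hf : AnalyticAt ℂ f 0) :
    AnalyticAt ℂ (fun q : Fin 3 → ℂ => f (q 0 * q 1)) 0 :=
  hf.comp_of_eq ((analyticAt_coord 0 0).fun_mul (analyticAt_coord 1 0)) (by simp)

theorem leadUnit₁_zero : leadUnit₁ 0 = 1 := by
  simp [leadUnit₁, jInvUnit_zero, ratioE6_zero]
  norm_num

theorem leadUnit₂_zero : leadUnit₂ 0 = 1 := by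
  simp [leadUnit₂, jInvUnit_zero, leadUnit₁_zero]

theorem leadUnit₁_analyticAt : AnalyticAt ℂ leadUnit₁ 0 := by
  have a1 := AnalyticAt.comp_coord 0 jInvUnit_analyticAt
  have a2 := AnalyticAt.comp_qHat₂ jInvUnit_analyticAt
  have w1 := AnalyticAt.comp_coord 0 ratioE6_analyticAt
  have w2 := AnalyticAt.comp_qHat₂ ratioE6_analyticAt
  have c0 := analyticAt_coord 0 0
  have c1 := analyticAt_coord 1 0
  exact (analyticAt_const.fun_mul ((a1.fun_add (c1.fun_mul a2)).fun_sub
    ((analyticAt_const.fun_mul (c0.fun_mul c1)).fun_mul (a1.fun_mul a2)))).fun_div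
    (analyticAt_const.fun_add (w1.fun_mul w2)) (by simp [ratioE6_zero])

theorem leadUnit₂_analyticAt : AnalyticAt ℂ leadUnit₂ 0 :=
  ((AnalyticAt.comp_coord 0 jInvUnit_analyticAt).fun_mul
    (AnalyticAt.comp_qHat₂ jInvUnit_analyticAt)).fun_div (leadUnit₁_analyticAt.fun_pow 2)
    (by simp [leadUnit₁_zero])

theorem leadMap_analyticAt : AnalyticAt ℂ leadMap 0 := by
  refine AnalyticAt.pi fun i => ?_
  fin_cases i
  · exact (analyticAt_coord 0 0).fun_mul leadUnit₁_analyticAt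
  · exact (analyticAt_coord 1 0).fun_mul leadUnit₂_analyticAt
  · exact analyticAt_const

theorem leadMap_zero : leadMap 0 = 0 := by
  funext i; fin_cases i <;> simp [leadMap]

theorem tendsto_qHat₁ : Tendsto (fun q : Fin 3 → ℂ => q 0) (𝓝 0) (𝓝 0) :=
  (continuous_apply 0).tendsto' _ _ rfl

theorem tendsto_qHat₂ : Tendsto (fun q : Fin 3 → ℂ => q 0 * q 1) (𝓝 0) (𝓝 0) :=
  ((continuous_apply 0).mul (continuous_apply 1)).tendsto' _ _ (by simp)

/-- Off `q₁ q₂ = 0`, `leadMap` is `leadingPoint`: the relation `w² = 1 - 1728 / j` turns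
`1 - w v = (1 - w² v²) / (1 + w v)` into a multiple of `q₁`. -/
theorem leadMap_eq : ∀ᶠ q : Fin 3 → ℂ in 𝓝 0, q 0 ≠ 0 → q 1 ≠ 0 →
    1 - ratioE6 (q 0) * ratioE6 (q 0 * q 1) ≠ 0 ∧
      leadMap q = leadingPoint (ratioE6 (q 0)) (ratioE6 (q 0 * q 1)) := by
  have w1 := (AnalyticAt.comp_coord 0 ratioE6_analyticAt).continuousAt
  have w2 := (AnalyticAt.comp_qHat₂ ratioE6_analyticAt).continuousAt
  have h1 : ∀ᶠ q : Fin 3 → ℂ in 𝓝 0, 1 + ratioE6 (q 0) * ratioE6 (q 0 * q 1) ≠ 0 :=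
    (continuousAt_const.add (w1.mul w2)).eventually_ne (by simp [ratioE6_zero])
  have h2 := leadUnit₁_analyticAt.continuousAt.eventually_ne
    (show leadUnit₁ 0 ≠ 0 by simp [leadUnit₁_zero])
  filter_upwards [h1, h2, tendsto_qHat₁.eventually ratioE6_sq, tendsto_qHat₂.eventually ratioE6_sq]
    with q h1 h2 h3 h4 hq0 hq1
  have e1 : 1 - ratioE6 (q 0) * ratioE6 (q 0 * q 1) = 864 * (q 0 * leadUnit₁ q) := by
    rw [leadUnit₁, mul_div_assoc', mul_div_assoc', eq_div_iff h1]
    linear_combination -(1 - 1728 * (q 0 * jInvUnit (q 0))) * h4 - ratioE6 (q 0 * q 1) ^ 2 * h3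
  have e2 : 1 - ratioE6 (q 0) * ratioE6 (q 0 * q 1) ≠ 0 := by
    rw [e1]
    exact mul_ne_zero (by norm_num) (mul_ne_zero hq0 h2)
  refine ⟨e2, ?_⟩
  funext i
  fin_cases i
  · simp only [leadMap, leadingPoint, e1]
    simp
  · simp only [leadMap, leadingPoint, e1, h3, h4, leadUnit₂]
    simp
    field_simp
    ring
  · rfl

/-- Where a function equals a solution of the Picard-Fuchs system along `leadMap`, divided by the
product of the fourth roots of `E₄`, its second derivatives along `q̂₁` and `q̂₂` vanish. -/
theorem euler_euler_eq_zero_of_solves_leadMap : ∀ᶠ q : Fin 3 → ℂ in 𝓝 0, q 0 ≠ 0 → q 1 ≠ 0 →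
    ∀ k F : (Fin 3 → ℂ) → ℂ, AnalyticAt ℂ k q → AnalyticAt ℂ F (leadMap q) →
      picardFuchs₁ F (leadMap q) = 0 → picardFuchsBase 1 F (leadMap q) = 0 →
      (k =ᶠ[𝓝 q] fun v => F (leadMap v) / (rootE4 (v 0) * rootE4 (v 0 * v 1))) →
      euler dirA (euler dirA k) q = 0 ∧ euler dirB (euler dirB k) q = 0 := by
  filter_upwards [leadMap_eq, leadMap_eq.eventually_nhds,
    tendsto_qHat₁.eventually eventually_ramanujanAt.eventually_nhds,
    tendsto_qHat₂.eventually eventually_ramanujanAt.eventually_nhds]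
    with q h1 h2 h3 h4 hq0 hq1 k F hk hF hF1 hF2 hkF
  obtain ⟨hne, he⟩ := h1 hq0 hq1
  have hn0 : ∀ᶠ v : Fin 3 → ℂ in 𝓝 q, v 0 ≠ 0 :=
    (continuous_apply 0).continuousAt.eventually_ne hq0
  have hn1 : ∀ᶠ v : Fin 3 → ℂ in 𝓝 q, v 1 ≠ 0 :=
    (continuous_apply 1).continuousAt.eventually_ne hq1
  have hkF' : ∀ᶠ v in 𝓝 q, k v = F (leadingPoint (ratioE6 (v 0)) (ratioE6 (v 0 * v 1))) /
      (rootE4 (v 0) * rootE4 (v 0 * v 1)) := by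
    filter_upwards [h2, hn0, hn1, hkF] with v h2 hv0 hv1 hkF
    rw [hkF, (h2 hv0 hv1).2]
  constructor
  · rw [he] at hF hF1 hF2
    refine euler_euler_eq_zero_of_solves h3 hk hF hF1 hF2 hne ?_
    filter_upwards [(tendsto_eulerFlow dirA q).eventually hkF'] with s hs
    have e : q 0 * exp s * (q 1 * exp (-s)) = q 0 * q 1 := by
      rw [exp_neg]
      field_simp
    simpa [eulerFlow, dirA, e] using hs
  · rw [he, leadingPoint_comm] at hF hF1 hF2
    rw [mul_comm (ratioE6 (q 0))] at hne
    refine euler_euler_eq_zero_of_solves h4 hk hF hF1 hF2 hne ?_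
    filter_upwards [(tendsto_eulerFlow dirB q).eventually hkF'] with s hs
    rw [leadingPoint_comm, mul_comm (rootE4 _)] at hs
    simpa [eulerFlow, dirB, mul_assoc] using hs


/-! ### The periods and the mirror map to leading order -/

section Periods

variable {ϖ₀ : (Fin 3 → ℂ) → ℂ} {ϖ : Fin 3 → (Fin 3 → ℂ) → ℂ} {g : (Fin 3 → ℂ) → ℂ}

theorem tendsto_leadMap : Tendsto leadMap (𝓝 0) (𝓝 0) := by
  simpa [leadMap_zero] using leadMap_analyticAt.continuousAt.tendsto

theorem rootE4_mul_analyticAt :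
    AnalyticAt ℂ (fun q : Fin 3 → ℂ => rootE4 (q 0) * rootE4 (q 0 * q 1)) 0 :=
  (AnalyticAt.comp_coord 0 rootE4_analyticAt).fun_mul (AnalyticAt.comp_qHat₂ rootE4_analyticAt)

theorem rootE4_mul_eventually_ne :
    ∀ᶠ q : Fin 3 → ℂ in 𝓝 0, rootE4 (q 0) * rootE4 (q 0 * q 1) ≠ 0 :=
  rootE4_mul_analyticAt.continuousAt.eventually_ne (by simp [rootE4_zero])

theorem leadMap_update (u : Fin 3 → ℂ) (z : ℂ) : leadMap (Function.update u 2 z) = leadMap u := by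
  simp [leadMap, leadUnit₁, leadUnit₂]

/-- On the divisor `q₃ = 0`, the holomorphic period is `E₄(q̂₁)^(1/4) E₄(q̂₂)^(1/4)`. -/
theorem period_leadMap (h : IsStandardPeriods ϖ₀ ϖ) :
    ∀ᶠ q in 𝓝 0, ϖ₀ (leadMap q) = rootE4 (q 0) * rootE4 (q 0 * q 1) := by
  set k : (Fin 3 → ℂ) → ℂ := fun q => ϖ₀ (leadMap q) / (rootE4 (q 0) * rootE4 (q 0 * q 1)) with hk
  have hka : AnalyticAt ℂ k 0 :=
    (h.analyticAt.comp_of_eq leadMap_analyticAt leadMap_zero).fun_div rootE4_mul_analyticAt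
      (by simp [rootE4_zero])
  have key : ∀ᶠ q : Fin 3 → ℂ in 𝓝 0, 0 < (q 0).re → 0 < (q 1).re →
      euler dirA (euler dirA k) q = 0 ∧ euler dirB (euler dirB k) q = 0 := by
    filter_upwards [euler_euler_eq_zero_of_solves_leadMap, hka.eventually_analyticAt,
      tendsto_leadMap.eventually h.analyticAt.eventually_analyticAt,
      tendsto_leadMap.eventually h.solves] with q h1 h2 h3 h4 hq0 hq1
    exact h1 (ne_zero_of_re_pos hq0) (ne_zero_of_re_pos hq1) k ϖ₀ h2 h3 h4.1 h4.2.1 .rfl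
  have hc := eventually_eq_const_of_euler hka
    (fun u z => by simp only [hk, leadMap_update]; simp)
    (eventually_eq_zero_of_re_pos (euler_analyticAt (euler_analyticAt hka _) _)
      (key.mono fun q hq h0 h1 => (hq h0 h1).1))
    (eventually_eq_zero_of_re_pos (euler_analyticAt (euler_analyticAt hka _) _)
      (key.mono fun q hq h0 h1 => (hq h0 h1).2))
  filter_upwards [hc, rootE4_mul_eventually_ne] with q hq hne
  have h0 : k 0 = 1 := by simp [hk, leadMap_zero, h.apply_zero, rootE4_zero]
  rw [h0] at hq
  exact (div_eq_one_iff_eq hne).mp hq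

/-- The logarithmic solutions satisfy the equations `L₁` and `L₂` on the divisor `u₃ = 0` as well,
by continuity. -/
theorem IsStandardPeriods.log_solves_of_eq_zero (h : IsStandardPeriods ϖ₀ ϖ) {i : Fin 3}
    (hi : i ≠ 2) (hg : AnalyticAt ℂ g 0)
    (hϖ : ∀ᶠ u in 𝓝 0, (∀ j, u j ≠ 0) →
      ϖ i u = ϖ₀ u / (2 * Real.pi * I) * log (u i) + g u) :
    ∀ᶠ p : Fin 3 → ℂ in 𝓝 0, p 0 ∈ slitPlane → p 1 ∈ slitPlane → p 2 = 0 →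
      AnalyticAt ℂ (fun u => ϖ₀ u / (2 * Real.pi * I) * log (u i) + g u) p ∧
      picardFuchs₁ (fun u => ϖ₀ u / (2 * Real.pi * I) * log (u i) + g u) p = 0 ∧
      picardFuchsBase 1 (fun u => ϖ₀ u / (2 * Real.pi * I) * log (u i) + g u) p = 0 := by
  set F : (Fin 3 → ℂ) → ℂ := fun u => ϖ₀ u / (2 * Real.pi * I) * log (u i) + g u
  filter_upwards [h.analyticAt.eventually_analyticAt, hg.eventually_analyticAt,
    hϖ.eventually_nhds, (h.log_solves i).eventually_nhds] with p h1 h2 h3 h4 hp0 hp1 hp2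
  have hpi : p i ∈ slitPlane := by
    fin_cases i
    · exact hp0
    · exact hp1
    · exact absurd rfl hi
  have hF : AnalyticAt ℂ F p :=
    (h1.div_const.fun_mul ((analyticAt_coord i p).clog hpi)).fun_add h2
  -- approach the divisor along `u₃ > 0`, where the equations are imposed
  have hcurve : Tendsto (fun s : ℝ => Function.update p 2 (s : ℂ)) (𝓝[>] 0) (𝓝 p) := by
    have hc : Continuous fun s : ℝ => Function.update p 2 (s : ℂ) :=
      continuous_const.update 2 continuous_ofReal
    refine (hc.tendsto' 0 p ?_).mono_left nhdsWithin_le_nhds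
    rw [ofReal_zero, ← hp2, Function.update_eq_self]
  have hzero : ∀ᶠ s : ℝ in 𝓝[>] 0, SolvesPicardFuchsAt F (Function.update p 2 (s : ℂ)) := by
    filter_upwards [hcurve.eventually h3.eventually_nhds, hcurve.eventually h4,
      self_mem_nhdsWithin] with s hs3 hs4 hs
    have hslit : ∀ j, Function.update p 2 (s : ℂ) j ∈ slitPlane := by
      intro j
      fin_cases j
      · simpa using hp0
      · simpa using hp1
      · simpa using hs
    have hne : ∀ᶠ u in 𝓝 (Function.update p 2 (s : ℂ)), ∀ j, u j ≠ 0 :=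
      eventually_all.mpr fun j =>
        (continuous_apply j).continuousAt.eventually_ne (slitPlane_ne_zero (hslit j))
    have heq : ϖ i =ᶠ[𝓝 (Function.update p 2 (s : ℂ))] F := by
      filter_upwards [hs3, hne] with u hu hu'
      exact hu hu'
    obtain ⟨e1, e2, e3⟩ := hs4 hslit
    refine ⟨?_, ?_, ?_⟩
    · rw [← (picardFuchs₁_congr heq).eq_of_nhds, e1]
    · rw [← (picardFuchsBase_congr heq 1).eq_of_nhds, e2]
    · rw [← (picardFuchsBase_congr heq 2).eq_of_nhds, e3]
  refine ⟨hF, ?_, ?_⟩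
  · exact tendsto_nhds_unique
      (((picardFuchs₁_analyticAt hF).continuousAt.tendsto.comp hcurve).congr'
        (hzero.mono fun s hs => hs.1)) tendsto_const_nhds
  · exact tendsto_nhds_unique
      (((picardFuchsBase_analyticAt hF 1).continuousAt.tendsto.comp hcurve).congr'
        (hzero.mono fun s hs => hs.2.1)) tendsto_const_nhds

/-- On the right half plane the principal logarithm is additive. -/
theorem mul_mem_slitPlane_of_re_pos {x y : ℂ} (hx : 0 < x.re) (hy : 0 < y.re) :
    x * y ∈ slitPlane ∧ log (x * y) = log x + log y := by
  have hx0 := ne_zero_of_re_pos hx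
  have hy0 := ne_zero_of_re_pos hy
  have h1 := abs_lt.mp (abs_arg_lt_pi_div_two_iff.mpr (Or.inl hx))
  have h2 := abs_lt.mp (abs_arg_lt_pi_div_two_iff.mpr (Or.inl hy))
  have h3 : x.arg + y.arg ∈ Set.Ioc (-Real.pi) Real.pi := ⟨by linarith, by linarith⟩
  refine ⟨mem_slitPlane_iff_arg.mpr ⟨?_, mul_ne_zero hx0 hy0⟩, log_mul hx0 hy0 h3⟩
  rw [(arg_mul_eq_add_arg_iff hx0 hy0).mpr h3]
  linarith

/-- The units `u_i / q_i` on the divisor `u₃ = 0`, for `i = 1, 2`. -/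
def leadUnit (i : Fin 3) : (Fin 3 → ℂ) → ℂ := ![leadUnit₁, leadUnit₂, 1] i

theorem leadMap_apply (q : Fin 3 → ℂ) {i : Fin 3} (hi : i ≠ 2) :
    leadMap q i = q i * leadUnit i q := by
  fin_cases i
  · rfl
  · rfl
  · exact absurd rfl hi

theorem leadUnit_analyticAt (i : Fin 3) : AnalyticAt ℂ (leadUnit i) 0 := by
  fin_cases i
  exacts [leadUnit₁_analyticAt, leadUnit₂_analyticAt, analyticAt_const]

theorem leadUnit_zero (i : Fin 3) : leadUnit i 0 = 1 := by
  fin_cases i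
  exacts [leadUnit₁_zero, leadUnit₂_zero, rfl]

/-- On the divisor `q₃ = 0`, the holomorphic part of the logarithmic period `ϖ(u, δ_i)` is
determined by the unit `u_i / q_i`. -/
theorem log_leadUnit (h : IsStandardPeriods ϖ₀ ϖ) {i : Fin 3} (hi : i ≠ 2)
    (hg : AnalyticAt ℂ g 0) (hg0 : g 0 = 0)
    (hϖ : ∀ᶠ u in 𝓝 0, (∀ j, u j ≠ 0) →
      ϖ i u = ϖ₀ u / (2 * Real.pi * I) * log (u i) + g u) :
    ∀ᶠ q in 𝓝 0, log (leadUnit i q) / (2 * Real.pi * I) +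
      g (leadMap q) / (rootE4 (q 0) * rootE4 (q 0 * q 1)) = 0 := by
  set H : (Fin 3 → ℂ) → ℂ := fun q => log (leadUnit i q) / (2 * Real.pi * I) +
      g (leadMap q) / (rootE4 (q 0) * rootE4 (q 0 * q 1)) with hH
  have hre (j : Fin 3) : ∀ᶠ q in 𝓝 0, 0 < (leadUnit j q).re :=
    (continuous_re.continuousAt.comp (leadUnit_analyticAt j).continuousAt).eventually_const_lt
      (by simp [leadUnit_zero])
  have hHa : AnalyticAt ℂ H 0 := by
    refine ((leadUnit_analyticAt i).clog (by simp [leadUnit_zero])).div_const.fun_add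
      ((hg.comp_of_eq leadMap_analyticAt leadMap_zero).fun_div rootE4_mul_analyticAt
      (by simp [rootE4_zero]))
  have key : ∀ᶠ q : Fin 3 → ℂ in 𝓝 0, 0 < (q 0).re → 0 < (q 1).re →
      euler dirA (euler dirA H) q = 0 ∧ euler dirB (euler dirB H) q = 0 := by
    filter_upwards [euler_euler_eq_zero_of_solves_leadMap, hHa.eventually_analyticAt,
      tendsto_leadMap.eventually (h.log_solves_of_eq_zero hi hg hϖ), hre 0, hre 1,
      (hre i).eventually_nhds, (period_leadMap h).eventually_nhds,
      rootE4_mul_eventually_ne.eventually_nhds] with q h1 h2 h3 hr0 hr1 hri hper hne hq0 hq1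
    have hqi : 0 < (q i).re := by
      fin_cases i
      · exact hq0
      · exact hq1
      · exact absurd rfl hi
    have hqi' : ∀ᶠ v : Fin 3 → ℂ in 𝓝 q, 0 < (v i).re :=
      (continuous_re.comp (continuous_apply i)).continuousAt.eventually_const_lt hqi
    have hslit : q i ∈ slitPlane := Or.inl hqi
    obtain ⟨hF, hF1, hF2⟩ := h3
      (by rw [leadMap_apply q (by decide)]; exact (mul_mem_slitPlane_of_re_pos hq0 hr0).1)
      (by rw [leadMap_apply q (by decide)]; exact (mul_mem_slitPlane_of_re_pos hq1 hr1).1) rfl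
    have hlog : AnalyticAt ℂ (fun v : Fin 3 → ℂ => log (v i) / (2 * Real.pi * I)) q :=
      analyticAt_log_div hslit
    -- along `leadMap`, the period divided by `E₄(q̂₁)^(1/4) E₄(q̂₂)^(1/4)` is `log q_i / (2πi) + H`
    have h4 := h1 (ne_zero_of_re_pos hq0) (ne_zero_of_re_pos hq1)
      (fun v => log (v i) / (2 * Real.pi * I) + H v) _ (hlog.fun_add h2) hF hF1 hF2 (by
        filter_upwards [hqi', hri, hper, hne] with v hv hv' hper hne
        obtain ⟨hne0, hne1⟩ := mul_ne_zero_iff.mp hne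
        rw [leadMap_apply v hi, (mul_mem_slitPlane_of_re_pos hv hv').2, hper, hH]
        field_simp
        ring)
    have h5 (c : Fin 3 → ℂ) : euler c (euler c fun v => log (v i) / (2 * Real.pi * I) + H v) q =
        euler c (euler c H) q := by
      rw [(euler_congr (euler_add hlog h2 c) c).eq_of_nhds,
        (euler_add (euler_analyticAt hlog c) (euler_analyticAt h2 c) c).eq_of_nhds,
        euler_euler_log_div hslit, zero_add]
    rwa [h5, h5] at h4
  have hc := eventually_eq_const_of_euler hHa
    (fun u z => by
      simp only [hH, leadMap_update]
      fin_cases i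
      · simp [leadUnit, leadUnit₁]
      · simp [leadUnit, leadUnit₁, leadUnit₂]
      · exact absurd rfl hi)
    (eventually_eq_zero_of_re_pos (euler_analyticAt (euler_analyticAt hHa _) _)
      (key.mono fun q hq h0 h1 => (hq h0 h1).1))
    (eventually_eq_zero_of_re_pos (euler_analyticAt (euler_analyticAt hHa _) _)
      (key.mono fun q hq h0 h1 => (hq h0 h1).2))
  filter_upwards [hc] with q hq
  refine hq.trans ?_
  simp [hH, leadUnit_zero, leadMap_zero, hg0]

/-- On the divisor `q₃ = 0`, the mirror map is `leadMap`. -/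
theorem IsMirrorMap.apply_divisor {U : (Fin 3 → ℂ) → (Fin 3 → ℂ)} (h : IsStandardPeriods ϖ₀ ϖ)
    (hU : IsMirrorMap ϖ₀ ϖ U) : ∀ᶠ q in 𝓝 0, U ![q 0, q 1, 0] = leadMap q := by
  choose g hg hg0 hϖ using h.log_form
  have hlog := fun (i : Fin 3) (hi : i ≠ 2) => log_leadUnit h hi (hg i) (hg0 i) (hϖ i)
  have hne (i : Fin 3) : ∀ᶠ q in 𝓝 0, leadUnit i q ≠ 0 :=
    (leadUnit_analyticAt i).continuousAt.eventually_ne (by simp [leadUnit_zero])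
  filter_upwards [tendsto_leadMap.eventually (hU.comp_nomeMap h hg hg0 hϖ), hlog 0 (by decide),
    hlog 1 (by decide), period_leadMap h, hne 0, hne 1] with q h1 h2 h3 h4 h5 h6
  have hcomp {i : Fin 3} (hi : i ≠ 2) (hu : leadUnit i q ≠ 0)
      (hl : log (leadUnit i q) / (2 * Real.pi * I) +
        g i (leadMap q) / (rootE4 (q 0) * rootE4 (q 0 * q 1)) = 0) :
      nomeMap ϖ₀ g (leadMap q) i = q i := by
    have e : 2 * Real.pi * I * (g i (leadMap q) / ϖ₀ (leadMap q)) = -log (leadUnit i q) := by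
      rw [h4]
      have hpi := Complex.two_pi_I_ne_zero
      rw [eq_neg_of_add_eq_zero_right hl]
      field_simp
    rw [nomeMap, leadMap_apply q hi, e, exp_neg, exp_log hu]
    field_simp
  have hn : nomeMap ϖ₀ g (leadMap q) = ![q 0, q 1, 0] := by
    funext i
    fin_cases i
    · exact hcomp (by decide) h5 h2
    · exact hcomp (by decide) h6 h3
    · simp [nomeMap, leadMap]
  rw [← hn, h1]

end Periods

/-- Off the coordinate hyperplanes, the components of `leadMap` are the leading terms in `j`. -/
theorem leadMap_eq_leadingU : ∀ᶠ q : Fin 3 → ℂ in 𝓝 0, (∀ i, q i ≠ 0) →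
    leadMap q 0 = leadingU₁ (qHat₁ q) (qHat₂ q) ∧
      leadMap q 1 = leadingU₂ (qHat₁ q) (qHat₂ q) := by
  have ha : ∀ᶠ z in 𝓝 0, jInvUnit z ≠ 0 :=
    jInvUnit_analyticAt.continuousAt.eventually_ne (by simp [jInvUnit_zero])
  have w1 := (AnalyticAt.comp_coord 0 ratioE6_analyticAt).continuousAt
  have w2 := (AnalyticAt.comp_qHat₂ ratioE6_analyticAt).continuousAt
  have h1 : ∀ᶠ q : Fin 3 → ℂ in 𝓝 0, 1 + ratioE6 (q 0) * ratioE6 (q 0 * q 1) ≠ 0 :=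
    (continuousAt_const.add (w1.mul w2)).eventually_ne (by simp [ratioE6_zero])
  have h2 := leadUnit₁_analyticAt.continuousAt.eventually_ne
    (show leadUnit₁ 0 ≠ 0 by simp [leadUnit₁_zero])
  filter_upwards [h1, h2, tendsto_qHat₁.eventually ha, tendsto_qHat₂.eventually ha,
    tendsto_qHat₁.eventually sqrtJ_eq, tendsto_qHat₂.eventually sqrtJ_eq]
    with q h1 h2 h3 h4 h5 h6 hq
  have hq0 := hq 0
  have hq1 := hq 1
  have j1 : j (q 0) = (q 0 * jInvUnit (q 0))⁻¹ := by rw [← inv_j, inv_inv]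
  have j2 : j (q 0 * q 1) = (q 0 * q 1 * jInvUnit (q 0 * q 1))⁻¹ := by rw [← inv_j, inv_inv]
  simp only [qHat₁, qHat₂]
  have e1 : q 0 * leadUnit₁ q = leadingU₁ (q 0) (q 0 * q 1) := by
    rw [leadingU₁, h5, h6, j1, j2, leadUnit₁]
    have h7 : (q 0 * jInvUnit (q 0))⁻¹ * (q 0 * q 1 * jInvUnit (q 0 * q 1))⁻¹ +
      (q 0 * jInvUnit (q 0))⁻¹ * ratioE6 (q 0) *
        ((q 0 * q 1 * jInvUnit (q 0 * q 1))⁻¹ * ratioE6 (q 0 * q 1)) =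
      (q 0 * jInvUnit (q 0))⁻¹ * (q 0 * q 1 * jInvUnit (q 0 * q 1))⁻¹ *
        (1 + ratioE6 (q 0) * ratioE6 (q 0 * q 1)) := by ring
    rw [h7]
    field_simp
    ring
  refine ⟨e1, ?_⟩
  have e2 : leadingU₂ (q 0) (q 0 * q 1) =
      (j (q 0) * j (q 0 * q 1) * leadingU₁ (q 0) (q 0 * q 1) ^ 2)⁻¹ := by
    rw [leadingU₁, leadingU₂, div_pow, mul_div_assoc', inv_div]
    ring
  rw [e2, ← e1, j1, j2]
  change q 1 * leadUnit₂ q = _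
  rw [leadUnit₂]
  field_simp

/-- A map that is analytic at `0` differs by `O(q₃)` from its values on the divisor `q₃ = 0`. -/
theorem isBigO_sub_divisor {U V : (Fin 3 → ℂ) → (Fin 3 → ℂ)} (hU : AnalyticAt ℂ U 0)
    (hV : ∀ᶠ q in 𝓝 0, U ![q 0, q 1, 0] = V q) (i : Fin 3) :
    (fun q => U q i - V q i) =O[𝓝 0] fun q : Fin 3 → ℂ => q 2 := by
  have h1 := hU.hasStrictFDerivAt.isBigO_sub
  have ht : Tendsto (fun q : Fin 3 → ℂ => (q, (![q 0, q 1, 0] : Fin 3 → ℂ))) (𝓝 0)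
      (𝓝 ((0 : Fin 3 → ℂ), (0 : Fin 3 → ℂ))) := by
    refine Continuous.tendsto' (by fun_prop) _ _ ?_
    simp
  have h2 := h1.comp_tendsto ht
  have h3 : (fun q => U q i - V q i) =O[𝓝 0] fun q : Fin 3 → ℂ => q - ![q 0, q 1, 0] := by
    refine IsBigO.trans (IsBigO.of_bound' ?_) h2
    filter_upwards [hV] with q hq
    rw [← hq]
    exact norm_le_pi_norm (U q - U ![q 0, q 1, 0]) i
  refine h3.trans (IsBigO.of_bound' (.of_forall fun q => ?_))
  rw [pi_norm_le_iff_of_nonneg (norm_nonneg _)]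
  intro k
  fin_cases k <;> simp

end STU

end

theorem mainTheorem8 :
    -- the normalized solutions and the mirror map exist
    (∃ (ϖ₀ : (Fin 3 → ℂ) → ℂ) (ϖ : Fin 3 → (Fin 3 → ℂ) → ℂ) (U : (Fin 3 → ℂ) → (Fin 3 → ℂ)),
      STU.IsStandardPeriods ϖ₀ ϖ ∧ STU.IsMirrorMap ϖ₀ ϖ U) ∧
    -- the normalization of the `j` function
    (fun q : ℂ => STU.j q - (1 / q + 744 + 196884 * q)) =O[𝓝[≠] 0] (fun q : ℂ => q ^ 2) ∧
    -- the mirror map and the period to leading order in `q₃`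
    ∀ (ϖ₀ : (Fin 3 → ℂ) → ℂ) (ϖ : Fin 3 → (Fin 3 → ℂ) → ℂ) (U : (Fin 3 → ℂ) → (Fin 3 → ℂ)),
      STU.IsStandardPeriods ϖ₀ ϖ → STU.IsMirrorMap ϖ₀ ϖ U →
        (fun q => U q 0 - STU.leadingU₁ (STU.qHat₁ q) (STU.qHat₂ q))
            =O[𝓝[{q : Fin 3 → ℂ | ∀ i, q i ≠ 0}] 0] (fun q => q 2) ∧
        (fun q => U q 1 - STU.leadingU₂ (STU.qHat₁ q) (STU.qHat₂ q))
            =O[𝓝[{q : Fin 3 → ℂ | ∀ i, q i ≠ 0}] 0] (fun q => q 2) ∧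
        ∀ᶠ p : ℂ × ℂ in 𝓝 0,
          Tendsto (fun q₃ : ℂ => ϖ₀ (U ![p.1, p.2, q₃])) (𝓝[≠] 0)
            (𝓝 (STU.E4 (STU.qHat₁ ![p.1, p.2, 0]) ^ (1 / 4 : ℂ) *
              STU.E4 (STU.qHat₂ ![p.1, p.2, 0]) ^ (1 / 4 : ℂ))) := by
  refine ⟨?_, STU.j_expansion, ?_⟩
  · obtain ⟨ϖ₀, ϖ, h⟩ := STU.exists_isStandardPeriods
    obtain ⟨U, hU⟩ := STU.exists_isMirrorMap h
    exact ⟨ϖ₀, ϖ, U, h, hU⟩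
  · intro ϖ₀ ϖ U h hU
    have hlead := hU.apply_divisor h
    have hO (i : Fin 3) : (fun q => U q i - STU.leadMap q i) =O[𝓝 0] fun q : Fin 3 → ℂ => q 2 :=
      STU.isBigO_sub_divisor hU.analyticAt hlead i
    refine ⟨((hO 0).mono nhdsWithin_le_nhds).congr' ?_ .rfl,
      ((hO 1).mono nhdsWithin_le_nhds).congr' ?_ .rfl, ?_⟩
    · filter_upwards [nhdsWithin_le_nhds STU.leadMap_eq_leadingU, self_mem_nhdsWithin] with q h1 h2
      rw [(h1 h2).1]
    · filter_upwards [nhdsWithin_le_nhds STU.leadMap_eq_leadingU, self_mem_nhdsWithin] with q h1 h2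
      rw [(h1 h2).2]
    · have hp : Tendsto (fun p : ℂ × ℂ => (![p.1, p.2, 0] : Fin 3 → ℂ)) (𝓝 0) (𝓝 0) := by
        refine Continuous.tendsto' ?_ _ _ ?_
        · fun_prop
        · simp
      have hcont : ∀ᶠ q in 𝓝 0, ContinuousAt (fun q => ϖ₀ (U q)) q :=
        STU.eventually_continuousAt (h.analyticAt.comp_of_eq hU.analyticAt hU.apply_zero)
      filter_upwards [hp.eventually hcont, hp.eventually hlead,
        hp.eventually (STU.period_leadMap h)] with p h1 h2 h3
      have hline : Tendsto (fun q₃ : ℂ => (![p.1, p.2, q₃] : Fin 3 → ℂ)) (𝓝[≠] 0)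
          (𝓝 ![p.1, p.2, 0]) :=
        (Continuous.tendsto' (by fun_prop) _ _ rfl).mono_left nhdsWithin_le_nhds
      have h4 := h1.tendsto.comp hline
      rw [show U ![p.1, p.2, 0] = STU.leadMap ![p.1, p.2, 0] from h2, h3] at h4
      exact h4
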